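/- **Setting.** Manifolds are smooth, finite-dimensional and Hausdorff. Let $\Gamma\rightrightarrows M$ be a Lie groupoid with source $\alpha$, target $\beta$ (submersions), identity section $\epsilon$, inversion $i$ and multiplication $(g,h)\mapsto gh$ (defined if $\beta(g)=\alpha(h)$), with left translations $l_g:\alpha^{-1}(\beta(g))\to\alpha^{-1}(\alpha(g))$, $l_g(k)=gk$, and right translations $r_g:\beta^{-1}(\alpha(g))\to\beta^{-1}(\beta(g))$, $r_g(k)=kg$. Let $E_\Gamma\to M$ be its Lie algebroid, with fibres $(E_\Gamma)_x=\ker T_{\epsilon(x)}\alpha$. For a section $X$ of $E_\Gamma$ put $\overleftarrow X(g)=T_{\epsilon(\beta(g))}l_g\,(X(\beta(g)))$ and $\overrightarrow X(g)=-T_{\epsilon(\alpha(g))}(r_g\circ i)(X(\alpha(g)))$; the bracket of $E_\Gamma$ is given by $\overleftarrow{[\![X,Y]\!]}=[\overleftarrow X,\overleftarrow Y]$. Let $\mathcal T^\Gamma\Gamma=V\beta\oplus V\alpha\to\Gamma$, where $V\alpha=\ker T\alpha$ and $V\beta=\ker T\beta$, be the Lie algebroid with anchor $\rho(X_g,Y_g)=X_g+Y_g$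 and bracket determined by $[\![(\overrightarrow X,\overleftarrow Y),(\overrightarrow{X'},\overleftarrow{Y'})]\!]=(-\overrightarrow{[\![X,X']\!]},\overleftarrow{[\![Y,Y']\!]})$, and let $d$ be its differential. For a smooth $L_d:\Gamma\to\mathbb R$ let $\Theta^+_{L_d}(g)(X_g,Y_g)=Y_g(L_d)$ and $\Omega_{L_d}=-d\Theta^+_{L_d}$; $L_d$ is *regular* if $\Omega_{L_d}$ is nondegenerate on $\mathcal T^\Gamma\Gamma$. A *discrete nonholonomic Lagrangian system* $(L_d,\mathcal M_c,\mathcal D_c)$ on $\Gamma$ consists of a regular $L_d$, a vector subbundle $\mathcal D_c\subseteq E_\Gamma$ of rank $r$ (over $M$), and an embedded submanifold $\mathcal M_c\subseteq\Gamma$ with $\dim\mathcal M_c=\dim M+r$. Its Legendre transformations $\mathbb F^{\pm}=\mathbb F^\pm(L_d,\mathcal M_c,\mathcal D_c):\mathcal M_c\to\mathcal D_c^*$ are $$\mathbb F^-(h)(v)=-v(L_d\circ r_h\circ i)\ \ (v\in\mathcal D_c(\alpha(h))),\qquad \mathbb F^+(g)(v)=v(L_d\circ l_g)\ \ (v\in\mathcal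 D_c(\beta(g))).$$ For $g,h\in\Gamma$ put $$F_h=\{(X_h,Y_h)\in\mathcal T^\Gamma_h\Gamma:\ \gamma(T_h(i\circ r_{h^{-1}})X_h)=0\ \ \forall\gamma\in\mathcal D_c(\alpha(h))^0\},$$ $$\bar F_g=\{(X_g,Y_g)\in\mathcal T^\Gamma_g\Gamma:\ \gamma(T_gl_{g^{-1}}Y_g)=0\ \ \forall\gamma\in\mathcal D_c(\beta(g))^0\},$$ where $\mathcal D_c(x)^0\subseteq(E_\Gamma)_x^*$ is the annihilator of $\mathcal D_c(x)$, and let $^\perp$ denote the orthogonal in $\mathcal T^\Gamma\Gamma$ with respect to $\Omega_{L_d}$. For $g,h\in\mathcal M_c$ put $\mathcal H_h=\rho^{-1}(T_h\mathcal M_c)\cap F_h$, $\bar{\mathcal H}_g=\rho^{-1}(T_g\mathcal M_c)\cap\bar F_g$, $$(\overleftarrow E_\Gamma)^{\mathcal M_c}_h=\{b\in(E_\Gamma)_{\beta(h)}:T_{\epsilon(\beta(h))}l_h(b)\in T_h\mathcal M_c\},\qquad (\overrightarrow E_\Gamma)^{\mathcal M_c}_g=\{a\in(E_\Gamma)_{\alpha(g)}:T_{\epsilon(\alpha(g))}(r_g\circ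 i)(a)\in T_g\mathcal M_c\}.$$ For $a\in(E_\Gamma)_{\alpha(g)}$ and $b\in(E_\Gamma)_{\beta(g)}$ put $$G^{L_d}_g(a,b)=\Omega_{L_d}(g)\big((-T_{\epsilon(\alpha(g))}(r_g\circ i)(a),0),(0,T_{\epsilon(\beta(g))}l_g(b))\big).$$ **Theorem.** Let $(L_d,\mathcal M_c,\mathcal D_c)$ be a discrete nonholonomic Lagrangian system on $\Gamma$. The following four conditions are equivalent: 1. $\mathbb F^-(L_d,\mathcal M_c,\mathcal D_c):\mathcal M_c\to\mathcal D_c^*$ is a local diffeomorphism. 2. For every $h\in\mathcal M_c$, $\rho^{-1}(T_h\mathcal M_c)\cap F_h^\perp=\{0\}$. 3. For every $h\in\mathcal M_c$, $\dim\mathcal H_h=2r$ and the restriction of $\Omega_{L_d}(h)$ to $\mathcal H_h$ is nondegenerate. 4. For every $h\in\mathcal M_c$, $\{b\in(\overleftarrow E_\Gamma)^{\mathcal M_c}_h:\ G^{L_d}_h(a,b)=0\ \ \forall a\in\mathcal D_c(\alpha(h))\}=\{0\}$. Likewise, the following four conditions are equivalent: 1. $\mathbb F^+(L_d,\mathcal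 M_c,\mathcal D_c):\mathcal M_c\to\mathcal D_c^*$ is a local diffeomorphism. 2. For every $g\in\mathcal M_c$, $\rho^{-1}(T_g\mathcal M_c)\cap\bar F_g^\perp=\{0\}$. 3. For every $g\in\mathcal M_c$, $\dim\bar{\mathcal H}_g=2r$ and the restriction of $\Omega_{L_d}(g)$ to $\bar{\mathcal H}_g$ is nondegenerate. 4. For every $g\in\mathcal M_c$, $\{a\in(\overrightarrow E_\Gamma)^{\mathcal M_c}_g:\ G^{L_d}_g(a,b)=0\ \ \forall b\in\mathcal D_c(\beta(g))\}=\{0\}$. -/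

import Mathlib

open scoped Manifold ContDiff Bundle
open Manifold

noncomputable section

/-- A Lie groupoid `Γ ⇉ M`: `Γ` and `M` are smooth manifolds modelled on the finite dimensional
spaces `EΓ` and `EM`.  The multiplication is written as a total map, but it is constrained (and
used) only on the set `Γ₂` of composable pairs; its values elsewhere are irrelevant. -/
structure LieGroupoid (EΓ EM Γ M : Type*)
    [NormedAddCommGroup EΓ] [NormedSpace ℝ EΓ] [NormedAddCommGroup EM] [NormedSpace ℝ EM]
    [TopologicalSpace Γ] [ChartedSpace EΓ Γ] [TopologicalSpace M] [ChartedSpace EM M] where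
  /-- the source `α` -/
  src : Γ → M
  /-- the target `β` -/
  tgt : Γ → M
  /-- the identity section `ε` -/
  one : M → Γ
  /-- the inversion `i` -/
  inv : Γ → Γ
  /-- the multiplication, `mul g h = gh` when `β(g) = α(h)` -/
  mul : Γ → Γ → Γ
  isSubmersion_src : IsSubmersion 𝓘(ℝ, EΓ) 𝓘(ℝ, EM) ∞ src
  isSubmersion_tgt : IsSubmersion 𝓘(ℝ, EΓ) 𝓘(ℝ, EM) ∞ tgt
  contMDiff_one : ContMDiff 𝓘(ℝ, EM) 𝓘(ℝ, EΓ) ∞ one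
  contMDiff_inv : ContMDiff 𝓘(ℝ, EΓ) 𝓘(ℝ, EΓ) ∞ inv
  contMDiffOn_mul : ContMDiffOn (𝓘(ℝ, EΓ).prod 𝓘(ℝ, EΓ)) 𝓘(ℝ, EΓ) ∞
    (fun p : Γ × Γ => mul p.1 p.2) {p | tgt p.1 = src p.2}
  src_mul : ∀ g h, tgt g = src h → src (mul g h) = src g
  tgt_mul : ∀ g h, tgt g = src h → tgt (mul g h) = tgt h
  mul_assoc : ∀ g h k, tgt g = src h → tgt h = src k → mul g (mul h k) = mul (mul g h) k
  src_one : ∀ x, src (one x) = x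
  tgt_one : ∀ x, tgt (one x) = x
  one_mul : ∀ g, mul (one (src g)) g = g
  mul_one : ∀ g, mul g (one (tgt g)) = g
  src_inv : ∀ g, src (inv g) = tgt g
  tgt_inv : ∀ g, tgt (inv g) = src g
  inv_mul : ∀ g, mul (inv g) g = one (tgt g)
  mul_inv : ∀ g, mul g (inv g) = one (src g)

namespace LieGroupoid

variable {EΓ EM Γ M : Type*}
  [NormedAddCommGroup EΓ] [NormedSpace ℝ EΓ] [NormedAddCommGroup EM] [NormedSpace ℝ EM]
  [TopologicalSpace Γ] [ChartedSpace EΓ Γ] [TopologicalSpace M] [ChartedSpace EM M]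
  (G : LieGroupoid EΓ EM Γ M)

/-- `v(f)`, the derivative of the function `f` on `Γ` along the tangent vector `v` at `g`. -/
def dirDeriv (f : Γ → ℝ) (g : Γ) (v : TangentSpace 𝓘(ℝ, EΓ) g) : ℝ :=
  mfderiv 𝓘(ℝ, EΓ) 𝓘(ℝ, ℝ) f g v

/-- `V_gα`, the vertical space of the source at `g`. -/
def vertSrc (g : Γ) : Submodule ℝ (TangentSpace 𝓘(ℝ, EΓ) g) :=
  LinearMap.ker (mfderiv 𝓘(ℝ, EΓ) 𝓘(ℝ, EM) G.src g).toLinearMap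

/-- `V_gβ`, the vertical space of the target at `g`. -/
def vertTgt (g : Γ) : Submodule ℝ (TangentSpace 𝓘(ℝ, EΓ) g) :=
  LinearMap.ker (mfderiv 𝓘(ℝ, EΓ) 𝓘(ℝ, EM) G.tgt g).toLinearMap

/-- `(E_Γ)_x = V_{ε(x)}α`, the fibre at `x` of the Lie algebroid of `Γ`. -/
def algFiber (x : M) : Submodule ℝ (TangentSpace 𝓘(ℝ, EΓ) (G.one x)) := G.vertSrc (G.one x)

/-! The tangent maps of the translations.  A translation lives on a fibre of the source or of the
target, and its tangent map is the derivative within that fibre.  Such a derivative is meaningful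
(uniquely determined) on the vectors tangent to the fibre, and is only applied to those. -/

/-- `T_{ε(β(g))} l_g`, where `l_g : α⁻¹(β(g)) → α⁻¹(α(g))`, `l_g(k) = gk`. -/
def tangentLeft (g : Γ) :
    TangentSpace 𝓘(ℝ, EΓ) (G.one (G.tgt g)) →L[ℝ] TangentSpace 𝓘(ℝ, EΓ) g :=
  mfderivWithin 𝓘(ℝ, EΓ) 𝓘(ℝ, EΓ) (fun k => G.mul g k) (G.src ⁻¹' {G.tgt g}) (G.one (G.tgt g))

/-- `T_{ε(α(g))} (r_g ∘ i)`, where `r_g ∘ i : α⁻¹(α(g)) → β⁻¹(β(g))`, `k ↦ k⁻¹g`. -/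
def tangentRightInv (g : Γ) :
    TangentSpace 𝓘(ℝ, EΓ) (G.one (G.src g)) →L[ℝ] TangentSpace 𝓘(ℝ, EΓ) g :=
  mfderivWithin 𝓘(ℝ, EΓ) 𝓘(ℝ, EΓ) (fun k => G.mul (G.inv k) g) (G.src ⁻¹' {G.src g})
    (G.one (G.src g))

/-- `T_g l_{g⁻¹}`, where `l_{g⁻¹} : α⁻¹(α(g)) → α⁻¹(β(g))`, `l_{g⁻¹}(k) = g⁻¹k`. -/
def tangentLeftBack (g : Γ) :
    TangentSpace 𝓘(ℝ, EΓ) g →L[ℝ] TangentSpace 𝓘(ℝ, EΓ) (G.one (G.tgt g)) :=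
  mfderivWithin 𝓘(ℝ, EΓ) 𝓘(ℝ, EΓ) (fun k => G.mul (G.inv g) k) (G.src ⁻¹' {G.src g}) g

/-- `T_h (i ∘ r_{h⁻¹})`, where `i ∘ r_{h⁻¹} : β⁻¹(β(h)) → α⁻¹(α(h))`, `k ↦ (kh⁻¹)⁻¹`. -/
def tangentInvRightBack (h : Γ) :
    TangentSpace 𝓘(ℝ, EΓ) h →L[ℝ] TangentSpace 𝓘(ℝ, EΓ) (G.one (G.src h)) :=
  mfderivWithin 𝓘(ℝ, EΓ) 𝓘(ℝ, EΓ) (fun k => G.inv (G.mul k (G.inv h))) (G.tgt ⁻¹' {G.tgt h}) h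

/-- A smooth section of the Lie algebroid `τ : E_Γ → M`. -/
structure AlgSection [IsManifold 𝓘(ℝ, EΓ) ∞ Γ] where
  /-- the underlying section of `TΓ` along `ε` -/
  val : ∀ x : M, TangentSpace 𝓘(ℝ, EΓ) (G.one x)
  mem : ∀ x, val x ∈ G.algFiber x
  smooth : ContMDiff 𝓘(ℝ, EM) 𝓘(ℝ, EΓ).tangent ∞
    (fun x => (⟨G.one x, val x⟩ : TangentBundle 𝓘(ℝ, EΓ) Γ))

/-- The left-invariant vector field `←X` of a section `X` of `E_Γ`:
`←X(g) = (T_{ε(β(g))} l_g)(X(β(g)))`. -/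
def leftField (X : ∀ x : M, TangentSpace 𝓘(ℝ, EΓ) (G.one x)) (g : Γ) :
    TangentSpace 𝓘(ℝ, EΓ) g :=
  G.tangentLeft g (X (G.tgt g))

/-- The right-invariant vector field `→X` of a section `X` of `E_Γ`:
`→X(g) = -(T_{ε(α(g))} (r_g ∘ i))(X(α(g)))`. -/
def rightField (X : ∀ x : M, TangentSpace 𝓘(ℝ, EΓ) (G.one x)) (g : Γ) :
    TangentSpace 𝓘(ℝ, EΓ) g :=
  -G.tangentRightInv g (X (G.src g))

/-! The Lie algebroid `T^ΓΓ = Vβ ⊕ Vα → Γ`. -/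

/-- The fibre `T_g^ΓΓ = V_gβ ⊕ V_gα`, as a space of pairs of tangent vectors. -/
def prol (g : Γ) : Submodule ℝ (TangentSpace 𝓘(ℝ, EΓ) g × TangentSpace 𝓘(ℝ, EΓ) g) :=
  (G.vertTgt g).prod (G.vertSrc g)

/-- The anchor `ρ(X_g, Y_g) = X_g + Y_g` of `T^ΓΓ`. -/
def anchor (g : Γ) :
    TangentSpace 𝓘(ℝ, EΓ) g × TangentSpace 𝓘(ℝ, EΓ) g →ₗ[ℝ] TangentSpace 𝓘(ℝ, EΓ) g :=
  LinearMap.fst ℝ _ _ + LinearMap.snd ℝ _ _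

/-- The section `(→X, ←Y)` of `T^ΓΓ`; these sections generate the module of all sections. -/
def prolSection (X Y : ∀ x : M, TangentSpace 𝓘(ℝ, EΓ) (G.one x)) (g : Γ) :
    TangentSpace 𝓘(ℝ, EΓ) g × TangentSpace 𝓘(ℝ, EΓ) g :=
  (G.rightField X g, G.leftField Y g)

/-- The bracket of `T^ΓΓ` on generating sections,
`⟦(→X, ←Y), (→X', ←Y')⟧ = (-→⟦X, X'⟧, ←⟦Y, Y'⟧)`.  The bracket of sections of `E_Γ` is defined by
`←⟦Y, Y'⟧ = [←Y, ←Y']`, and it satisfies `→⟦X, X'⟧ = -[→X, →X']`, so that this is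
`([→X, →X'], [←Y, ←Y'])`, with Lie brackets of vector fields on `Γ`. -/
def prolBracket (X Y X' Y' : ∀ x : M, TangentSpace 𝓘(ℝ, EΓ) (G.one x)) (g : Γ) :
    TangentSpace 𝓘(ℝ, EΓ) g × TangentSpace 𝓘(ℝ, EΓ) g :=
  (VectorField.mlieBracket 𝓘(ℝ, EΓ) (G.rightField X) (G.rightField X') g,
    VectorField.mlieBracket 𝓘(ℝ, EΓ) (G.leftField Y) (G.leftField Y') g)

/-- The algebroid differential `dμ(S, S')` at `g` of a 1-section `μ` of `(T^ΓΓ)*`, on generating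
sections `S = (→X, ←Y)` and `S' = (→X', ←Y')`:
`dμ(S, S') = ρ(S)(μ(S')) - ρ(S')(μ(S)) - μ(⟦S, S'⟧)`. -/
def prolDiffOn (μ : ∀ g : Γ, TangentSpace 𝓘(ℝ, EΓ) g × TangentSpace 𝓘(ℝ, EΓ) g → ℝ)
    (X Y X' Y' : ∀ x : M, TangentSpace 𝓘(ℝ, EΓ) (G.one x)) (g : Γ) : ℝ :=
  dirDeriv (fun k => μ k (G.prolSection X' Y' k)) g (anchor g (G.prolSection X Y g))
    - dirDeriv (fun k => μ k (G.prolSection X Y k)) g (anchor g (G.prolSection X' Y' g))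
    - μ g (G.prolBracket X Y X' Y' g)

variable [IsManifold 𝓘(ℝ, EΓ) ∞ Γ]

open Classical in
/-- A pair `(X, Y)` of sections of `E_Γ` with `(→X, ←Y)(g) = s` (it exists for every
`s ∈ T_g^ΓΓ`). -/
def extend (g : Γ) (s : TangentSpace 𝓘(ℝ, EΓ) g × TangentSpace 𝓘(ℝ, EΓ) g) :
    (∀ x : M, TangentSpace 𝓘(ℝ, EΓ) (G.one x)) × (∀ x : M, TangentSpace 𝓘(ℝ, EΓ) (G.one x)) :=
  if h : ∃ P : G.AlgSection × G.AlgSection, G.prolSection P.1.val P.2.val g = s then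
    (h.choose.1.val, h.choose.2.val)
  else (0, 0)

/-- The value `(dμ)(g)(s, s')` of the algebroid differential of a 1-section `μ` of `(T^ΓΓ)*` on
vectors `s, s' ∈ T_g^ΓΓ`: the vectors are extended to generating sections (the differential is
tensorial, so that the value does not depend on the extensions). -/
def prolDiff (μ : ∀ g : Γ, TangentSpace 𝓘(ℝ, EΓ) g × TangentSpace 𝓘(ℝ, EΓ) g → ℝ) (g : Γ)
    (s s' : TangentSpace 𝓘(ℝ, EΓ) g × TangentSpace 𝓘(ℝ, EΓ) g) : ℝ :=
  G.prolDiffOn μ (G.extend g s).1 (G.extend g s).2 (G.extend g s').1 (G.extend g s').2 g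

/-- The Poincaré-Cartan 1-section `Θ⁺_L(g)(X_g, Y_g) = Y_g(L)`. -/
def thetaPlus (L : Γ → ℝ) (g : Γ)
    (s : TangentSpace 𝓘(ℝ, EΓ) g × TangentSpace 𝓘(ℝ, EΓ) g) : ℝ :=
  dirDeriv L g s.2

/-- The Poincaré-Cartan 2-section `Ω_L = -dΘ⁺_L`. -/
def omega (L : Γ → ℝ) (g : Γ)
    (s s' : TangentSpace 𝓘(ℝ, EΓ) g × TangentSpace 𝓘(ℝ, EΓ) g) : ℝ :=
  -G.prolDiff (thetaPlus L) g s s'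

/-- A 2-form `B` is nondegenerate on the subspace `W`. -/
def NondegenerateOn {V : Type*} [AddCommGroup V] [Module ℝ V] (B : V → V → ℝ)
    (W : Submodule ℝ V) : Prop :=
  ∀ s ∈ W, (∀ s' ∈ W, B s s' = 0) → s = 0

/-- The discrete Lagrangian `L` is regular: `Ω_L` is nondegenerate on `T^ΓΓ`. -/
def IsRegular (L : Γ → ℝ) : Prop :=
  ∀ g, NondegenerateOn (G.omega L g) (G.prol g)

/-- The map `G_g^L : (E_Γ)_{α(g)} × (E_Γ)_{β(g)} → ℝ`,
`G_g^L(a, b) = Ω_L(g)((-T(r_g ∘ i)(a), 0), (0, T l_g(b)))`. -/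
def gForm (L : Γ → ℝ) (g : Γ) (a : TangentSpace 𝓘(ℝ, EΓ) (G.one (G.src g)))
    (b : TangentSpace 𝓘(ℝ, EΓ) (G.one (G.tgt g))) : ℝ :=
  G.omega L g (-G.tangentRightInv g a, 0) (0, G.tangentLeft g b)

/-- `γ ↦ γ_h^{(1,0)}`, `γ_h^{(1,0)}(X_h, Y_h) = γ(T_h(i ∘ r_{h⁻¹})(X_h))`.  Here and below an element
of `(E_Γ)_x^*` is given by a functional on `T_{ε(x)}Γ` restricting to it. -/
def lift10 (h : Γ) : Module.Dual ℝ (TangentSpace 𝓘(ℝ, EΓ) (G.one (G.src h))) →ₗ[ℝ]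
    Module.Dual ℝ (TangentSpace 𝓘(ℝ, EΓ) h × TangentSpace 𝓘(ℝ, EΓ) h) :=
  ((G.tangentInvRightBack h).toLinearMap ∘ₗ LinearMap.fst ℝ _ _).dualMap

/-- `γ ↦ γ_g^{(0,1)}`, `γ_g^{(0,1)}(X_g, Y_g) = γ(T_g l_{g⁻¹}(Y_g))`. -/
def lift01 (g : Γ) : Module.Dual ℝ (TangentSpace 𝓘(ℝ, EΓ) (G.one (G.tgt g))) →ₗ[ℝ]
    Module.Dual ℝ (TangentSpace 𝓘(ℝ, EΓ) g × TangentSpace 𝓘(ℝ, EΓ) g) :=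
  ((G.tangentLeftBack g).toLinearMap ∘ₗ LinearMap.snd ℝ _ _).dualMap

end LieGroupoid

/-- A (generalized) discrete nonholonomic Lagrangian system `(L_d, M_c, D_c)` on the Lie groupoid
`G`.  The embedded submanifold `M_c` is a manifold `C` (modelled on `EC`) with a smooth embedding
into `Γ`; the vector subbundle `D_c ⊆ E_Γ` is a smooth vector bundle `D → M` (with model fibre `FD`,
of dimension `r`) with a fibrewise injective smooth morphism (the inclusion) into `E_Γ`. -/
structure DiscreteNonholonomicSystem {EΓ EM Γ M : Type*}
    [NormedAddCommGroup EΓ] [NormedSpace ℝ EΓ] [NormedAddCommGroup EM] [NormedSpace ℝ EM]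
    [TopologicalSpace Γ] [ChartedSpace EΓ Γ] [IsManifold 𝓘(ℝ, EΓ) ∞ Γ]
  [TopologicalSpace M] [ChartedSpace EM M]
    (G : LieGroupoid EΓ EM Γ M)
    (EC C : Type*) [NormedAddCommGroup EC] [NormedSpace ℝ EC]
    [TopologicalSpace C] [ChartedSpace EC C]
    (FD : Type*) [NormedAddCommGroup FD] [NormedSpace ℝ FD]
    (D : M → Type*) [∀ x, AddCommGroup (D x)] [∀ x, Module ℝ (D x)]
    [∀ x, TopologicalSpace (D x)] [TopologicalSpace (Bundle.TotalSpace FD D)]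
    [FiberBundle FD D] where
  /-- the discrete Lagrangian `L_d` -/
  L : Γ → ℝ
  smooth_L : ContMDiff 𝓘(ℝ, EΓ) 𝓘(ℝ, ℝ) ∞ L
  regular : G.IsRegular L
  /-- the inclusion of `M_c` in `Γ` -/
  emb : C → Γ
  isSmoothEmbedding_emb : IsSmoothEmbedding 𝓘(ℝ, EC) 𝓘(ℝ, EΓ) ∞ emb
  /-- the inclusion of `D_c` in `E_Γ` -/
  incl : ∀ x : M, D x →L[ℝ] TangentSpace 𝓘(ℝ, EΓ) (G.one x)
  incl_mem : ∀ x v, incl x v ∈ G.algFiber x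
  injective_incl : ∀ x, Function.Injective (incl x)
  smooth_incl : ContMDiff (𝓘(ℝ, EM).prod 𝓘(ℝ, FD)) 𝓘(ℝ, EΓ).tangent ∞
    (fun p : Bundle.TotalSpace FD D =>
      (⟨G.one p.proj, incl p.proj p.snd⟩ : TangentBundle 𝓘(ℝ, EΓ) Γ))
  /-- `dim M_c = m + r`, where `m = dim M` and `r` is the rank of `D_c` -/
  finrank_eq : Module.finrank ℝ EC = Module.finrank ℝ EM + Module.finrank ℝ FD

namespace DiscreteNonholonomicSystem

variable {EΓ EM Γ M : Type*}
  [NormedAddCommGroup EΓ] [NormedSpace ℝ EΓ] [NormedAddCommGroup EM] [NormedSpace ℝ EM]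
  [TopologicalSpace Γ] [ChartedSpace EΓ Γ] [IsManifold 𝓘(ℝ, EΓ) ∞ Γ]
  [TopologicalSpace M] [ChartedSpace EM M]
  {G : LieGroupoid EΓ EM Γ M}
  {EC C : Type*} [NormedAddCommGroup EC] [NormedSpace ℝ EC]
  [TopologicalSpace C] [ChartedSpace EC C]
  {FD : Type*} [NormedAddCommGroup FD] [NormedSpace ℝ FD]
  {D : M → Type*} [∀ x, AddCommGroup (D x)] [∀ x, Module ℝ (D x)]
  [∀ x, TopologicalSpace (D x)] [TopologicalSpace (Bundle.TotalSpace FD D)]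
  [FiberBundle FD D]
  (S : DiscreteNonholonomicSystem G EC C FD D)

/-- `D_c(x)`, as a subspace of `(E_Γ)_x ⊆ T_{ε(x)}Γ`. -/
def constraint (x : M) : Submodule ℝ (TangentSpace 𝓘(ℝ, EΓ) (G.one x)) :=
  LinearMap.range (S.incl x).toLinearMap

/-- `T_hM_c ⊆ T_hΓ` at the point `h` of `M_c` (`h = S.emb c`). -/
def tangentC (c : C) : Submodule ℝ (TangentSpace 𝓘(ℝ, EΓ) (S.emb c)) :=
  LinearMap.range (mfderiv 𝓘(ℝ, EC) 𝓘(ℝ, EΓ) S.emb c).toLinearMap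

/-- The nonholonomic Legendre transformation `F⁻ : M_c → D_c^*`: `F⁻(h)(v) = -v(L_d ∘ r_h ∘ i)` for
`v ∈ D_c(α(h))`. -/
def legendreMinus (c : C) :
    Bundle.TotalSpace (FD →L[ℝ] ℝ) (fun x : M => D x →L[ℝ] Bundle.Trivial M ℝ x) :=
  ⟨G.src (S.emb c),
    -((mfderivWithin 𝓘(ℝ, EΓ) 𝓘(ℝ, ℝ) (fun k => S.L (G.mul (G.inv k) (S.emb c)))
        (G.src ⁻¹' {G.src (S.emb c)}) (G.one (G.src (S.emb c))) :
        TangentSpace 𝓘(ℝ, EΓ) (G.one (G.src (S.emb c))) →L[ℝ] ℝ).comp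
      (S.incl (G.src (S.emb c))))⟩

/-- The nonholonomic Legendre transformation `F⁺ : M_c → D_c^*`: `F⁺(g)(v) = v(L_d ∘ l_g)` for
`v ∈ D_c(β(g))`. -/
def legendrePlus (c : C) :
    Bundle.TotalSpace (FD →L[ℝ] ℝ) (fun x : M => D x →L[ℝ] Bundle.Trivial M ℝ x) :=
  ⟨G.tgt (S.emb c),
    (mfderivWithin 𝓘(ℝ, EΓ) 𝓘(ℝ, ℝ) (fun k => S.L (G.mul (S.emb c) k))
        (G.src ⁻¹' {G.tgt (S.emb c)}) (G.one (G.tgt (S.emb c))) :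
        TangentSpace 𝓘(ℝ, EΓ) (G.one (G.tgt (S.emb c))) →L[ℝ] ℝ).comp
      (S.incl (G.tgt (S.emb c)))⟩

/-- `F_h = {γ_h^{(1,0)} : γ ∈ D_c(α(h))⁰}⁰ ⊆ T_h^ΓΓ`. -/
def subF (h : Γ) : Submodule ℝ (TangentSpace 𝓘(ℝ, EΓ) h × TangentSpace 𝓘(ℝ, EΓ) h) :=
  G.prol h ⊓
    ((S.constraint (G.src h)).dualAnnihilator.map (G.lift10 h)).dualCoannihilator

/-- `F̄_g = {γ_g^{(0,1)} : γ ∈ D_c(β(g))⁰}⁰ ⊆ T_g^ΓΓ`. -/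
def subFbar (g : Γ) : Submodule ℝ (TangentSpace 𝓘(ℝ, EΓ) g × TangentSpace 𝓘(ℝ, EΓ) g) :=
  G.prol g ⊓
    ((S.constraint (G.tgt g)).dualAnnihilator.map (G.lift01 g)).dualCoannihilator

/-- The orthogonal `W^⊥` in `T_g^ΓΓ` of `W ⊆ T_g^ΓΓ` with respect to `Ω_{L_d}(g)`. -/
def orth (g : Γ) (W : Submodule ℝ (TangentSpace 𝓘(ℝ, EΓ) g × TangentSpace 𝓘(ℝ, EΓ) g)) :
    Set (TangentSpace 𝓘(ℝ, EΓ) g × TangentSpace 𝓘(ℝ, EΓ) g) :=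
  {s | s ∈ G.prol g ∧ ∀ s' ∈ W, G.omega S.L g s s' = 0}

/-- `ρ⁻¹(T_hM_c) ⊆ T_h^ΓΓ` at a point `h` of `M_c`. -/
def anchorPre (c : C) :
    Submodule ℝ (TangentSpace 𝓘(ℝ, EΓ) (S.emb c) × TangentSpace 𝓘(ℝ, EΓ) (S.emb c)) :=
  G.prol (S.emb c) ⊓ (S.tangentC c).comap (LieGroupoid.anchor (S.emb c))

/-- `H_h = ρ⁻¹(T_hM_c) ∩ F_h`. -/
def subH (c : C) :
    Submodule ℝ (TangentSpace 𝓘(ℝ, EΓ) (S.emb c) × TangentSpace 𝓘(ℝ, EΓ) (S.emb c)) :=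
  S.anchorPre c ⊓ S.subF (S.emb c)

/-- `H̄_g = ρ⁻¹(T_gM_c) ∩ F̄_g`. -/
def subHbar (c : C) :
    Submodule ℝ (TangentSpace 𝓘(ℝ, EΓ) (S.emb c) × TangentSpace 𝓘(ℝ, EΓ) (S.emb c)) :=
  S.anchorPre c ⊓ S.subFbar (S.emb c)

/-- `(←E_Γ)_h^{M_c} = {b ∈ (E_Γ)_{β(h)} : T l_h(b) ∈ T_hM_c}`. -/
def leftE (c : C) : Submodule ℝ (TangentSpace 𝓘(ℝ, EΓ) (G.one (G.tgt (S.emb c)))) :=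
  G.algFiber (G.tgt (S.emb c)) ⊓
    (S.tangentC c).comap (G.tangentLeft (S.emb c)).toLinearMap

/-- `(→E_Γ)_g^{M_c} = {a ∈ (E_Γ)_{α(g)} : T(r_g ∘ i)(a) ∈ T_gM_c}`. -/
def rightE (c : C) : Submodule ℝ (TangentSpace 𝓘(ℝ, EΓ) (G.one (G.src (S.emb c)))) :=
  G.algFiber (G.src (S.emb c)) ⊓
    (S.tangentC c).comap (G.tangentRightInv (S.emb c)).toLinearMap

end DiscreteNonholonomicSystem

end

/-!
Both families of conditions compare one bilinear pairing with the submanifold `M_c`.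

Left- and right-invariant vector fields commute, since `→X(←YL)` and `←Y(→XL)` are both the mixed
second derivative of `L (a(s)⁻¹ g b(t))` for curves `a`, `b` in the fibres of the source
(`dirDeriv_leftField_rightField_comm`). In the formula for `dΘ⁺_L` the terms without a
right-invariant field cancel (`prolDiffOn_thetaPlus`), so that, at `g`,
`Ω_L((→X, ←Y), (→X', ←Y')) = →X'(←YL) - →X(←Y'L)`. This depends on the values of the fields at `g`
only: each term is tensorial in both fields, again because they commute. Hence `Ω_L(g)` is a skew
bilinear form on `V_gβ ⊕ V_gα` for which both summands are isotropic (`omega_eq`,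
`exists_omega_bilinear`).

The second and third conditions are then equivalent to the fourth by symplectic linear algebra at
one point: `F_h = D ⊕ V_hα`, where `D ⊆ V_hβ` is the image of `D_c(α(h))` (`subF_eq`), and the
isotropic subspace `V_hα` is its own orthogonal because `L` is regular, so that `F_h^⊥` is the
orthogonal of `D` in `V_hα` (`mem_sup_orthogonal_iff`); the rest is a count of dimensions
(`finrank_and_nondegenerate_iff`), for which `dim M_c = dim M + r` gives
`dim (T_hM_c ∩ V_hα) ≥ r`.

For the first condition, in a local frame `σ` of `D_c` the coordinates of `F⁻` are the functions
`→σL` (`legendreMinus_apply`), so that `T_hF⁻` kills a vector of `T_hM_c` if and only if it lies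
in `V_hα` and is `Ω_L`-orthogonal to `D` (`mfderiv_legendreMinus_injective_iff`). As
`dim M_c = dim D_c^*`, by the inverse function theorem `F⁻` is a local diffeomorphism if and only
if these kernels vanish (`isLocalDiffeomorph_iff_mfderiv`). The statements for `F⁺` are obtained
with the roles of `Vα` and `Vβ` exchanged.

Tangent maps of translations are handled through curves in the fibres of the source and the target
(`HasVelocityAt`, `Manifold.IsSubmersion.exists_curves`): every vertical vector is the velocity of
such a curve, and the translations map velocities to velocities.
-/

section

open Set Filter Topology

/-! ### The inverse function theorem on manifolds -/

section InverseFunctionTheorem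

variable {E E' H' N P : Type*} [NormedAddCommGroup E] [NormedSpace ℝ E]
  [NormedAddCommGroup E'] [NormedSpace ℝ E'] [TopologicalSpace H']
  {J : ModelWithCorners ℝ E' H'} [J.Boundaryless]
  [TopologicalSpace N] [ChartedSpace E N] [IsManifold 𝓘(ℝ, E) ∞ N]
  [TopologicalSpace P] [ChartedSpace H' P] [IsManifold J ∞ P]

/-- The inverse function theorem on vector spaces, with a `C^∞` inverse on a whole neighbourhood
that may be taken as small as desired. -/
theorem exists_openPartialHomeomorph_contDiffOn [CompleteSpace E] {f : E → E'} {U : Set E} {a : E}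
    (hU : IsOpen U) (ha : a ∈ U) (hf : ContDiffOn ℝ ∞ f U) (f' : E ≃L[ℝ] E')
    (hf' : HasFDerivAt f (f' : E →L[ℝ] E') a) :
    ∃ e : OpenPartialHomeomorph E E', a ∈ e.source ∧ e.source ⊆ U ∧ (e : E → E') = f ∧
      ContDiffOn ℝ ∞ e.symm e.target := by
  have hfa : ContDiffAt ℝ ∞ f a := hf.contDiffAt (hU.mem_nhds ha)
  let e₀ := hfa.toOpenPartialHomeomorph f hf' (by simp)
  have he₀ : (e₀ : E → E') = f := rfl
  let W : Set E := U ∩ fderiv ℝ f ⁻¹' (interior (range ContinuousLinearEquiv.toContinuousLinearMap))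
  have hcont : ContinuousOn (fderiv ℝ f) U := hf.continuousOn_fderiv_of_isOpen hU (by simp)
  have hW : IsOpen W := hcont.isOpen_inter_preimage hU isOpen_interior
  have haW : a ∈ W := by
    refine ⟨ha, ?_⟩
    rw [mem_preimage, hf'.fderiv, mem_interior_iff_mem_nhds]
    exact f'.nhds
  refine ⟨e₀.restrOpen W hW, ⟨hfa.mem_toOpenPartialHomeomorph_source hf' (by simp), haW⟩,
    fun x hx => hx.2.1, he₀, fun y hy => ContDiffAt.contDiffWithinAt ?_⟩
  have hy' := (e₀.restrOpen W hW).map_target hy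
  obtain ⟨g, hg⟩ := interior_subset hy'.2.2
  have hfy : ContDiffAt ℝ ∞ f ((e₀.restrOpen W hW).symm y) :=
    hf.contDiffAt (hU.mem_nhds hy'.2.1)
  refine (e₀.restrOpen W hW).contDiffAt_symm (f₀' := g) hy ?_ hfy
  change HasFDerivAt f _ _
  rw [hg]
  exact (hfy.differentiableAt (by simp)).hasFDerivAt

/-- The inverse function theorem for a smooth map between manifolds without boundary. -/
theorem isLocalDiffeomorphAt_of_bijective_mfderiv [FiniteDimensional ℝ E] [FiniteDimensional ℝ E']
    {f : N → P} (hf : ContMDiff 𝓘(ℝ, E) J ∞ f) (x : N)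
    (hbij : Function.Bijective (mfderiv 𝓘(ℝ, E) J f x)) :
    IsLocalDiffeomorphAt 𝓘(ℝ, E) J ∞ f x := by
  have : CompleteSpace E := FiniteDimensional.complete ℝ E
  let φ := extChartAt 𝓘(ℝ, E) x
  let ψ := extChartAt J (f x)
  let U : Set E := φ.target ∩ φ.symm ⁻¹' (f ⁻¹' ψ.source)
  have hφt : IsOpen φ.target := isOpen_extChartAt_target x
  have hφs : IsOpen φ.source := isOpen_extChartAt_source x
  have hψt : IsOpen ψ.target := isOpen_extChartAt_target (f x)
  have hψs : IsOpen ψ.source := isOpen_extChartAt_source (f x)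
  have hφsm : ContMDiffOn 𝓘(ℝ, E) 𝓘(ℝ, E) ∞ φ.symm φ.target := contMDiffOn_extChartAt_symm x
  have hψsm : ContMDiffOn 𝓘(ℝ, E') J ∞ ψ.symm ψ.target := contMDiffOn_extChartAt_symm (f x)
  have hφm : ContMDiffOn 𝓘(ℝ, E) 𝓘(ℝ, E) ∞ φ φ.source := by
    simpa [φ] using contMDiffOn_extChartAt (I := 𝓘(ℝ, E)) (n := ∞) (x := x)
  have hψm : ContMDiffOn J 𝓘(ℝ, E') ∞ ψ ψ.source := by
    simpa [ψ] using contMDiffOn_extChartAt (I := J) (n := ∞) (x := f x)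
  have hU : IsOpen U :=
    hφsm.continuousOn.isOpen_inter_preimage hφt (hψs.preimage hf.continuous)
  have hxs : x ∈ φ.source := mem_extChartAt_source x
  have hfxs : f x ∈ ψ.source := mem_extChartAt_source (f x)
  have haU : φ x ∈ U := ⟨φ.map_source hxs, by simpa [φ.left_inv hxs] using hfxs⟩
  let F : E → E' := ψ ∘ f ∘ φ.symm
  have hF : ContDiffOn ℝ ∞ F U := by
    rw [← contMDiffOn_iff_contDiffOn]
    exact hψm.comp (hf.comp_contMDiffOn (hφsm.mono inter_subset_left)) (fun y hy => hy.2)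
  let A : E →L[ℝ] E' := mfderiv 𝓘(ℝ, E) J f x
  have hA : Function.Bijective A := hbij
  have hFd : HasFDerivAt F A (φ x) := by
    have h : HasFDerivWithinAt F A (range 𝓘(ℝ, E)) (φ x) :=
      ((hf x).mdifferentiableAt (by simp)).hasMFDerivAt.2
    have h2 : range 𝓘(ℝ, E) = univ := by simp
    rwa [h2, hasFDerivWithinAt_univ] at h
  let f' : E ≃L[ℝ] E' := (LinearEquiv.ofBijective A.toLinearMap hA).toContinuousLinearEquiv
  obtain ⟨e, hae, heU, heF, hes⟩ := exists_openPartialHomeomorph_contDiffOn hU haU hF f'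
    (hFd.congr_fderiv (by ext v; rfl))
  have hmaps : ∀ y ∈ e.source, e y ∈ ψ.target := fun y hy => by
    rw [heF]; exact ψ.map_source (heU hy).2
  let Φ : PartialEquiv N P := (φ.trans e.toPartialEquiv).trans ψ.symm
  have hsrc : Φ.source = φ.source ∩ φ ⁻¹' e.source := by
    ext y
    simp only [Φ, PartialEquiv.trans_source, mem_inter_iff, mem_preimage,
      PartialEquiv.symm_source]
    exact ⟨fun h => h.1, fun h => ⟨h, hmaps _ h.2⟩⟩
  have htgt : Φ.target = ψ.source ∩ ψ ⁻¹' e.target := by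
    ext y
    simp only [Φ, PartialEquiv.trans_target, PartialEquiv.symm_target, mem_inter_iff, mem_preimage]
    refine ⟨fun h => ⟨h.1, h.2.1⟩, fun h => ⟨h.1, h.2, ?_⟩⟩
    exact (heU (e.map_target h.2)).1
  let Ψ : PartialDiffeomorph 𝓘(ℝ, E) J N P ∞ :=
    { toPartialEquiv := Φ
      open_source := by
        rw [hsrc]; exact hφm.continuousOn.isOpen_inter_preimage hφs e.open_source
      open_target := by
        rw [htgt]; exact hψm.continuousOn.isOpen_inter_preimage hψs e.open_target
      contMDiffOn_toFun := by
        rw [hsrc]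
        have h1 : ContMDiffOn 𝓘(ℝ, E) 𝓘(ℝ, E') ∞ e e.source := by
          rw [contMDiffOn_iff_contDiffOn, heF]; exact hF.mono heU
        refine hψsm.comp (h1.comp (hφm.mono inter_subset_left) (fun y hy => hy.2)) ?_
        exact fun y hy => hmaps _ hy.2
      contMDiffOn_invFun := by
        rw [htgt]
        have h1 : ContMDiffOn 𝓘(ℝ, E') 𝓘(ℝ, E) ∞ e.symm e.target := by
          rw [contMDiffOn_iff_contDiffOn]; exact hes
        refine hφsm.comp (h1.comp (hψm.mono inter_subset_left) (fun y hy => hy.2)) ?_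
        exact fun y hy => (heU (e.map_target hy.2)).1 }
  refine ⟨Ψ, ?_, ?_⟩
  · change x ∈ Φ.source
    rw [hsrc]; exact ⟨hxs, hae⟩
  · intro y hy
    change y ∈ Φ.source at hy
    rw [hsrc] at hy
    change f y = ψ.symm (e (φ y))
    have h2 := (heU hy.2).2
    rw [mem_preimage, φ.left_inv hy.1, mem_preimage] at h2
    rw [heF]
    change f y = ψ.symm (ψ (f (φ.symm (φ y))))
    rw [φ.left_inv hy.1, ψ.left_inv h2]

end InverseFunctionTheorem

/-! ### The derivative of a map into a bundle -/

section TotalSpace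

variable {B F N E HB EB HN : Type*} {Z : B → Type*} [NormedAddCommGroup F] [NormedSpace ℝ F]
  [NormedAddCommGroup EB] [NormedSpace ℝ EB] [NormedAddCommGroup E] [NormedSpace ℝ E]
  [TopologicalSpace HB] {IB : ModelWithCorners ℝ EB HB} [TopologicalSpace HN]
  {I : ModelWithCorners ℝ E HN}
  [TopologicalSpace B] [ChartedSpace HB B] [TopologicalSpace N] [ChartedSpace HN N]
  [TopologicalSpace (Bundle.TotalSpace F Z)] [∀ x, TopologicalSpace (Z x)] [FiberBundle F Z]

/-- The derivative of a map into the total space of a bundle, in the trivialization at the value. -/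
theorem mfderiv_totalSpace {f : N → Bundle.TotalSpace F Z} {x : N}
    (hf : MDifferentiableAt I (IB.prod 𝓘(ℝ, F)) f x) (v : TangentSpace I x) :
    (mfderiv I (IB.prod 𝓘(ℝ, F)) f x v : EB × F) =
      ((mfderiv I IB (fun y => (f y).proj) x v : EB),
        (mfderiv I 𝓘(ℝ, F) (fun y => (trivializationAt F Z (f x).proj (f y)).2) x v : F)) := by
  obtain ⟨h1, h2⟩ := (mdifferentiableAt_totalSpace IB f).1 hf
  let A : E →L[ℝ] EB := mfderiv I IB (fun y => (f y).proj) x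
  let A' : E →L[ℝ] F :=
    mfderiv I 𝓘(ℝ, F) (fun y => (trivializationAt F Z (f x).proj (f y)).2) x
  have k1 : HasFDerivWithinAt (writtenInExtChartAt I IB x (fun y => (f y).proj)) A (range I)
    (extChartAt I x x) := h1.hasMFDerivAt.2
  have k2 : HasFDerivWithinAt (writtenInExtChartAt I 𝓘(ℝ, F) x
    (fun y => (trivializationAt F Z (f x).proj (f y)).2)) A' (range I)
    (extChartAt I x x) := h2.hasMFDerivAt.2
  have h : HasFDerivWithinAt (writtenInExtChartAt I (IB.prod 𝓘(ℝ, F)) x f) (A.prod A') (range I)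
      (extChartAt I x x) := by
    have key : ∀ z : E, (f ((extChartAt I x).symm z)).proj ∈
        (trivializationAt F Z (f x).proj).baseSet →
        writtenInExtChartAt I (IB.prod 𝓘(ℝ, F)) x f z =
          (writtenInExtChartAt I IB x (fun y => (f y).proj) z,
            writtenInExtChartAt I 𝓘(ℝ, F) x
              (fun y => (trivializationAt F Z (f x).proj (f y)).2) z) := by
      intro z hz
      simp only [writtenInExtChartAt, FiberBundle.extChartAt, Function.comp_apply,
        PartialEquiv.coe_trans, PartialEquiv.prod_coe,
        PartialEquiv.refl_coe, id_eq, extChartAt_model_space_eq_id]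
      congr 2
      exact (trivializationAt F Z (f x).proj).coe_fst' hz
    have hc : ContinuousAt (fun z => (f ((extChartAt I x).symm z)).proj) (extChartAt I x x) := by
      refine ContinuousAt.comp (f := (extChartAt I x).symm) (g := fun y => (f y).proj) ?_
        (continuousAt_extChartAt_symm x)
      rw [extChartAt_to_inv]
      exact h1.continuousAt
    have hmem : ∀ᶠ z in 𝓝 (extChartAt I x x), (f ((extChartAt I x).symm z)).proj ∈
        (trivializationAt F Z (f x).proj).baseSet := by
      refine hc.eventually ((trivializationAt F Z (f x).proj).open_baseSet.mem_nhds ?_)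
      change (f ((extChartAt I x).symm (extChartAt I x x))).proj ∈ _
      rw [extChartAt_to_inv]
      exact FiberBundle.mem_baseSet_trivializationAt' _
    refine (k1.prodMk k2).congr_of_eventuallyEq ?_ (key _ hmem.self_of_nhds)
    exact nhdsWithin_le_nhds (hmem.mono key)
  have h3 : HasMFDerivAt I (IB.prod 𝓘(ℝ, F)) f x (A.prod A') := ⟨hf.continuousAt, h⟩
  rw [h3.mfderiv]
  rfl

end TotalSpace

/-! ### Lie brackets and mixed derivatives -/

theorem two_le_infty : (2 : WithTop ℕ∞) ≤ ∞ := by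
  exact WithTop.coe_le_coe.2 (le_top : (2 : ℕ∞) ≤ ⊤)

section LieBracket

variable {E N : Type*} [NormedAddCommGroup E] [NormedSpace ℝ E]
  [TopologicalSpace N] [ChartedSpace E N] [IsManifold 𝓘(ℝ, E) ∞ N]

/-- A function's second mixed partial derivatives on `ℝ × ℝ` agree. -/
theorem deriv_deriv_comm {Φ : ℝ × ℝ → ℝ} (h : ContDiffAt ℝ 2 Φ (0, 0)) :
    deriv (fun s => deriv (fun t => Φ (s, t)) 0) 0 =
      deriv (fun t => deriv (fun s => Φ (s, t)) 0) 0 := by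
  have hd : ∀ᶠ p in 𝓝 ((0, 0) : ℝ × ℝ), DifferentiableAt ℝ Φ p := by
    filter_upwards [h.eventually (by simp)] with p hp using hp.differentiableAt (by simp)
  have hD : DifferentiableAt ℝ (fderiv ℝ Φ) (0, 0) :=
    (h.fderiv_right (m := 1) (by norm_num)).differentiableAt (by simp)
  have hsymm := h.isSymmSndFDerivAt (by simp)
  have c1 : ContinuousAt (fun s : ℝ => (s, (0 : ℝ))) 0 := by fun_prop
  have c2 : ContinuousAt (fun t : ℝ => ((0 : ℝ), t)) 0 := by fun_prop
  have e1 : (fun s => deriv (fun t => Φ (s, t)) 0) =ᶠ[𝓝 0] fun s => fderiv ℝ Φ (s, 0) (0, 1) := by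
    filter_upwards [c1.eventually hd] with s hs
    exact (hs.hasFDerivAt.comp_hasDerivAt (0 : ℝ)
      ((hasDerivAt_const (0 : ℝ) s).prodMk (hasDerivAt_id (0 : ℝ)))).deriv
  have e2 : (fun t => deriv (fun s => Φ (s, t)) 0) =ᶠ[𝓝 0] fun t => fderiv ℝ Φ (0, t) (1, 0) := by
    filter_upwards [c2.eventually hd] with t ht
    exact (ht.hasFDerivAt.comp_hasDerivAt (0 : ℝ)
      ((hasDerivAt_id (0 : ℝ)).prodMk (hasDerivAt_const (0 : ℝ) t))).deriv
  rw [e1.deriv_eq, e2.deriv_eq]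
  have d1 : HasDerivAt (fun s : ℝ => fderiv ℝ Φ (s, 0)) (fderiv ℝ (fderiv ℝ Φ) (0, 0) (1, 0)) 0 :=
    HasFDerivAt.comp_hasDerivAt (l := fderiv ℝ Φ) (f := fun s : ℝ => (s, (0 : ℝ))) (0 : ℝ)
      hD.hasFDerivAt ((hasDerivAt_id (0 : ℝ)).prodMk (hasDerivAt_const (0 : ℝ) (0 : ℝ)))
  have d2 : HasDerivAt (fun t : ℝ => fderiv ℝ Φ (0, t)) (fderiv ℝ (fderiv ℝ Φ) (0, 0) (0, 1)) 0 :=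
    HasFDerivAt.comp_hasDerivAt (l := fderiv ℝ Φ) (f := fun t : ℝ => ((0 : ℝ), t)) (0 : ℝ)
      hD.hasFDerivAt ((hasDerivAt_const (0 : ℝ) (0 : ℝ)).prodMk (hasDerivAt_id (0 : ℝ)))
  have d1' := (d1.clm_apply (hasDerivAt_const (0 : ℝ) ((0 : ℝ), (1 : ℝ)))).deriv
  have d2' := (d2.clm_apply (hasDerivAt_const (0 : ℝ) ((1 : ℝ), (0 : ℝ)))).deriv
  simp only [map_zero, add_zero] at d1' d2'
  rw [d1', d2']
  exact hsymm _ _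

/-- Differentiating a function along a vector field can be done in a chart. -/
theorem fderiv_comp_extChartAt_symm_mpullbackWithin {g : N} {k : N → ℝ} {y : E}
    (hy : y ∈ (extChartAt 𝓘(ℝ, E) g).target)
    (hk : MDifferentiableAt 𝓘(ℝ, E) 𝓘(ℝ, ℝ) k ((extChartAt 𝓘(ℝ, E) g).symm y))
    (V : ∀ k : N, TangentSpace 𝓘(ℝ, E) k) :
    fderiv ℝ (k ∘ (extChartAt 𝓘(ℝ, E) g).symm) y
      (VectorField.mpullbackWithin 𝓘(ℝ, E) 𝓘(ℝ, E) (extChartAt 𝓘(ℝ, E) g).symm V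
        (range 𝓘(ℝ, E)) y) =
      LieGroupoid.dirDeriv k ((extChartAt 𝓘(ℝ, E) g).symm y)
        (V ((extChartAt 𝓘(ℝ, E) g).symm y)) := by
  have hr : range 𝓘(ℝ, E) = univ := by simp
  have hinv := isInvertible_mfderivWithin_extChartAt_symm (I := 𝓘(ℝ, E)) hy
  have hd := mdifferentiableWithinAt_extChartAt_symm (I := 𝓘(ℝ, E)) hy
  rw [VectorField.mpullbackWithin_apply]
  rw [hr, mfderivWithin_univ] at *
  rw [mdifferentiableWithinAt_univ] at hd
  rw [← mfderiv_eq_fderiv, mfderiv_comp y hk hd]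
  change mfderiv 𝓘(ℝ, E) 𝓘(ℝ, ℝ) k _ (mfderiv 𝓘(ℝ, E) 𝓘(ℝ, E) _ y _) = _
  rw [hinv.self_apply_inverse]
  rfl

/-- The Lie bracket of vector fields acts on functions as a commutator of derivations. -/
theorem dirDeriv_mlieBracket [FiniteDimensional ℝ E] {L : N → ℝ} {g : N}
    (hL : ContMDiff 𝓘(ℝ, E) 𝓘(ℝ, ℝ) ∞ L) {V W : ∀ k : N, TangentSpace 𝓘(ℝ, E) k}
    (hV : MDifferentiableAt 𝓘(ℝ, E) 𝓘(ℝ, E).tangent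
      (fun k => (⟨k, V k⟩ : TangentBundle 𝓘(ℝ, E) N)) g)
    (hW : MDifferentiableAt 𝓘(ℝ, E) 𝓘(ℝ, E).tangent
      (fun k => (⟨k, W k⟩ : TangentBundle 𝓘(ℝ, E) N)) g)
    (hLV : MDifferentiableAt 𝓘(ℝ, E) 𝓘(ℝ, ℝ) (fun k => LieGroupoid.dirDeriv L k (V k)) g)
    (hLW : MDifferentiableAt 𝓘(ℝ, E) 𝓘(ℝ, ℝ) (fun k => LieGroupoid.dirDeriv L k (W k)) g) :
    LieGroupoid.dirDeriv L g (VectorField.mlieBracket 𝓘(ℝ, E) V W g) =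
      LieGroupoid.dirDeriv (fun k => LieGroupoid.dirDeriv L k (W k)) g (V g) -
      LieGroupoid.dirDeriv (fun k => LieGroupoid.dirDeriv L k (V k)) g (W g) := by
  have : CompleteSpace E := FiniteDimensional.complete ℝ E
  have : IsManifold 𝓘(ℝ, E) 2 N := IsManifold.of_le (n := ∞) two_le_infty
  have : IsManifold 𝓘(ℝ, E) 1 N := IsManifold.of_le (n := ∞) (by exact_mod_cast le_top)
  let φ := extChartAt 𝓘(ℝ, E) g
  have hr : range 𝓘(ℝ, E) = univ := by simp
  have hgt : φ g ∈ φ.target := mem_extChartAt_target g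
  have hgg : φ.symm (φ g) = g := extChartAt_to_inv g
  let V' : E → E := VectorField.mpullbackWithin 𝓘(ℝ, E) 𝓘(ℝ, E) φ.symm V (range 𝓘(ℝ, E))
  let W' : E → E := VectorField.mpullbackWithin 𝓘(ℝ, E) 𝓘(ℝ, E) φ.symm W (range 𝓘(ℝ, E))
  have hV' : DifferentiableAt ℝ V' (φ g) := by
    have h : DifferentiableWithinAt ℝ V' (φ.symm ⁻¹' univ ∩ range 𝓘(ℝ, E)) (φ g) :=
      (mdifferentiableWithinAt_univ.2 hV).differentiableWithinAt_mpullbackWithin_vectorField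
    rwa [preimage_univ, hr, univ_inter, differentiableWithinAt_univ] at h
  have hW' : DifferentiableAt ℝ W' (φ g) := by
    have h : DifferentiableWithinAt ℝ W' (φ.symm ⁻¹' univ ∩ range 𝓘(ℝ, E)) (φ g) :=
      (mdifferentiableWithinAt_univ.2 hW).differentiableWithinAt_mpullbackWithin_vectorField
    rwa [preimage_univ, hr, univ_inter, differentiableWithinAt_univ] at h
  let L' : E → ℝ := L ∘ φ.symm
  have hL' : ContDiffAt ℝ ∞ L' (φ g) := by
    rw [← contMDiffAt_iff_contDiffAt]
    exact (hL.comp_contMDiffOn (contMDiffOn_extChartAt_symm (I := 𝓘(ℝ, E)) g)).contMDiffAt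
      ((isOpen_extChartAt_target (I := 𝓘(ℝ, E)) g).mem_nhds hgt)
  have hD : DifferentiableAt ℝ (fderiv ℝ L') (φ g) :=
    (hL'.fderiv_right (m := 1) two_le_infty).differentiableAt (by simp)
  have hsymm : IsSymmSndFDerivAt ℝ L' (φ g) := hL'.isSymmSndFDerivAt (by simpa using two_le_infty)
  have hnear : ∀ᶠ y in 𝓝 (φ g), y ∈ φ.target :=
    (isOpen_extChartAt_target (I := 𝓘(ℝ, E)) g).mem_nhds hgt
  -- the function `X L`, read in the chart
  have hX : ∀ X : ∀ k : N, TangentSpace 𝓘(ℝ, E) k,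
      (fun k => LieGroupoid.dirDeriv L k (X k)) ∘ φ.symm =ᶠ[𝓝 (φ g)]
        fun y => fderiv ℝ L' y (VectorField.mpullbackWithin 𝓘(ℝ, E) 𝓘(ℝ, E) φ.symm X
          (range 𝓘(ℝ, E)) y) := fun X => by
    filter_upwards [hnear] with y hy
    exact (fderiv_comp_extChartAt_symm_mpullbackWithin hy
      ((hL _).mdifferentiableAt (by simp)) X).symm
  have hkey : ∀ (k : N → ℝ), MDifferentiableAt 𝓘(ℝ, E) 𝓘(ℝ, ℝ) k g →
      ∀ X : ∀ k : N, TangentSpace 𝓘(ℝ, E) k, LieGroupoid.dirDeriv k g (X g) =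
        fderiv ℝ (k ∘ φ.symm) (φ g) (VectorField.mpullbackWithin 𝓘(ℝ, E) 𝓘(ℝ, E) φ.symm X
          (range 𝓘(ℝ, E)) (φ g)) := fun k hk X => by
    have h := fderiv_comp_extChartAt_symm_mpullbackWithin hgt (by rwa [hgg]) X (k := k)
    rw [hgg] at h
    exact h.symm
  rw [hkey _ hLW V, hkey _ hLV W, (hX V).fderiv_eq, (hX W).fderiv_eq]
  change _ = fderiv ℝ (fun y => fderiv ℝ L' y (W' y)) (φ g) (V' (φ g)) -
    fderiv ℝ (fun y => fderiv ℝ L' y (V' y)) (φ g) (W' (φ g))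
  rw [fderiv_clm_apply hD hW', fderiv_clm_apply hD hV']
  simp only [add_apply, ContinuousLinearMap.comp_apply,
    ContinuousLinearMap.flip_apply]
  rw [hsymm (V' (φ g)) (W' (φ g))]
  have hbr : LieGroupoid.dirDeriv L g (VectorField.mlieBracket 𝓘(ℝ, E) V W g) =
      fderiv ℝ L' (φ g) (VectorField.lieBracket ℝ V' W' (φ g)) := by
    have hφd : MDifferentiableAt 𝓘(ℝ, E) 𝓘(ℝ, E) φ g :=
      mdifferentiableAt_extChartAt (mem_chart_source E g)
    have hL'd : MDifferentiableAt 𝓘(ℝ, E) 𝓘(ℝ, ℝ) L' (φ g) :=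
      (hL'.differentiableAt (by simp)).mdifferentiableAt
    have hLL : L =ᶠ[𝓝 g] L' ∘ φ := by
      filter_upwards [extChartAt_source_mem_nhds (I := 𝓘(ℝ, E)) g] with y hy
      change L y = L (φ.symm (φ y))
      rw [φ.left_inv hy]
    have hinv : (mfderiv 𝓘(ℝ, E) 𝓘(ℝ, E) φ g).IsInvertible :=
      isInvertible_mfderiv_extChartAt (mem_extChartAt_source g)
    rw [← VectorField.mlieBracketWithin_univ, VectorField.mlieBracketWithin_apply,
      LieGroupoid.dirDeriv, hLL.mfderiv_eq, mfderiv_comp g hL'd hφd]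
    change mfderiv 𝓘(ℝ, E) 𝓘(ℝ, ℝ) L' (φ g) (mfderiv 𝓘(ℝ, E) 𝓘(ℝ, E) φ g _) = _
    refine (congrArg _ (hinv.self_apply_inverse _)).trans ?_
    rw [mfderiv_eq_fderiv]
    change fderiv ℝ L' (φ g) (VectorField.lieBracketWithin ℝ V' W'
      (φ.symm ⁻¹' univ ∩ range 𝓘(ℝ, E)) (φ g)) = _
    rw [preimage_univ, hr, univ_inter, VectorField.lieBracketWithin_univ]
  rw [hbr, VectorField.lieBracket, map_sub]
  ring

end LieBracket

/-! ### Velocities of curves -/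

section Velocity

variable {E E' N P : Type*} [NormedAddCommGroup E] [NormedSpace ℝ E]
  [NormedAddCommGroup E'] [NormedSpace ℝ E']
  [TopologicalSpace N] [ChartedSpace E N] [TopologicalSpace P] [ChartedSpace E' P]

/-- The curve `γ` passes through `y` at time `0`, with velocity `v`.  The velocities are compared in
the model space `E`, so that `v` may be a tangent vector at `y` rather than at `γ 0`. -/
def HasVelocityAt (γ : ℝ → N) (y : N) (v : TangentSpace 𝓘(ℝ, E) y) : Prop :=
  γ 0 = y ∧ MDifferentiableAt 𝓘(ℝ, ℝ) 𝓘(ℝ, E) γ 0 ∧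
    @Eq E (mfderiv 𝓘(ℝ, ℝ) 𝓘(ℝ, E) γ 0 (1 : ℝ)) v

namespace HasVelocityAt

theorem unique {γ : ℝ → N} {y : N} {v w : TangentSpace 𝓘(ℝ, E) y} (hv : HasVelocityAt γ y v)
    (hw : HasVelocityAt γ y w) : v = w := hv.2.2.symm.trans hw.2.2

theorem congr {γ γ' : ℝ → N} {y : N} {v : TangentSpace 𝓘(ℝ, E) y} (h : HasVelocityAt γ y v)
    (hγ : γ' =ᶠ[𝓝 0] γ) : HasVelocityAt γ' y v := by
  refine ⟨hγ.self_of_nhds.trans h.1, h.2.1.congr_of_eventuallyEq hγ, ?_⟩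
  exact (congrArg (fun A : ℝ →L[ℝ] E => A 1) hγ.mfderiv_eq).trans h.2.2

theorem comp_mfderivWithin {γ : ℝ → N} {y : N} {v : TangentSpace 𝓘(ℝ, E) y}
    (h : HasVelocityAt γ y v) {f : N → P} {s : Set N}
    (hf : MDifferentiableWithinAt 𝓘(ℝ, E) 𝓘(ℝ, E') f s y) (hs : ∀ᶠ t in 𝓝 0, γ t ∈ s) :
    HasVelocityAt (fun t => f (γ t)) (f y) (mfderivWithin 𝓘(ℝ, E) 𝓘(ℝ, E') f s y v) := by
  obtain ⟨rfl, h, hv⟩ := h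
  have h1 := (HasMFDerivWithinAt.comp (0 : ℝ) hf.hasMFDerivWithinAt
    (h.hasMFDerivAt.hasMFDerivWithinAt (s := γ ⁻¹' s)) subset_rfl).hasMFDerivAt hs
  refine ⟨rfl, h1.mdifferentiableAt, ?_⟩
  refine (congrArg (fun A : ℝ →L[ℝ] E' => A 1) h1.mfderiv).trans ?_
  exact congrArg (mfderivWithin 𝓘(ℝ, E) 𝓘(ℝ, E') f s (γ 0)) hv

theorem comp_mfderiv {γ : ℝ → N} {y : N} {v : TangentSpace 𝓘(ℝ, E) y}
    (h : HasVelocityAt γ y v) {f : N → P}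
    (hf : MDifferentiableAt 𝓘(ℝ, E) 𝓘(ℝ, E') f y) :
    HasVelocityAt (fun t => f (γ t)) (f y) (mfderiv 𝓘(ℝ, E) 𝓘(ℝ, E') f y v) := by
  have h' := h.comp_mfderivWithin (mdifferentiableWithinAt_univ.2 hf) (by simp)
  rwa [mfderivWithin_univ] at h'

theorem of_hasDerivAt {γ : ℝ → E} {v : E} (h : HasDerivAt γ v 0) :
    HasVelocityAt γ (γ 0) v := by
  refine ⟨rfl, h.differentiableAt.mdifferentiableAt, ?_⟩
  rw [mfderiv_eq_fderiv]
  exact h.deriv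

theorem hasDerivAt {γ : ℝ → E} {y v : E} (h : HasVelocityAt γ y v) :
    HasDerivAt γ v 0 := by
  obtain ⟨-, h, hv⟩ := h
  rw [mfderiv_eq_fderiv] at hv
  rw [← hv]
  exact h.differentiableAt.hasDerivAt

theorem hasDerivAt_comp {γ : ℝ → N} {y : N} {v : TangentSpace 𝓘(ℝ, E) y}
    (h : HasVelocityAt γ y v) {f : N → ℝ}
    (hf : MDifferentiableAt 𝓘(ℝ, E) 𝓘(ℝ, ℝ) f y) :
    HasDerivAt (fun t => f (γ t)) (LieGroupoid.dirDeriv f y v) 0 :=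
  (h.comp_mfderiv hf).hasDerivAt

theorem eq_zero {γ : ℝ → N} {y : N} {v : TangentSpace 𝓘(ℝ, E) y}
    (h : HasVelocityAt γ y v) (hγ : ∀ᶠ t in 𝓝 0, γ t = y) : v = 0 := by
  refine h.unique (HasVelocityAt.congr (γ := fun _ => y) ⟨rfl, mdifferentiableAt_const, ?_⟩ hγ)
  rw [mfderiv_const]; rfl

end HasVelocityAt

end Velocity

/-! ### Submersions and immersions -/

section Submersion

variable {E E' EQ N P Q : Type*} [NormedAddCommGroup E] [NormedSpace ℝ E]
  [NormedAddCommGroup E'] [NormedSpace ℝ E'] [NormedAddCommGroup EQ] [NormedSpace ℝ EQ]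
  [TopologicalSpace N] [ChartedSpace E N]
  [TopologicalSpace P] [ChartedSpace E' P]
  [TopologicalSpace Q] [ChartedSpace EQ Q]

theorem mdifferentiable_of_mem_maximalAtlas {φ : OpenPartialHomeomorph N E}
    (hφ : φ ∈ IsManifold.maximalAtlas 𝓘(ℝ, E) ∞ N) :
    φ.MDifferentiable 𝓘(ℝ, E) 𝓘(ℝ, E) :=
  ⟨(contMDiffOn_of_mem_maximalAtlas hφ).mdifferentiableOn (by simp),
    (contMDiffOn_symm_of_mem_maximalAtlas hφ).mdifferentiableOn (by simp)⟩

/-- Charts `φ` at `y` and `ψ` at `f y` of the maximal atlases in which the submersion `f` is a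
linear surjection `p`. -/
structure SubmersionCharts (f : N → P) (y : N) where
  φ : OpenPartialHomeomorph N E
  ψ : OpenPartialHomeomorph P E'
  p : E →L[ℝ] E'
  hφ : φ ∈ IsManifold.maximalAtlas 𝓘(ℝ, E) ∞ N
  hψ : ψ ∈ IsManifold.maximalAtlas 𝓘(ℝ, E') ∞ P
  mem : y ∈ φ.source
  maps : ∀ z ∈ φ.source, f z ∈ ψ.source
  surj : Function.Surjective p
  eq : ∀ z ∈ φ.source, ψ (f z) = p (φ z)

theorem exists_submersionCharts {f : N → P} (hf : IsSubmersion 𝓘(ℝ, E) 𝓘(ℝ, E') ∞ f) (y : N) :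
    Nonempty (SubmersionCharts (E := E) (E' := E') f y) := by
  have h := hf.isSubmersionAt y
  refine ⟨⟨h.domChart, h.codChart, (ContinuousLinearMap.fst ℝ _ _).comp
    (h.equiv : E →L[ℝ] E' × h.complement), h.domChart_mem_maximalAtlas,
    h.codChart_mem_maximalAtlas, h.mem_domChart_source,
    fun z hz => h.source_subset_preimage_source hz,
    Prod.fst_surjective.comp h.equiv.surjective, fun z hz => ?_⟩⟩
  have := h.writtenInCharts (show h.domChart z ∈ _ by simp [h.domChart.map_source hz])
  simpa [h.domChart.left_inv hz] using this

namespace SubmersionCharts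

variable {f : N → P} {y : N} (S : SubmersionCharts (E := E) (E' := E') f y)

theorem mfderiv_eq (hf : ContMDiff 𝓘(ℝ, E) 𝓘(ℝ, E') ∞ f) {z : N} (hz : z ∈ S.φ.source)
    (v : TangentSpace 𝓘(ℝ, E) z) :
    mfderiv 𝓘(ℝ, E') 𝓘(ℝ, E') S.ψ (f z) (mfderiv 𝓘(ℝ, E) 𝓘(ℝ, E') f z v) =
      S.p (mfderiv 𝓘(ℝ, E) 𝓘(ℝ, E) S.φ z v) := by
  have hφd := (mdifferentiable_of_mem_maximalAtlas S.hφ).mdifferentiableAt hz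
  have hψd := (mdifferentiable_of_mem_maximalAtlas S.hψ).mdifferentiableAt (S.maps z hz)
  have h : S.ψ ∘ f =ᶠ[𝓝 z] S.p ∘ S.φ := by
    filter_upwards [S.φ.open_source.mem_nhds hz] with x hx using S.eq x hx
  have h1 := h.mfderiv_eq (I := 𝓘(ℝ, E)) (I' := 𝓘(ℝ, E'))
  rw [mfderiv_comp z hψd ((hf z).mdifferentiableAt (by simp)),
    mfderiv_comp z S.p.mdifferentiableAt hφd, ContinuousLinearMap.mfderiv_eq] at h1
  exact congrArg (fun A : E →L[ℝ] E' => A v) h1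

theorem mfderiv_eq_zero_iff (hf : ContMDiff 𝓘(ℝ, E) 𝓘(ℝ, E') ∞ f) {z : N} (hz : z ∈ S.φ.source)
    (v : TangentSpace 𝓘(ℝ, E) z) :
    mfderiv 𝓘(ℝ, E) 𝓘(ℝ, E') f z v = 0 ↔ S.p (mfderiv 𝓘(ℝ, E) 𝓘(ℝ, E) S.φ z v) = 0 := by
  rw [← S.mfderiv_eq hf hz v]
  refine ⟨fun h => by rw [h]; exact map_zero _, fun h => ?_⟩
  refine (mdifferentiable_of_mem_maximalAtlas S.hψ).mfderiv_injective (S.maps z hz) ?_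
  rw [h]; exact (map_zero _).symm

end SubmersionCharts

theorem Manifold.IsSubmersion.mfderiv_surjective {f : N → P}
    (hf : IsSubmersion 𝓘(ℝ, E) 𝓘(ℝ, E') ∞ f) (y : N) :
    Function.Surjective (mfderiv 𝓘(ℝ, E) 𝓘(ℝ, E') f y) := by
  obtain ⟨S⟩ := exists_submersionCharts hf y
  intro w
  obtain ⟨u, hu⟩ := S.surj (mfderiv 𝓘(ℝ, E') 𝓘(ℝ, E') S.ψ (f y) w)
  obtain ⟨v, hv⟩ := (mdifferentiable_of_mem_maximalAtlas S.hφ).mfderiv_surjective S.mem u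
  refine ⟨v, (mdifferentiable_of_mem_maximalAtlas S.hψ).mfderiv_injective (S.maps y S.mem) ?_⟩
  rw [S.mfderiv_eq hf.contMDiff S.mem, hv]
  exact hu

variable [IsManifold 𝓘(ℝ, E) ∞ N]

/-- A smooth family of vectors `X q` at `σ q`, tangent to the fibres of a submersion `f`, is the
family of velocities of a smooth family of curves in the fibres. -/
theorem Manifold.IsSubmersion.exists_curves {f : N → P} (hf : IsSubmersion 𝓘(ℝ, E) 𝓘(ℝ, E') ∞ f)
    {σ : Q → N} {X : ∀ q, TangentSpace 𝓘(ℝ, E) (σ q)} {q₀ : Q}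
    (hX : ContMDiffAt 𝓘(ℝ, EQ) 𝓘(ℝ, E).tangent ∞
      (fun q => (⟨σ q, X q⟩ : TangentBundle 𝓘(ℝ, E) N)) q₀)
    (hv : ∀ q, mfderiv 𝓘(ℝ, E) 𝓘(ℝ, E') f (σ q) (X q) = 0) :
    ∃ c : Q × ℝ → N, ContMDiffAt (𝓘(ℝ, EQ).prod 𝓘(ℝ, ℝ)) 𝓘(ℝ, E) ∞ c (q₀, 0) ∧
      (∀ᶠ p in 𝓝 (q₀, (0 : ℝ)), f (c p) = f (σ p.1)) ∧
      ∀ᶠ q in 𝓝 q₀, HasVelocityAt (fun t => c (q, t)) (σ q) (X q) := by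
  have : IsManifold 𝓘(ℝ, E) 1 N := IsManifold.of_le (n := ∞) (by exact_mod_cast le_top)
  obtain ⟨S⟩ := exists_submersionCharts hf (σ q₀)
  have hfs := hf.contMDiff
  have hφm := mdifferentiable_of_mem_maximalAtlas S.hφ
  have hσ : ContMDiffAt 𝓘(ℝ, EQ) 𝓘(ℝ, E) ∞ σ q₀ := ((Bundle.contMDiffAt_totalSpace).1 hX).1
  have hσs : ∀ᶠ q in 𝓝 q₀, σ q ∈ S.φ.source :=
    hσ.continuousAt.eventually (S.φ.open_source.mem_nhds S.mem)
  let w : Q → E := fun q => mfderiv 𝓘(ℝ, E) 𝓘(ℝ, E) S.φ (σ q) (X q)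
  have hw : ContMDiffAt 𝓘(ℝ, EQ) 𝓘(ℝ, E) ∞ w q₀ := by
    have h1 := (contMDiffOn_of_mem_maximalAtlas S.hφ).contMDiffOn_tangentMapWithin
      (m := ∞) (by simp) S.φ.open_source.uniqueMDiffOn
    have h2 := h1.contMDiffAt (x := (⟨σ q₀, X q₀⟩ : TangentBundle 𝓘(ℝ, E) N))
      ((S.φ.open_source.preimage (FiberBundle.continuous_proj E _)).mem_nhds S.mem)
    have h3 := (contMDiff_snd_tangentBundle_modelSpace (n := ∞) E 𝓘(ℝ, E)).contMDiffAt.comp q₀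
      (h2.comp q₀ hX)
    refine h3.congr_of_eventuallyEq ?_
    filter_upwards [hσs] with q hq
    exact congrArg (fun A : E →L[ℝ] E => A (X q))
      (mfderivWithin_of_isOpen (I := 𝓘(ℝ, E)) (I' := 𝓘(ℝ, E)) (f := S.φ) S.φ.open_source hq).symm
  let a : Q × ℝ → E := fun p => S.φ (σ p.1) + p.2 • w p.1
  have ha : ContMDiffAt (𝓘(ℝ, EQ).prod 𝓘(ℝ, ℝ)) 𝓘(ℝ, E) ∞ a (q₀, 0) := by
    have h1 : ContMDiffAt 𝓘(ℝ, EQ) 𝓘(ℝ, E) ∞ (fun q => S.φ (σ q)) q₀ :=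
      ((contMDiffOn_of_mem_maximalAtlas S.hφ).contMDiffAt
        (S.φ.open_source.mem_nhds S.mem)).comp q₀ hσ
    have h1' : ContMDiffAt (𝓘(ℝ, EQ).prod 𝓘(ℝ, ℝ)) 𝓘(ℝ, E) ∞
        (fun p : Q × ℝ => S.φ (σ p.1)) (q₀, 0) :=
      ContMDiffAt.comp (q₀, (0 : ℝ)) (g := fun q => S.φ (σ q)) (f := Prod.fst) h1 contMDiffAt_fst
    have h2' : ContMDiffAt (𝓘(ℝ, EQ).prod 𝓘(ℝ, ℝ)) 𝓘(ℝ, E) ∞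
        (fun p : Q × ℝ => w p.1) (q₀, 0) :=
      ContMDiffAt.comp (q₀, (0 : ℝ)) (g := w) (f := Prod.fst) hw contMDiffAt_fst
    exact h1'.add (contMDiffAt_snd.smul h2')
  have ha0 : ∀ q, a (q, 0) = S.φ (σ q) := fun q => by simp [a]
  have hat : ∀ᶠ p in 𝓝 (q₀, (0 : ℝ)), a p ∈ S.φ.target := by
    refine ha.continuousAt.eventually (S.φ.open_target.mem_nhds ?_)
    rw [ha0]; exact S.φ.map_source S.mem
  refine ⟨fun p => S.φ.symm (a p), ?_, ?_, ?_⟩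
  · refine ((contMDiffOn_symm_of_mem_maximalAtlas S.hφ).contMDiffAt
      (S.φ.open_target.mem_nhds hat.self_of_nhds)).comp (q₀, (0 : ℝ)) ha
  · filter_upwards [hat, continuousAt_fst.eventually hσs] with p hp hq
    have hs := S.φ.map_target hp
    refine S.ψ.injOn (S.maps _ hs) (S.maps _ hq) ?_
    rw [S.eq _ hs, S.eq _ hq, S.φ.right_inv hp, map_add, map_smul,
      (S.mfderiv_eq_zero_iff hfs hq (X p.1)).1 (hv p.1), smul_zero, add_zero]
  · filter_upwards [hσs] with q hq
    have h1 : HasDerivAt (fun t : ℝ => a (q, t)) (w q) 0 := by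
      simpa [a] using ((hasDerivAt_id (0 : ℝ)).smul_const (w q)).const_add (S.φ (σ q))
    have h2 := HasVelocityAt.of_hasDerivAt h1
    have ht : a (q, 0) ∈ S.φ.target := by rw [ha0]; exact S.φ.map_source hq
    have h3 := h2.comp_mfderiv (f := S.φ.symm) (hφm.symm.mdifferentiableAt ht)
    have h4 : S.φ.symm (a (q, 0)) = σ q := by rw [ha0, S.φ.left_inv hq]
    refine ⟨h4, h3.2.1, h3.2.2.trans ?_⟩
    rw [ha0]
    exact congrArg (fun A : E →L[ℝ] E => A (X q)) (hφm.symm_comp_deriv hq)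

/-- A vector in the kernel of a submersion is the velocity of a smooth curve in the fibre. -/
theorem Manifold.IsSubmersion.exists_curve {f : N → P}
    (hf : IsSubmersion 𝓘(ℝ, E) 𝓘(ℝ, E') ∞ f) {y : N}
    {v : TangentSpace 𝓘(ℝ, E) y} (hv : mfderiv 𝓘(ℝ, E) 𝓘(ℝ, E') f y v = 0) :
    ∃ γ : ℝ → N, ContMDiffAt 𝓘(ℝ, ℝ) 𝓘(ℝ, E) ∞ γ 0 ∧ HasVelocityAt γ y v ∧
      ∀ᶠ t in 𝓝 0, f (γ t) = f y := by
  obtain ⟨c, hc, hfc, hcv⟩ := hf.exists_curves (Q := ℝ) (EQ := ℝ) (σ := fun _ => y)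
    (X := fun _ => v) (q₀ := 0) contMDiffAt_const (fun _ => hv)
  have hp : ContMDiffAt 𝓘(ℝ, ℝ) (𝓘(ℝ, ℝ).prod 𝓘(ℝ, ℝ)) ∞ (fun t : ℝ => ((0 : ℝ), t)) 0 :=
    contMDiffAt_const.prodMk contMDiffAt_id
  exact ⟨fun t => c (0, t), hc.comp (0 : ℝ) hp, hcv.self_of_nhds,
    hp.continuousAt.eventually hfc⟩

/-- A vector in the kernel of a submersion `f`, at a point of a smooth section `σ`, extends to a
smooth family of such vectors along `σ`. -/
theorem Manifold.IsSubmersion.exists_vertical_extension [FiniteDimensional ℝ E'] [T2Space P]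
    [IsManifold 𝓘(ℝ, E') ∞ P] {f : N → P}
    (hf : IsSubmersion 𝓘(ℝ, E) 𝓘(ℝ, E') ∞ f) {σ : P → N} (hσ : ContMDiff 𝓘(ℝ, E') 𝓘(ℝ, E) ∞ σ)
    {x : P} {v : TangentSpace 𝓘(ℝ, E) (σ x)} (hv : mfderiv 𝓘(ℝ, E) 𝓘(ℝ, E') f (σ x) v = 0) :
    ∃ X : ∀ q, TangentSpace 𝓘(ℝ, E) (σ q), X x = v ∧
      (∀ q, mfderiv 𝓘(ℝ, E) 𝓘(ℝ, E') f (σ q) (X q) = 0) ∧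
      ContMDiff 𝓘(ℝ, E') 𝓘(ℝ, E).tangent ∞ (fun q => (⟨σ q, X q⟩ : TangentBundle 𝓘(ℝ, E) N)) := by
  have : IsManifold 𝓘(ℝ, E) 1 N := IsManifold.of_le (n := ∞) (by exact_mod_cast le_top)
  obtain ⟨S⟩ := exists_submersionCharts hf (σ x)
  have hfs := hf.contMDiff
  have hφm := mdifferentiable_of_mem_maximalAtlas S.hφ
  have hU : IsOpen (σ ⁻¹' S.φ.source) := S.φ.open_source.preimage hσ.continuous
  obtain ⟨b, -, hb⟩ := (SmoothBumpFunction.nhds_basis_tsupport (I := 𝓘(ℝ, E')) x).mem_iff.1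
    (hU.mem_nhds S.mem)
  let w : E := mfderiv 𝓘(ℝ, E) 𝓘(ℝ, E) S.φ (σ x) v
  have hw : S.p w = 0 := (S.mfderiv_eq_zero_iff hfs S.mem v).1 hv
  let X₀ : ∀ q, E := fun q => mfderiv 𝓘(ℝ, E) 𝓘(ℝ, E) S.φ.symm (S.φ (σ q)) (b q • w)
  have hX0 : ∀ q, b q = 0 → X₀ q = 0 := fun q hq => by
    simp only [X₀]
    rw [hq, zero_smul]
    exact map_zero _
  refine ⟨X₀, ?_, fun q => ?_, fun q => ?_⟩
  · simp only [X₀]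
    rw [b.eq_one, one_smul]
    exact congrArg (fun A : E →L[ℝ] E => A v) (hφm.symm_comp_deriv S.mem)
  · by_cases hq : σ q ∈ S.φ.source
    · refine (S.mfderiv_eq_zero_iff hfs hq _).2 ?_
      have h : ∀ z, z = σ q → (mfderiv 𝓘(ℝ, E) 𝓘(ℝ, E) S.φ z (X₀ q) : E) = b q • w := by
        intro z hz
        have h := congrArg (fun A : E →L[ℝ] E => A (b q • w))
          (hφm.comp_symm_deriv (S.φ.map_source hq))
        rw [S.φ.left_inv hq] at h
        subst hz
        exact h
      refine (congrArg S.p (h _ rfl)).trans ?_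
      rw [map_smul, hw, smul_zero]
    · have : b q = 0 := by
        by_contra hne
        exact hq (hb (subset_tsupport _ hne))
      rw [hX0 q this]
      exact map_zero _
  · by_cases hq : q ∈ tsupport b
    · have hqs : σ q ∈ S.φ.source := hb hq
      have h1 := (contMDiffOn_symm_of_mem_maximalAtlas S.hφ).contMDiffOn_tangentMapWithin
        (m := ∞) (by simp) S.φ.open_target.uniqueMDiffOn
      have hqt := S.φ.map_source hqs
      have h2 := h1.contMDiffAt (x := (⟨S.φ (σ q), b q • w⟩ : TangentBundle 𝓘(ℝ, E) E))
        ((S.φ.open_target.preimage (FiberBundle.continuous_proj E _)).mem_nhds hqt)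
      have h3 : ContMDiffAt 𝓘(ℝ, E') 𝓘(ℝ, E) ∞ (fun q => S.φ (σ q)) q :=
        ((contMDiffOn_of_mem_maximalAtlas S.hφ).contMDiffAt
          (S.φ.open_source.mem_nhds hqs)).comp q (hσ q)
      have h4 : ContMDiffAt 𝓘(ℝ, E') 𝓘(ℝ, E).tangent ∞
          (fun q => (⟨S.φ (σ q), b q • w⟩ : TangentBundle 𝓘(ℝ, E) E)) q := by
        rw [Bundle.contMDiffAt_totalSpace]
        refine ⟨h3, ?_⟩
        simp only [trivializationAt_model_space_apply]
        exact b.contMDiffAt.smul contMDiffAt_const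
      have h5 := h2.comp q h4
      refine h5.congr_of_eventuallyEq ?_
      filter_upwards [hU.mem_nhds hqs] with q' hq'
      have h6 := mfderivWithin_of_isOpen (I := 𝓘(ℝ, E)) (I' := 𝓘(ℝ, E)) (f := S.φ.symm)
        S.φ.open_target (S.φ.map_source hq')
      have h7 : ∀ (z : N) (u : E), z = σ q' →
          (⟨z, u⟩ : TangentBundle 𝓘(ℝ, E) N) = ⟨σ q', u⟩ := by
        rintro _ u rfl; rfl
      refine Eq.trans ?_ (h7 _ _ (S.φ.left_inv hq')).symm
      exact congrArg (fun A : E →L[ℝ] E => (⟨σ q', A (b q' • w)⟩ : TangentBundle 𝓘(ℝ, E) N)) h6.symm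
    · have h0 : ∀ᶠ q' in 𝓝 q, X₀ q' = 0 := by
        filter_upwards [(isClosed_tsupport b).isOpen_compl.mem_nhds hq] with q' hq'
        exact hX0 q' (image_eq_zero_of_notMem_tsupport hq')
      refine ((Bundle.contMDiff_zeroSection (n := ∞) (IB := 𝓘(ℝ, E)) ℝ
        (TangentSpace 𝓘(ℝ, E) : N → Type _)).comp hσ).contMDiffAt.congr_of_eventuallyEq ?_
      filter_upwards [h0] with q' hq'
      exact congrArg (Bundle.TotalSpace.mk (σ q')) hq'

end Submersion

section Immersion

variable {E E' N P : Type*} [NormedAddCommGroup E] [NormedSpace ℝ E]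
  [NormedAddCommGroup E'] [NormedSpace ℝ E']
  [TopologicalSpace N] [ChartedSpace E N]
  [TopologicalSpace P] [ChartedSpace E' P]

theorem Manifold.IsImmersion.mfderiv_injective {f : N → P} (hf : IsImmersion 𝓘(ℝ, E) 𝓘(ℝ, E') ∞ f)
    (y : N) : Function.Injective (mfderiv 𝓘(ℝ, E) 𝓘(ℝ, E') f y) := by
  have h := hf.isImmersionAt y
  have hφm := mdifferentiable_of_mem_maximalAtlas h.domChart_mem_maximalAtlas
  have hψm := mdifferentiable_of_mem_maximalAtlas h.codChart_mem_maximalAtlas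
  have hy := h.mem_domChart_source
  let A : E →L[ℝ] E' := (h.equiv : (E × h.complement) →L[ℝ] E').comp
    (ContinuousLinearMap.inl ℝ E h.complement)
  have hA : Function.Injective A := h.equiv.injective.comp LinearMap.inl_injective
  have heq : h.codChart ∘ f =ᶠ[𝓝 y] A ∘ h.domChart := by
    filter_upwards [h.domChart.open_source.mem_nhds hy] with z hz
    have := h.writtenInCharts (show h.domChart z ∈ _ by simp [h.domChart.map_source hz])
    simpa [h.domChart.left_inv hz, A] using this
  have h1 := heq.mfderiv_eq (I := 𝓘(ℝ, E)) (I' := 𝓘(ℝ, E'))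
  rw [mfderiv_comp y (hψm.mdifferentiableAt h.mem_codChart_source)
      ((hf.contMDiff y).mdifferentiableAt (by simp)),
    mfderiv_comp y A.mdifferentiableAt (hφm.mdifferentiableAt hy),
    ContinuousLinearMap.mfderiv_eq] at h1
  intro v w hvw
  refine hφm.mfderiv_injective hy (hA ?_)
  have hv := congrArg (fun A : E →L[ℝ] E' => A v) h1
  have hw := congrArg (fun A : E →L[ℝ] E' => A w) h1
  exact hv.symm.trans ((congrArg _ hvw).trans hw)

end Immersion

section VelocityFields

variable {E E' N P : Type*} [NormedAddCommGroup E] [NormedSpace ℝ E]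
  [NormedAddCommGroup E'] [NormedSpace ℝ E']
  [TopologicalSpace N] [ChartedSpace E N] [IsManifold 𝓘(ℝ, E) ∞ N]
  [TopologicalSpace P] [ChartedSpace E' P] [IsManifold 𝓘(ℝ, E') ∞ P]

/-- The velocities of a smooth family of curves form a smooth family of vectors. -/
theorem contMDiffAt_velocity {F : N × ℝ → P} {k₀ : N}
    (hF : ContMDiffAt (𝓘(ℝ, E).prod 𝓘(ℝ, ℝ)) 𝓘(ℝ, E') ∞ F (k₀, 0)) {σ : N → P}
    {V : ∀ k, TangentSpace 𝓘(ℝ, E') (σ k)}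
    (hV : ∀ᶠ k in 𝓝 k₀, HasVelocityAt (fun t => F (k, t)) (σ k) (V k)) :
    ContMDiffAt 𝓘(ℝ, E) 𝓘(ℝ, E').tangent ∞
      (fun k => (⟨σ k, V k⟩ : TangentBundle 𝓘(ℝ, E') P)) k₀ := by
  have : IsManifold 𝓘(ℝ, E') 1 P := IsManifold.of_le (n := ∞) (by exact_mod_cast le_top)
  have h1 := ContMDiffAt.mfderiv (I := 𝓘(ℝ, ℝ)) (I' := 𝓘(ℝ, E')) (J := 𝓘(ℝ, E)) (m := ∞) (n := ∞)
    (x₀ := k₀) (fun (k : N) (t : ℝ) => F (k, t)) (fun _ => (0 : ℝ)) hF contMDiffAt_const (by simp)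
  have h2 : ContMDiffAt 𝓘(ℝ, E) 𝓘(ℝ, E') ∞ (fun k => F (k, 0)) k₀ :=
    ContMDiffAt.comp k₀ (g := F) (f := fun k => (k, (0 : ℝ))) hF
      (contMDiffAt_id.prodMk contMDiffAt_const)
  have h4 : ContMDiffAt 𝓘(ℝ, E) 𝓘(ℝ, ℝ).tangent ∞
      (fun _ : N => (⟨(0 : ℝ), (1 : ℝ)⟩ : TangentBundle 𝓘(ℝ, ℝ) ℝ)) k₀ := contMDiffAt_const
  have h3 := ContMDiffAt.clm_apply_of_inCoordinates (b₁ := fun _ : N => (0 : ℝ))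
    (b₂ := fun k => F (k, 0)) (v := fun _ => (1 : ℝ)) h1 h4 h2
  refine h3.congr_of_eventuallyEq ?_
  filter_upwards [hV] with k hk
  have : ∀ (z : P) (u : E'), z = σ k →
      (⟨z, u⟩ : TangentBundle 𝓘(ℝ, E') P) = ⟨σ k, u⟩ := by
    rintro _ u rfl; rfl
  exact (congrArg (fun u : E' => (⟨σ k, u⟩ : TangentBundle 𝓘(ℝ, E') P)) hk.2.2.symm).trans
    (this _ _ hk.1).symm

theorem contMDiffAt_dirDeriv {L : N → ℝ} (hL : ContMDiff 𝓘(ℝ, E) 𝓘(ℝ, ℝ) ∞ L)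
    {V : ∀ k, TangentSpace 𝓘(ℝ, E) k} {g : N}
    (hV : ContMDiffAt 𝓘(ℝ, E) 𝓘(ℝ, E).tangent ∞
      (fun k => (⟨k, V k⟩ : TangentBundle 𝓘(ℝ, E) N)) g) :
    ContMDiffAt 𝓘(ℝ, E) 𝓘(ℝ, ℝ) ∞ (fun k => LieGroupoid.dirDeriv L k (V k)) g := by
  have : IsManifold 𝓘(ℝ, E) 1 N := IsManifold.of_le (n := ∞) (by exact_mod_cast le_top)
  have h := (hL.contMDiff_tangentMap (m := ∞) (by simp)).contMDiffAt.comp g hV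
  exact (contMDiff_snd_tangentBundle_modelSpace (n := ∞) ℝ 𝓘(ℝ, ℝ)).contMDiffAt.comp g h

end VelocityFields

/-! ### Translations in a Lie groupoid -/

namespace LieGroupoid

variable {EΓ EM Γ M : Type*}
  [NormedAddCommGroup EΓ] [NormedSpace ℝ EΓ] [NormedAddCommGroup EM] [NormedSpace ℝ EM]
  [TopologicalSpace Γ] [ChartedSpace EΓ Γ] [TopologicalSpace M] [ChartedSpace EM M]
  (G : LieGroupoid EΓ EM Γ M)

section Multiplication

variable {EN HN N : Type*} [NormedAddCommGroup EN] [NormedSpace ℝ EN] [TopologicalSpace HN]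
  {I : ModelWithCorners ℝ EN HN} [TopologicalSpace N] [ChartedSpace HN N]

theorem contMDiffWithinAt_mul {f₁ f₂ : N → Γ} {s : Set N} {x : N} (hx : x ∈ s)
    (h₁ : ContMDiffWithinAt I 𝓘(ℝ, EΓ) ∞ f₁ s x) (h₂ : ContMDiffWithinAt I 𝓘(ℝ, EΓ) ∞ f₂ s x)
    (h : ∀ y ∈ s, G.tgt (f₁ y) = G.src (f₂ y)) :
    ContMDiffWithinAt I 𝓘(ℝ, EΓ) ∞ (fun y => G.mul (f₁ y) (f₂ y)) s x :=
  ContMDiffWithinAt.comp (t := {p : Γ × Γ | G.tgt p.1 = G.src p.2}) x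
    (G.contMDiffOn_mul (f₁ x, f₂ x) (h x hx)) (h₁.prodMk h₂) h

theorem contMDiffAt_mul {f₁ f₂ : N → Γ} {x : N}
    (h₁ : ContMDiffAt I 𝓘(ℝ, EΓ) ∞ f₁ x) (h₂ : ContMDiffAt I 𝓘(ℝ, EΓ) ∞ f₂ x)
    (h : ∀ᶠ y in 𝓝 x, G.tgt (f₁ y) = G.src (f₂ y)) :
    ContMDiffAt I 𝓘(ℝ, EΓ) ∞ (fun y => G.mul (f₁ y) (f₂ y)) x :=
  (G.contMDiffWithinAt_mul (s := {y | G.tgt (f₁ y) = G.src (f₂ y)}) h.self_of_nhds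
    h₁.contMDiffWithinAt h₂.contMDiffWithinAt (fun _ hy => hy)).contMDiffAt h

end Multiplication

theorem mul_inv_mul_cancel_left {g k : Γ} (h : G.tgt g = G.src k) :
    G.mul (G.inv g) (G.mul g k) = k := by
  rw [G.mul_assoc _ _ _ (G.tgt_inv g) h, G.inv_mul, h, G.one_mul]

theorem mul_mul_inv_cancel_left {g k : Γ} (h : G.src k = G.src g) :
    G.mul g (G.mul (G.inv g) k) = k := by
  rw [G.mul_assoc _ _ _ (G.src_inv g).symm ((G.tgt_inv g).trans h.symm), G.mul_inv, ← h, G.one_mul]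

theorem inv_unique {g k : Γ} (h : G.tgt g = G.src k) (h' : G.mul g k = G.one (G.src g)) :
    k = G.inv g := by
  have h1 := G.mul_inv_mul_cancel_left h
  have h2 := G.mul_one (G.inv g)
  rw [G.tgt_inv] at h2
  rw [h', h2] at h1
  exact h1.symm

theorem inv_inv (g : Γ) : G.inv (G.inv g) = g :=
  (G.inv_unique (G.tgt_inv g) ((G.inv_mul g).trans (by rw [G.src_inv]))).symm

theorem inv_one (x : M) : G.inv (G.one x) = G.one x := by
  refine (G.inv_unique (by rw [G.src_one, G.tgt_one]) ?_).symm
  have := G.one_mul (G.one x)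
  rw [G.src_one] at this ⊢
  exact this

section Velocity

variable {G}

theorem mem_vertSrc {g : Γ} {v : TangentSpace 𝓘(ℝ, EΓ) g} :
    v ∈ G.vertSrc g ↔ mfderiv 𝓘(ℝ, EΓ) 𝓘(ℝ, EM) G.src g v = 0 := Iff.rfl

theorem mem_vertTgt {g : Γ} {v : TangentSpace 𝓘(ℝ, EΓ) g} :
    v ∈ G.vertTgt g ↔ mfderiv 𝓘(ℝ, EΓ) 𝓘(ℝ, EM) G.tgt g v = 0 := Iff.rfl

theorem mem_vertSrc_of_hasVelocityAt {γ : ℝ → Γ} {g : Γ} {v : TangentSpace 𝓘(ℝ, EΓ) g}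
    (h : HasVelocityAt γ g v) (hγ : ∀ᶠ t in 𝓝 0, G.src (γ t) = G.src g) : v ∈ G.vertSrc g :=
  HasVelocityAt.eq_zero
    (h.comp_mfderiv ((G.isSubmersion_src.contMDiff g).mdifferentiableAt (by simp))) hγ

theorem mem_vertTgt_of_hasVelocityAt {γ : ℝ → Γ} {g : Γ} {v : TangentSpace 𝓘(ℝ, EΓ) g}
    (h : HasVelocityAt γ g v) (hγ : ∀ᶠ t in 𝓝 0, G.tgt (γ t) = G.tgt g) : v ∈ G.vertTgt g :=
  HasVelocityAt.eq_zero
    (h.comp_mfderiv ((G.isSubmersion_tgt.contMDiff g).mdifferentiableAt (by simp))) hγ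

/-- `T l_g` maps the velocity of `b` to the velocity of `g b`. -/
theorem hasVelocityAt_mul_left {b : ℝ → Γ} {g : Γ}
    {v : TangentSpace 𝓘(ℝ, EΓ) (G.one (G.tgt g))} (hb : HasVelocityAt b (G.one (G.tgt g)) v)
    (hs : ∀ᶠ t in 𝓝 0, G.src (b t) = G.tgt g) :
    HasVelocityAt (fun t => G.mul g (b t)) g (G.tangentLeft g v) := by
  have hm : G.one (G.tgt g) ∈ G.src ⁻¹' {G.tgt g} := G.src_one _
  have h := hb.comp_mfderivWithin (f := fun k => G.mul g k) (s := G.src ⁻¹' {G.tgt g})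
    ((G.contMDiffWithinAt_mul hm contMDiffWithinAt_const contMDiffWithinAt_id
      (fun y hy => Eq.symm hy)).mdifferentiableWithinAt (by simp)) hs
  exact ⟨h.1.trans (G.mul_one g), h.2⟩

/-- `T (r_g ∘ i)` maps the velocity of `a` to the velocity of `a⁻¹ g`. -/
theorem hasVelocityAt_inv_mul {a : ℝ → Γ} {g : Γ}
    {v : TangentSpace 𝓘(ℝ, EΓ) (G.one (G.src g))} (ha : HasVelocityAt a (G.one (G.src g)) v)
    (hs : ∀ᶠ t in 𝓝 0, G.src (a t) = G.src g) :
    HasVelocityAt (fun t => G.mul (G.inv (a t)) g) g (G.tangentRightInv g v) := by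
  have hm : G.one (G.src g) ∈ G.src ⁻¹' {G.src g} := G.src_one _
  have h := ha.comp_mfderivWithin (f := fun k => G.mul (G.inv k) g) (s := G.src ⁻¹' {G.src g})
    ((G.contMDiffWithinAt_mul hm (G.contMDiff_inv _).contMDiffWithinAt contMDiffWithinAt_const
      (fun y hy => (G.tgt_inv y).trans hy)).mdifferentiableWithinAt (by simp)) hs
  exact ⟨h.1.trans (by rw [G.inv_one, G.one_mul]), h.2⟩

theorem hasVelocityAt_leftBack {γ : ℝ → Γ} {g : Γ}
    {v : TangentSpace 𝓘(ℝ, EΓ) g} (hγ : HasVelocityAt γ g v)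
    (hs : ∀ᶠ t in 𝓝 0, G.src (γ t) = G.src g) :
    HasVelocityAt (fun t => G.mul (G.inv g) (γ t)) (G.one (G.tgt g)) (G.tangentLeftBack g v) := by
  have hm : g ∈ G.src ⁻¹' {G.src g} := rfl
  have h := hγ.comp_mfderivWithin (f := fun k => G.mul (G.inv g) k) (s := G.src ⁻¹' {G.src g})
    ((G.contMDiffWithinAt_mul hm contMDiffWithinAt_const contMDiffWithinAt_id
      (fun y (hy : G.src y = _) => (G.tgt_inv g).trans hy.symm)).mdifferentiableWithinAt
      (by simp)) hs
  exact ⟨h.1.trans (G.inv_mul g), h.2⟩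

theorem hasVelocityAt_invRightBack {γ : ℝ → Γ} {g : Γ}
    {v : TangentSpace 𝓘(ℝ, EΓ) g} (hγ : HasVelocityAt γ g v)
    (hs : ∀ᶠ t in 𝓝 0, G.tgt (γ t) = G.tgt g) :
    HasVelocityAt (fun t => G.inv (G.mul (γ t) (G.inv g))) (G.one (G.src g))
      (G.tangentInvRightBack g v) := by
  have hm : g ∈ G.tgt ⁻¹' {G.tgt g} := rfl
  have h := hγ.comp_mfderivWithin (f := fun k => G.inv (G.mul k (G.inv g)))
    (s := G.tgt ⁻¹' {G.tgt g})
    (((G.contMDiff_inv _).comp_contMDiffWithinAt _ (G.contMDiffWithinAt_mul hm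
      contMDiffWithinAt_id contMDiffWithinAt_const
      (fun y (hy : G.tgt y = _) => hy.trans (G.src_inv g).symm))).mdifferentiableWithinAt
      (by simp)) hs
  exact ⟨h.1.trans (by rw [G.mul_inv, G.inv_one]), h.2⟩

end Velocity

variable [IsManifold 𝓘(ℝ, EΓ) ∞ Γ] {G}

theorem exists_curve_of_mem_vertSrc {g : Γ} {v : TangentSpace 𝓘(ℝ, EΓ) g} (hv : v ∈ G.vertSrc g) :
    ∃ γ : ℝ → Γ, ContMDiffAt 𝓘(ℝ, ℝ) 𝓘(ℝ, EΓ) ∞ γ 0 ∧ HasVelocityAt γ g v ∧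
      ∀ᶠ t in 𝓝 0, G.src (γ t) = G.src g :=
  G.isSubmersion_src.exists_curve hv

theorem exists_curve_of_mem_vertTgt {g : Γ} {v : TangentSpace 𝓘(ℝ, EΓ) g} (hv : v ∈ G.vertTgt g) :
    ∃ γ : ℝ → Γ, ContMDiffAt 𝓘(ℝ, ℝ) 𝓘(ℝ, EΓ) ∞ γ 0 ∧ HasVelocityAt γ g v ∧
      ∀ᶠ t in 𝓝 0, G.tgt (γ t) = G.tgt g :=
  G.isSubmersion_tgt.exists_curve hv

theorem exists_curve_of_mem_algFiber {x : M} {v : TangentSpace 𝓘(ℝ, EΓ) (G.one x)}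
    (hv : v ∈ G.algFiber x) :
    ∃ γ : ℝ → Γ, ContMDiffAt 𝓘(ℝ, ℝ) 𝓘(ℝ, EΓ) ∞ γ 0 ∧ HasVelocityAt γ (G.one x) v ∧
      ∀ᶠ t in 𝓝 0, G.src (γ t) = x := by
  obtain ⟨γ, h1, h2, h3⟩ := exists_curve_of_mem_vertSrc hv
  exact ⟨γ, h1, h2, by simpa only [G.src_one] using h3⟩

theorem tangentLeft_mem {g : Γ} {v : TangentSpace 𝓘(ℝ, EΓ) (G.one (G.tgt g))}
    (hv : v ∈ G.algFiber (G.tgt g)) : G.tangentLeft g v ∈ G.vertSrc g := by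
  obtain ⟨b, -, hb, hs⟩ := exists_curve_of_mem_algFiber hv
  refine mem_vertSrc_of_hasVelocityAt (hasVelocityAt_mul_left hb hs) ?_
  filter_upwards [hs] with t ht using G.src_mul _ _ ht.symm

theorem tangentRightInv_mem {g : Γ} {v : TangentSpace 𝓘(ℝ, EΓ) (G.one (G.src g))}
    (hv : v ∈ G.algFiber (G.src g)) : G.tangentRightInv g v ∈ G.vertTgt g := by
  obtain ⟨b, -, hb, hs⟩ := exists_curve_of_mem_algFiber hv
  refine mem_vertTgt_of_hasVelocityAt (hasVelocityAt_inv_mul hb hs) ?_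
  filter_upwards [hs] with t ht using G.tgt_mul _ _ ((G.tgt_inv _).trans ht)

theorem tangentLeftBack_mem {g : Γ} {v : TangentSpace 𝓘(ℝ, EΓ) g}
    (hv : v ∈ G.vertSrc g) : G.tangentLeftBack g v ∈ G.algFiber (G.tgt g) := by
  obtain ⟨b, -, hb, hs⟩ := exists_curve_of_mem_vertSrc hv
  refine mem_vertSrc_of_hasVelocityAt (hasVelocityAt_leftBack hb hs) ?_
  filter_upwards [hs] with t ht
  rw [G.src_mul _ _ ((G.tgt_inv g).trans ht.symm), G.src_inv, G.src_one]

theorem tangentInvRightBack_mem {g : Γ} {v : TangentSpace 𝓘(ℝ, EΓ) g}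
    (hv : v ∈ G.vertTgt g) : G.tangentInvRightBack g v ∈ G.algFiber (G.src g) := by
  obtain ⟨b, -, hb, hs⟩ := exists_curve_of_mem_vertTgt hv
  refine mem_vertSrc_of_hasVelocityAt (hasVelocityAt_invRightBack hb hs) ?_
  filter_upwards [hs] with t ht
  rw [G.src_inv, G.tgt_mul _ _ (ht.trans (G.src_inv g).symm), G.tgt_inv, G.src_one]

theorem tangentLeftBack_tangentLeft {g : Γ} {v : TangentSpace 𝓘(ℝ, EΓ) (G.one (G.tgt g))}
    (hv : v ∈ G.algFiber (G.tgt g)) : G.tangentLeftBack g (G.tangentLeft g v) = v := by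
  obtain ⟨b, -, hb, hs⟩ := exists_curve_of_mem_algFiber hv
  refine (hasVelocityAt_leftBack (hasVelocityAt_mul_left hb hs) ?_).unique (hb.congr ?_)
  · filter_upwards [hs] with t ht using G.src_mul _ _ ht.symm
  · filter_upwards [hs] with t ht using G.mul_inv_mul_cancel_left ht.symm

theorem tangentLeft_tangentLeftBack {g : Γ} {v : TangentSpace 𝓘(ℝ, EΓ) g}
    (hv : v ∈ G.vertSrc g) : G.tangentLeft g (G.tangentLeftBack g v) = v := by
  obtain ⟨b, -, hb, hs⟩ := exists_curve_of_mem_vertSrc hv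
  refine (hasVelocityAt_mul_left (hasVelocityAt_leftBack hb hs) ?_).unique (hb.congr ?_)
  · filter_upwards [hs] with t ht
    rw [G.src_mul _ _ ((G.tgt_inv g).trans ht.symm), G.src_inv]
  · filter_upwards [hs] with t ht using G.mul_mul_inv_cancel_left ht

theorem tangentRightInv_tangentInvRightBack {g : Γ} {v : TangentSpace 𝓘(ℝ, EΓ) g}
    (hv : v ∈ G.vertTgt g) : G.tangentRightInv g (G.tangentInvRightBack g v) = v := by
  obtain ⟨b, -, hb, hs⟩ := exists_curve_of_mem_vertTgt hv
  refine (hasVelocityAt_inv_mul (hasVelocityAt_invRightBack hb hs) ?_).unique (hb.congr ?_)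
  · filter_upwards [hs] with t ht
    rw [G.src_inv, G.tgt_mul _ _ (ht.trans (G.src_inv g).symm), G.tgt_inv]
  · filter_upwards [hs] with t ht
    rw [G.inv_inv, ← G.mul_assoc _ _ _ (ht.trans (G.src_inv g).symm) (G.tgt_inv g), G.inv_mul,
      ← ht, G.mul_one]

theorem tangentInvRightBack_tangentRightInv {g : Γ}
    {v : TangentSpace 𝓘(ℝ, EΓ) (G.one (G.src g))}
    (hv : v ∈ G.algFiber (G.src g)) : G.tangentInvRightBack g (G.tangentRightInv g v) = v := by
  obtain ⟨b, -, hb, hs⟩ := exists_curve_of_mem_algFiber hv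
  refine (hasVelocityAt_invRightBack (hasVelocityAt_inv_mul hb hs) ?_).unique (hb.congr ?_)
  · filter_upwards [hs] with t ht using G.tgt_mul _ _ ((G.tgt_inv _).trans ht)
  · filter_upwards [hs] with t ht
    have h1 := (G.tgt_inv (b t)).trans ht
    have h2 := G.mul_one (G.inv (b t))
    rw [← G.mul_assoc _ _ _ h1 (G.src_inv g).symm, G.mul_inv, ← h1, h2, G.inv_inv]

end LieGroupoid

/-! ### Invariant vector fields and the Poincaré-Cartan 2-section -/

namespace LieGroupoid

variable {EΓ EM Γ M : Type*}
  [NormedAddCommGroup EΓ] [NormedSpace ℝ EΓ] [NormedAddCommGroup EM] [NormedSpace ℝ EM]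
  [TopologicalSpace Γ] [ChartedSpace EΓ Γ] [TopologicalSpace M] [ChartedSpace EM M]
  {G : LieGroupoid EΓ EM Γ M}

variable (G) in
/-- `X` is a section of `E_Γ`, smooth at the point `x₀`. No smoothness is required elsewhere, so
that the local frames of a subbundle qualify without being cut off. -/
structure IsAlgSectionAt (X : ∀ x : M, TangentSpace 𝓘(ℝ, EΓ) (G.one x)) (x₀ : M)
    [IsManifold 𝓘(ℝ, EΓ) ∞ Γ] : Prop where
  mem : ∀ x, X x ∈ G.algFiber x
  smooth : ContMDiffAt 𝓘(ℝ, EM) 𝓘(ℝ, EΓ).tangent ∞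
    (fun x => (⟨G.one x, X x⟩ : TangentBundle 𝓘(ℝ, EΓ) Γ)) x₀

theorem hasVelocityAt_leftField {X : ∀ x : M, TangentSpace 𝓘(ℝ, EΓ) (G.one x)} {k : Γ} {x : M}
    {b : ℝ → Γ} (hk : G.tgt k = x) (hb : HasVelocityAt b (G.one x) (X x))
    (hs : ∀ᶠ t in 𝓝 0, G.src (b t) = x) :
    HasVelocityAt (fun t => G.mul k (b t)) k (G.leftField X k) := by
  subst hk
  exact hasVelocityAt_mul_left hb hs

/-- The velocity of `a⁻¹ k` is `-→X(k)`: the sign in the definition of `→X` is left out. -/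
theorem hasVelocityAt_neg_rightField {X : ∀ x : M, TangentSpace 𝓘(ℝ, EΓ) (G.one x)} {k : Γ} {x : M}
    {a : ℝ → Γ} (hk : G.src k = x) (ha : HasVelocityAt a (G.one x) (X x))
    (hs : ∀ᶠ t in 𝓝 0, G.src (a t) = x) :
    HasVelocityAt (fun t => G.mul (G.inv (a t)) k) k (-G.rightField X k) := by
  subst hk
  rw [rightField, neg_neg]
  exact hasVelocityAt_inv_mul ha hs

theorem dirDeriv_add (f : Γ → ℝ) (g : Γ) (v w : TangentSpace 𝓘(ℝ, EΓ) g) :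
    dirDeriv f g (v + w) = dirDeriv f g v + dirDeriv f g w := map_add (mfderiv _ _ f g) v w

theorem dirDeriv_neg (f : Γ → ℝ) (g : Γ) (v : TangentSpace 𝓘(ℝ, EΓ) g) :
    dirDeriv f g (-v) = -dirDeriv f g v := map_neg (mfderiv _ _ f g) v

theorem dirDeriv_smul (f : Γ → ℝ) (g : Γ) (c : ℝ) (v : TangentSpace 𝓘(ℝ, EΓ) g) :
    dirDeriv f g (c • v) = c * dirDeriv f g v := map_smul (mfderiv _ _ f g) c v

/-- The curves `t ↦ c (x, t)` stay in the fibres of the source, for all `x` near `x₀`. -/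
theorem eventually_eventually_curve {x₀ : M} {c : M × ℝ → Γ}
    (h : ∀ᶠ p in 𝓝 (x₀, (0 : ℝ)), G.src (c p) = p.1) :
    ∀ᶠ x in 𝓝 x₀, ∀ᶠ t in 𝓝 (0 : ℝ), G.src (c (x, t)) = x := by
  rw [nhds_prod_eq] at h
  exact h.curry

variable [IsManifold 𝓘(ℝ, EΓ) ∞ Γ]

theorem AlgSection.isAlgSectionAt (X : G.AlgSection) (x : M) : G.IsAlgSectionAt X.val x :=
  ⟨X.mem, X.smooth x⟩

/-- Near `x₀`, a section of `E_Γ` consists of the velocities of a smooth family of curves in the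
fibres of the source. -/
theorem IsAlgSectionAt.exists_curve {X : ∀ x : M, TangentSpace 𝓘(ℝ, EΓ) (G.one x)} {x₀ : M}
    (hX : G.IsAlgSectionAt X x₀) :
    ∃ c : M × ℝ → Γ, ContMDiffAt (𝓘(ℝ, EM).prod 𝓘(ℝ, ℝ)) 𝓘(ℝ, EΓ) ∞ c (x₀, 0) ∧
      (∀ᶠ p in 𝓝 (x₀, (0 : ℝ)), G.src (c p) = p.1) ∧
      ∀ᶠ x in 𝓝 x₀, HasVelocityAt (fun t => c (x, t)) (G.one x) (X x) := by
  have h := G.isSubmersion_src.exists_curves hX.smooth hX.mem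
  simpa only [G.src_one] using h

theorem IsAlgSectionAt.contMDiffAt_leftField {X : ∀ x : M, TangentSpace 𝓘(ℝ, EΓ) (G.one x)} {g : Γ}
    (hX : G.IsAlgSectionAt X (G.tgt g)) :
    ContMDiffAt 𝓘(ℝ, EΓ) 𝓘(ℝ, EΓ).tangent ∞
      (fun k => (⟨k, G.leftField X k⟩ : TangentBundle 𝓘(ℝ, EΓ) Γ)) g := by
  obtain ⟨c, hc, hs, hv⟩ := hX.exists_curve
  have ht : ContMDiff 𝓘(ℝ, EΓ) 𝓘(ℝ, EM) ∞ G.tgt := G.isSubmersion_tgt.contMDiff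
  have hp : ContMDiffAt (𝓘(ℝ, EΓ).prod 𝓘(ℝ, ℝ)) (𝓘(ℝ, EM).prod 𝓘(ℝ, ℝ)) ∞
      (fun p : Γ × ℝ => (G.tgt p.1, p.2)) (g, 0) :=
    ((ht g).comp (g, (0 : ℝ)) contMDiffAt_fst).prodMk contMDiffAt_snd
  have hF : ContMDiffAt (𝓘(ℝ, EΓ).prod 𝓘(ℝ, ℝ)) 𝓘(ℝ, EΓ) ∞
      (fun p : Γ × ℝ => G.mul p.1 (c (G.tgt p.1, p.2))) (g, 0) := by
    refine G.contMDiffAt_mul contMDiffAt_fst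
      (ContMDiffAt.comp (g, (0 : ℝ)) (g := c) (f := fun p : Γ × ℝ => (G.tgt p.1, p.2)) hc hp) ?_
    filter_upwards [hp.continuousAt.eventually hs] with p hp using hp.symm
  refine contMDiffAt_velocity hF ?_
  have hta : Tendsto G.tgt (𝓝 g) (𝓝 (G.tgt g)) := ht.continuous.continuousAt
  filter_upwards [hta.eventually hv, hta.eventually (eventually_eventually_curve hs)]
    with k hk hk'
  exact hasVelocityAt_leftField rfl hk hk'

theorem IsAlgSectionAt.contMDiffAt_neg_rightField {X : ∀ x : M, TangentSpace 𝓘(ℝ, EΓ) (G.one x)}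
    {g : Γ} (hX : G.IsAlgSectionAt X (G.src g)) :
    ContMDiffAt 𝓘(ℝ, EΓ) 𝓘(ℝ, EΓ).tangent ∞
      (fun k => (⟨k, -G.rightField X k⟩ : TangentBundle 𝓘(ℝ, EΓ) Γ)) g := by
  obtain ⟨c, hc, hs, hv⟩ := hX.exists_curve
  have ht : ContMDiff 𝓘(ℝ, EΓ) 𝓘(ℝ, EM) ∞ G.src := G.isSubmersion_src.contMDiff
  have hp : ContMDiffAt (𝓘(ℝ, EΓ).prod 𝓘(ℝ, ℝ)) (𝓘(ℝ, EM).prod 𝓘(ℝ, ℝ)) ∞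
      (fun p : Γ × ℝ => (G.src p.1, p.2)) (g, 0) :=
    ((ht g).comp (g, (0 : ℝ)) contMDiffAt_fst).prodMk contMDiffAt_snd
  have hF : ContMDiffAt (𝓘(ℝ, EΓ).prod 𝓘(ℝ, ℝ)) 𝓘(ℝ, EΓ) ∞
      (fun p : Γ × ℝ => G.mul (G.inv (c (G.src p.1, p.2))) p.1) (g, 0) := by
    refine G.contMDiffAt_mul ((G.contMDiff_inv _).comp (g, (0 : ℝ))
      (ContMDiffAt.comp (g, (0 : ℝ)) (g := c) (f := fun p : Γ × ℝ => (G.src p.1, p.2)) hc hp))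
      contMDiffAt_fst ?_
    filter_upwards [hp.continuousAt.eventually hs] with p hp
    exact (G.tgt_inv _).trans hp
  refine contMDiffAt_velocity hF ?_
  have hta : Tendsto G.src (𝓝 g) (𝓝 (G.src g)) := ht.continuous.continuousAt
  filter_upwards [hta.eventually hv, hta.eventually (eventually_eventually_curve hs)]
    with k hk hk'
  exact hasVelocityAt_neg_rightField rfl hk hk'

variable {L : Γ → ℝ}

theorem IsAlgSectionAt.contMDiffAt_dirDeriv_leftField
    {X : ∀ x : M, TangentSpace 𝓘(ℝ, EΓ) (G.one x)} {g : Γ}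
    (hX : G.IsAlgSectionAt X (G.tgt g)) (hL : ContMDiff 𝓘(ℝ, EΓ) 𝓘(ℝ, ℝ) ∞ L) :
    ContMDiffAt 𝓘(ℝ, EΓ) 𝓘(ℝ, ℝ) ∞ (fun k => dirDeriv L k (G.leftField X k)) g :=
  contMDiffAt_dirDeriv hL hX.contMDiffAt_leftField

theorem IsAlgSectionAt.contMDiffAt_dirDeriv_rightField
    {X : ∀ x : M, TangentSpace 𝓘(ℝ, EΓ) (G.one x)} {g : Γ}
    (hX : G.IsAlgSectionAt X (G.src g)) (hL : ContMDiff 𝓘(ℝ, EΓ) 𝓘(ℝ, ℝ) ∞ L) :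
    ContMDiffAt 𝓘(ℝ, EΓ) 𝓘(ℝ, ℝ) ∞ (fun k => dirDeriv L k (G.rightField X k)) g := by
  have h := (contMDiffAt_dirDeriv hL hX.contMDiffAt_neg_rightField).neg
  refine h.congr_of_eventuallyEq (Eventually.of_forall fun k => ?_)
  change _ = -dirDeriv L k (-G.rightField X k)
  rw [dirDeriv_neg, neg_neg]

/-- Left- and right-invariant vector fields commute, as derivations of functions: both sides are
(up to sign) the mixed second derivative of `L (a(s)⁻¹ g b(t))`, where the curves `a` and `b` in the
fibres of the source have the velocities `X` and `Y`. -/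
theorem dirDeriv_leftField_rightField_comm {X Y : ∀ x : M, TangentSpace 𝓘(ℝ, EΓ) (G.one x)} {g : Γ}
    (hL : ContMDiff 𝓘(ℝ, EΓ) 𝓘(ℝ, ℝ) ∞ L)
    (hX : G.IsAlgSectionAt X (G.src g)) (hY : G.IsAlgSectionAt Y (G.tgt g)) :
    dirDeriv (fun k => dirDeriv L k (G.leftField Y k)) g (G.rightField X g) =
      dirDeriv (fun k => dirDeriv L k (G.rightField X k)) g (G.leftField Y g) := by
  obtain ⟨a, hac, ha, has⟩ := exists_curve_of_mem_algFiber (hX.mem (G.src g))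
  obtain ⟨b, hbc, hb, hbs⟩ := exists_curve_of_mem_algFiber (hY.mem (G.tgt g))
  have hLd : ∀ k, MDifferentiableAt 𝓘(ℝ, EΓ) 𝓘(ℝ, ℝ) L k :=
    fun k => (hL k).mdifferentiableAt (by simp)
  let Φ : ℝ × ℝ → ℝ := fun p => L (G.mul (G.mul (G.inv (a p.1)) g) (b p.2))
  have hpc : ContMDiffAt 𝓘(ℝ, ℝ) 𝓘(ℝ, EΓ) ∞ (fun s => G.mul (G.inv (a s)) g) 0 := by
    refine G.contMDiffAt_mul ((G.contMDiff_inv _).comp (0 : ℝ) hac) contMDiffAt_const ?_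
    filter_upwards [has] with s hs using (G.tgt_inv _).trans hs
  have hΦ : ContDiffAt ℝ 2 Φ (0, 0) := by
    have h1 : ContMDiffAt (𝓘(ℝ, ℝ).prod 𝓘(ℝ, ℝ)) 𝓘(ℝ, EΓ) ∞
        (fun p : ℝ × ℝ => G.mul (G.mul (G.inv (a p.1)) g) (b p.2)) (0, 0) := by
      refine G.contMDiffAt_mul
        (ContMDiffAt.comp ((0 : ℝ), (0 : ℝ)) (g := fun s => G.mul (G.inv (a s)) g) (f := Prod.fst)
          hpc contMDiffAt_fst)
        (ContMDiffAt.comp ((0 : ℝ), (0 : ℝ)) (g := b) (f := Prod.snd) hbc contMDiffAt_snd) ?_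
      have h1 : ∀ᶠ p : ℝ × ℝ in 𝓝 ((0 : ℝ), (0 : ℝ)), G.src (a p.1) = G.src g :=
        (continuous_fst.tendsto ((0 : ℝ), (0 : ℝ))).eventually has
      have h2 : ∀ᶠ p : ℝ × ℝ in 𝓝 ((0 : ℝ), (0 : ℝ)), G.src (b p.2) = G.tgt g :=
        (continuous_snd.tendsto ((0 : ℝ), (0 : ℝ))).eventually hbs
      filter_upwards [h1, h2] with p hp1 hp2
      rw [hp2, G.tgt_mul _ _ ((G.tgt_inv _).trans hp1)]
    have h2 : ContMDiffAt (𝓘(ℝ, ℝ).prod 𝓘(ℝ, ℝ)) 𝓘(ℝ, ℝ) ∞ Φ (0, 0) :=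
      (hL _).comp ((0 : ℝ), (0 : ℝ)) h1
    refine ContDiffAt.of_le (contMDiffAt_iff_contDiffAt.1 ?_) two_le_infty
    rw [modelWithCornersSelf_prod, ← chartedSpaceSelf_prod]
    exact h2
  have e1 : (fun s => dirDeriv L (G.mul (G.inv (a s)) g) (G.leftField Y (G.mul (G.inv (a s)) g)))
      =ᶠ[𝓝 0] fun s => deriv (fun t => Φ (s, t)) 0 := by
    filter_upwards [has] with s hs
    have ht : G.tgt (G.mul (G.inv (a s)) g) = G.tgt g := G.tgt_mul _ _ ((G.tgt_inv _).trans hs)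
    exact ((hasVelocityAt_leftField ht hb hbs).hasDerivAt_comp (hLd _)).deriv.symm
  have e2 : (fun t => dirDeriv L (G.mul g (b t)) (G.rightField X (G.mul g (b t))))
      =ᶠ[𝓝 0] fun t => -deriv (fun s => Φ (s, t)) 0 := by
    filter_upwards [hbs] with t ht
    have hs : G.src (G.mul g (b t)) = G.src g := G.src_mul _ _ ht.symm
    have h1 := ((hasVelocityAt_neg_rightField hs ha has).hasDerivAt_comp (hLd _)).deriv
    rw [dirDeriv_neg] at h1
    rw [← neg_eq_iff_eq_neg, ← h1]
    refine EventuallyEq.deriv_eq ?_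
    filter_upwards [has] with s hs'
    exact congrArg L (G.mul_assoc _ _ _ ((G.tgt_inv _).trans hs') ht.symm)
  have d1 := ((hasVelocityAt_neg_rightField rfl ha has).hasDerivAt_comp
    ((hY.contMDiffAt_dirDeriv_leftField hL).mdifferentiableAt (by simp))).deriv
  have d2 := ((hasVelocityAt_leftField rfl hb hbs).hasDerivAt_comp
    ((hX.contMDiffAt_dirDeriv_rightField hL).mdifferentiableAt (by simp))).deriv
  rw [e1.deriv_eq, dirDeriv_neg] at d1
  rw [e2.deriv_eq, deriv.fun_neg] at d2
  rw [← d2, ← deriv_deriv_comm hΦ, d1, neg_neg]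

/-- The derivative `→X(←Y L)(g)` depends on `Y` through `←Y(g)` only. -/
theorem dirDeriv_leftField_congr {X Y Y' : ∀ x : M, TangentSpace 𝓘(ℝ, EΓ) (G.one x)} {g : Γ}
    (hL : ContMDiff 𝓘(ℝ, EΓ) 𝓘(ℝ, ℝ) ∞ L)
    (hX : G.IsAlgSectionAt X (G.src g)) (hY : G.IsAlgSectionAt Y (G.tgt g))
    (hY' : G.IsAlgSectionAt Y' (G.tgt g)) (h : G.leftField Y g = G.leftField Y' g) :
    dirDeriv (fun k => dirDeriv L k (G.leftField Y k)) g (G.rightField X g) =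
      dirDeriv (fun k => dirDeriv L k (G.leftField Y' k)) g (G.rightField X g) := by
  rw [dirDeriv_leftField_rightField_comm hL hX hY, dirDeriv_leftField_rightField_comm hL hX hY', h]

/-- The terms of `dΘ⁺` that only involve `Y` and `Y'` cancel, as `←Y(←Y'L) - ←Y'(←YL) = [←Y, ←Y']L`;
the two mixed second derivatives remain. -/
theorem prolDiffOn_thetaPlus [FiniteDimensional ℝ EΓ]
    {X Y X' Y' : ∀ x : M, TangentSpace 𝓘(ℝ, EΓ) (G.one x)} {g : Γ}
    (hL : ContMDiff 𝓘(ℝ, EΓ) 𝓘(ℝ, ℝ) ∞ L)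
    (hY : G.IsAlgSectionAt Y (G.tgt g)) (hY' : G.IsAlgSectionAt Y' (G.tgt g)) :
    G.prolDiffOn (thetaPlus L) X Y X' Y' g =
      dirDeriv (fun k => dirDeriv L k (G.leftField Y' k)) g (G.rightField X g) -
      dirDeriv (fun k => dirDeriv L k (G.leftField Y k)) g (G.rightField X' g) := by
  have h := dirDeriv_mlieBracket hL
    (hY.contMDiffAt_leftField.mdifferentiableAt (by simp))
    (hY'.contMDiffAt_leftField.mdifferentiableAt (by simp))
    ((hY.contMDiffAt_dirDeriv_leftField hL).mdifferentiableAt (by simp))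
    ((hY'.contMDiffAt_dirDeriv_leftField hL).mdifferentiableAt (by simp))
  simp only [prolDiffOn, thetaPlus, prolSection, prolBracket, anchor, LinearMap.add_apply,
    LinearMap.fst_apply, LinearMap.snd_apply]
  rw [dirDeriv_add, dirDeriv_add, h]
  ring

variable [FiniteDimensional ℝ EM] [T2Space M] [IsManifold 𝓘(ℝ, EM) ∞ M]

theorem exists_algSection {x : M} {v : TangentSpace 𝓘(ℝ, EΓ) (G.one x)} (hv : v ∈ G.algFiber x) :
    ∃ X : G.AlgSection, X.val x = v := by
  obtain ⟨X, h1, h2, h3⟩ := G.isSubmersion_src.exists_vertical_extension G.contMDiff_one hv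
  exact ⟨⟨X, h2, h3⟩, h1⟩

theorem exists_rightField_eq {g : Γ} {v : TangentSpace 𝓘(ℝ, EΓ) g} (hv : v ∈ G.vertTgt g) :
    ∃ X : G.AlgSection, G.rightField X.val g = v := by
  obtain ⟨X, hX⟩ := exists_algSection (neg_mem (tangentInvRightBack_mem hv))
  refine ⟨X, ?_⟩
  rw [rightField, hX, map_neg, neg_neg, tangentRightInv_tangentInvRightBack hv]

theorem exists_leftField_eq {g : Γ} {v : TangentSpace 𝓘(ℝ, EΓ) g} (hv : v ∈ G.vertSrc g) :
    ∃ X : G.AlgSection, G.leftField X.val g = v := by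
  obtain ⟨X, hX⟩ := exists_algSection (tangentLeftBack_mem hv)
  refine ⟨X, ?_⟩
  rw [leftField, hX, tangentLeft_tangentLeftBack hv]

/-- The extensions chosen in the definition of `prolDiff` are through the given vector. -/
theorem exists_extend {g : Γ} {s : TangentSpace 𝓘(ℝ, EΓ) g × TangentSpace 𝓘(ℝ, EΓ) g}
    (hs : s ∈ G.prol g) :
    ∃ X Y : G.AlgSection, G.extend g s = (X.val, Y.val) ∧ G.rightField X.val g = s.1 ∧
      G.leftField Y.val g = s.2 := by
  obtain ⟨X, hX⟩ := exists_rightField_eq hs.1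
  obtain ⟨Y, hY⟩ := exists_leftField_eq hs.2
  have h : ∃ P : G.AlgSection × G.AlgSection, G.prolSection P.1.val P.2.val g = s :=
    ⟨(X, Y), Prod.ext hX hY⟩
  refine ⟨h.choose.1, h.choose.2, ?_, congrArg Prod.fst h.choose_spec,
    congrArg Prod.snd h.choose_spec⟩
  rw [extend, dif_pos h]

/-- The Poincaré-Cartan 2-section, computed with any sections of `E_Γ`, smooth at the relevant
points, through the given vectors. -/
theorem omega_eq [FiniteDimensional ℝ EΓ]
    {X Y X' Y' : ∀ x : M, TangentSpace 𝓘(ℝ, EΓ) (G.one x)} {g : Γ}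
    (hL : ContMDiff 𝓘(ℝ, EΓ) 𝓘(ℝ, ℝ) ∞ L)
    (hX : G.IsAlgSectionAt X (G.src g)) (hY : G.IsAlgSectionAt Y (G.tgt g))
    (hX' : G.IsAlgSectionAt X' (G.src g)) (hY' : G.IsAlgSectionAt Y' (G.tgt g)) :
    G.omega L g (G.rightField X g, G.leftField Y g) (G.rightField X' g, G.leftField Y' g) =
      dirDeriv (fun k => dirDeriv L k (G.leftField Y k)) g (G.rightField X' g) -
      dirDeriv (fun k => dirDeriv L k (G.leftField Y' k)) g (G.rightField X g) := by
  have hmem : ∀ {X Y : ∀ x : M, TangentSpace 𝓘(ℝ, EΓ) (G.one x)},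
      G.IsAlgSectionAt X (G.src g) → G.IsAlgSectionAt Y (G.tgt g) →
      (G.rightField X g, G.leftField Y g) ∈ G.prol g := fun h1 h2 =>
    ⟨neg_mem (tangentRightInv_mem (h1.mem _)), tangentLeft_mem (h2.mem _)⟩
  obtain ⟨U, V, h1, h2, h3⟩ := exists_extend (hmem hX hY)
  obtain ⟨U', V', h1', h2', h3'⟩ := exists_extend (hmem hX' hY')
  rw [omega, prolDiff, h1, h1',
    prolDiffOn_thetaPlus hL (V.isAlgSectionAt _) (V'.isAlgSectionAt _), h2, h2', neg_sub,
    dirDeriv_leftField_congr hL hX (V'.isAlgSectionAt _) hY' h3',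
    dirDeriv_leftField_congr hL hX' (V.isAlgSectionAt _) hY h3]

end LieGroupoid

/-! ### Symplectic linear algebra -/

section LinearAlgebra

open Module LieGroupoid

variable {V : Type*} [AddCommGroup V] [Module ℝ V]
  {Ω : V →ₗ[ℝ] V →ₗ[ℝ] ℝ} {A B D P : Submodule ℝ V}

/-- If `A` and `B` are isotropic for a form nondegenerate on `A ⊕ B`, then `B` is its own
orthogonal, so that the orthogonal of `D ⊕ B` is the orthogonal of `D` in `B`. -/
theorem mem_sup_orthogonal_iff (hskew : ∀ s s', Ω s s' = -Ω s' s)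
    (hnd : ∀ s ∈ A ⊔ B, (∀ s' ∈ A ⊔ B, Ω s s' = 0) → s = 0)
    (hA : ∀ s ∈ A, ∀ s' ∈ A, Ω s s' = 0) (hB : ∀ s ∈ B, ∀ s' ∈ B, Ω s s' = 0)
    {s : V} (hs : s ∈ A ⊔ B) :
    (∀ s' ∈ D ⊔ B, Ω s s' = 0) ↔ s ∈ B ∧ ∀ x ∈ D, Ω x s = 0 := by
  constructor
  · intro h
    obtain ⟨a, ha, b, hb, rfl⟩ := Submodule.mem_sup.1 hs
    have ha0 : a = 0 := by
      refine hnd a (Submodule.mem_sup_left ha) fun s' hs' => ?_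
      obtain ⟨a', ha', b', hb', rfl⟩ := Submodule.mem_sup.1 hs'
      have h1 := h b' (Submodule.mem_sup_right hb')
      rw [map_add, LinearMap.add_apply, hB b hb b' hb', add_zero] at h1
      rw [map_add, hA a ha a' ha', h1, add_zero]
    subst ha0
    rw [zero_add] at h ⊢
    refine ⟨hb, fun x hx => ?_⟩
    rw [hskew, h x (Submodule.mem_sup_left hx), neg_zero]
  · rintro ⟨hsB, h⟩ s' hs'
    obtain ⟨x, hx, b, hb, rfl⟩ := Submodule.mem_sup.1 hs'
    rw [map_add, hB s hsB b hb, hskew, h x hx, neg_zero, add_zero]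

/-- In a symplectic space `A ⊕ B`, a sum of two Lagrangian subspaces, let `D ⊆ A` and let `P` have
dimension at least `dim A + dim D`, so that `dim (P ∩ B) ≥ dim D`. If no nonzero vector of `P ∩ B`
is orthogonal to `D`, then `P ∩ B` and `D` are in duality, and `P ∩ (D ⊕ B)`, an extension of `D`
by `P ∩ B`, has dimension `2 dim D` and is symplectic; and conversely. -/
theorem finrank_and_nondegenerate_iff [FiniteDimensional ℝ V] (hskew : ∀ s s', Ω s s' = -Ω s' s)
    (hB : ∀ s ∈ B, ∀ s' ∈ B, Ω s s' = 0) (hAB : Disjoint A B) (hDA : D ≤ A) (hPAB : P ≤ A ⊔ B)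
    (hdim : finrank ℝ A + finrank ℝ D ≤ finrank ℝ P) :
    (finrank ℝ (P ⊓ (D ⊔ B) : Submodule ℝ V) = 2 * finrank ℝ D ∧
      ∀ s ∈ P ⊓ (D ⊔ B), (∀ s' ∈ P ⊓ (D ⊔ B), Ω s s' = 0) → s = 0) ↔
    ∀ y ∈ P ⊓ B, (∀ x ∈ D, Ω x y = 0) → y = 0 := by
  constructor
  · rintro ⟨-, h⟩ y ⟨hyP, hyB⟩ hy
    refine h y ⟨hyP, Submodule.mem_sup_right hyB⟩ fun s' hs' => ?_
    obtain ⟨x, hx, b, hb, rfl⟩ := Submodule.mem_sup.1 hs'.2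
    rw [map_add, hB y hyB b hb, hskew, hy x hx, neg_zero, add_zero]
  · intro h
    have dAB := Submodule.finrank_sup_add_finrank_inf_eq A B
    have dDB := Submodule.finrank_sup_add_finrank_inf_eq D B
    rw [hAB.eq_bot, finrank_bot] at dAB
    rw [(hAB.mono_left hDA).eq_bot, finrank_bot] at dDB
    have dPB := Submodule.finrank_sup_add_finrank_inf_eq P B
    have lePB := Submodule.finrank_mono (sup_le hPAB (le_sup_right : B ≤ A ⊔ B))
    -- the pairing of `P ∩ B` with `D`
    let f : (P ⊓ B : Submodule ℝ V) →ₗ[ℝ] Dual ℝ D :=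
      (Submodule.dualRestrict D).comp (Ω.flip.comp (P ⊓ B).subtype)
    have hf : Function.Injective f := by
      rw [← LinearMap.ker_eq_bot, LinearMap.ker_eq_bot']
      intro y hy
      refine Subtype.ext (h y y.2 fun x hx => ?_)
      exact LinearMap.congr_fun hy ⟨x, hx⟩
    have hle := LinearMap.finrank_le_finrank_of_injective hf
    rw [Subspace.dual_finrank_eq] at hle
    have hE : finrank ℝ (P ⊓ B : Submodule ℝ V) = finrank ℝ D := by omega
    have hfs : Function.Surjective f :=
      (LinearMap.injective_iff_surjective_of_finrank_eq_finrank
        (by rw [hE, Subspace.dual_finrank_eq])).1 hf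
    have hD0 : ∀ x ∈ D, (∀ y ∈ P ⊓ B, Ω x y = 0) → x = 0 := by
      intro x hx hxy
      have : (⟨x, hx⟩ : D) = 0 := by
        refine (Module.forall_dual_apply_eq_zero_iff ℝ _).1 fun φ => ?_
        obtain ⟨y, rfl⟩ := hfs φ
        exact hxy y y.2
      exact congrArg Subtype.val this
    have dH := Submodule.finrank_sup_add_finrank_inf_eq P (D ⊔ B)
    have leH := Submodule.finrank_mono
      (sup_le hPAB (sup_le_sup_right hDA B) : P ⊔ (D ⊔ B) ≤ A ⊔ B)
    have dHB := Submodule.finrank_sup_add_finrank_inf_eq (P ⊓ (D ⊔ B)) B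
    have hHB : P ⊓ (D ⊔ B) ⊓ B = P ⊓ B := by
      rw [inf_assoc, inf_eq_right.2 (le_sup_right : B ≤ D ⊔ B)]
    rw [hHB] at dHB
    have hsup : P ⊓ (D ⊔ B) ⊔ B ≤ D ⊔ B := sup_le inf_le_right le_sup_right
    have leHB := Submodule.finrank_mono hsup
    have hH : finrank ℝ (P ⊓ (D ⊔ B) : Submodule ℝ V) = 2 * finrank ℝ D := by omega
    refine ⟨hH, fun s hs hs0 => ?_⟩
    have hsupeq : P ⊓ (D ⊔ B) ⊔ B = D ⊔ B :=
      Submodule.eq_of_le_of_finrank_eq hsup (by omega)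
    have hE' : ∀ e ∈ P ⊓ B, e ∈ P ⊓ (D ⊔ B) := fun e he => ⟨he.1, Submodule.mem_sup_right he.2⟩
    have hsB : s ∈ B := by
      obtain ⟨x, hx, b, hb, rfl⟩ := Submodule.mem_sup.1 hs.2
      have : x = 0 := by
        refine hD0 x hx fun y hy => ?_
        have h1 := hs0 y (hE' y hy)
        rwa [map_add, LinearMap.add_apply, hB b hb y hy.2, add_zero] at h1
      rwa [this, zero_add]
    refine h s ⟨hs.1, hsB⟩ fun x hx => ?_
    have hx' : x ∈ P ⊓ (D ⊔ B) ⊔ B := by rw [hsupeq]; exact Submodule.mem_sup_left hx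
    obtain ⟨s', hs', b, hb, rfl⟩ := Submodule.mem_sup.1 hx'
    rw [hskew, map_add, hs0 s' hs', hB s hsB b hb, add_zero, neg_zero]

/-- The preimage of a subspace has at most its codimension. -/
theorem finrank_comap_ge [FiniteDimensional ℝ V] {T : Type*} [AddCommGroup T] [Module ℝ T]
    [FiniteDimensional ℝ T] (ρ : V →ₗ[ℝ] T) (U : Submodule ℝ V) (W : Submodule ℝ T) :
    finrank ℝ U + finrank ℝ W ≤ finrank ℝ (U ⊓ W.comap ρ : Submodule ℝ V) + finrank ℝ T := by
  have h1 := (W.mkQ ∘ₗ ρ ∘ₗ U.subtype).finrank_range_add_finrank_ker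
  have h2 := Submodule.finrank_le (LinearMap.range (W.mkQ ∘ₗ ρ ∘ₗ U.subtype))
  have h3 := W.finrank_quotient_add_finrank
  have h4 : finrank ℝ (LinearMap.ker (W.mkQ ∘ₗ ρ ∘ₗ U.subtype)) =
      finrank ℝ (U ⊓ W.comap ρ : Submodule ℝ V) := by
    have : LinearMap.ker (W.mkQ ∘ₗ ρ ∘ₗ U.subtype) = (W.comap ρ).comap U.subtype := by
      rw [LinearMap.ker_comp, Submodule.ker_mkQ, Submodule.comap_comp]
    rw [this, ← Submodule.map_comap_subtype]
    exact (Submodule.finrank_map_subtype_eq _ _).symm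
  omega

end LinearAlgebra

/-! ### The Poincaré-Cartan 2-section as a bilinear form -/

namespace LieGroupoid

variable {EΓ EM Γ M : Type*}
  [NormedAddCommGroup EΓ] [NormedSpace ℝ EΓ]
  [NormedAddCommGroup EM] [NormedSpace ℝ EM] [FiniteDimensional ℝ EM]
  [TopologicalSpace Γ] [ChartedSpace EΓ Γ] [IsManifold 𝓘(ℝ, EΓ) ∞ Γ]
  [TopologicalSpace M] [T2Space M] [ChartedSpace EM M] [IsManifold 𝓘(ℝ, EM) ∞ M]
  {G : LieGroupoid EΓ EM Γ M} {L : Γ → ℝ}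

/-- The pairing of `V_gβ` and `V_gα` by mixed second derivatives of `L`.  It is defined with chosen
extensions of the vectors to invariant vector fields; it is linear in the second variable because
left- and right-invariant fields commute. -/
theorem exists_pairing (hL : ContMDiff 𝓘(ℝ, EΓ) 𝓘(ℝ, ℝ) ∞ L) (g : Γ) :
    ∃ c : TangentSpace 𝓘(ℝ, EΓ) g →ₗ[ℝ] TangentSpace 𝓘(ℝ, EΓ) g →ₗ[ℝ] ℝ,
      ∀ X Y, G.IsAlgSectionAt X (G.src g) → G.IsAlgSectionAt Y (G.tgt g) →
        c (G.rightField X g) (G.leftField Y g) =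
          dirDeriv (fun k => dirDeriv L k (G.leftField Y k)) g (G.rightField X g) := by
  have hR := fun v : G.vertTgt g => exists_rightField_eq v.2
  have hS := fun v : G.vertSrc g => exists_leftField_eq v.2
  choose R hR using hR
  choose S hS using hS
  have hcomm : ∀ u v, dirDeriv (fun k => dirDeriv L k (G.leftField (S v).val k)) g u.1 =
      dirDeriv (fun k => dirDeriv L k (G.rightField (R u).val k)) g v.1 := fun u v => by
    have h := dirDeriv_leftField_rightField_comm hL ((R u).isAlgSectionAt (G.src g))
      ((S v).isAlgSectionAt (G.tgt g))
    rwa [hR, hS] at h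
  let c₀ : G.vertTgt g →ₗ[ℝ] G.vertSrc g →ₗ[ℝ] ℝ := LinearMap.mk₂ ℝ
    (fun u v => dirDeriv (fun k => dirDeriv L k (G.leftField (S v).val k)) g u.1)
    (fun u u' v => dirDeriv_add _ _ _ _) (fun r u v => dirDeriv_smul _ _ _ _)
    (fun u v v' => by simp only [hcomm]; exact dirDeriv_add _ _ _ _)
    (fun r u v => by simp only [hcomm]; exact dirDeriv_smul _ _ _ _)
  -- the pairing is extended to `T_gΓ × T_gΓ` by means of projections onto `V_gβ` and `V_gα`
  obtain ⟨πA, hπA⟩ := LinearMap.exists_extend (LinearMap.id : G.vertTgt g →ₗ[ℝ] G.vertTgt g)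
  obtain ⟨πB, hπB⟩ := LinearMap.exists_extend (LinearMap.id : G.vertSrc g →ₗ[ℝ] G.vertSrc g)
  refine ⟨c₀.compl₁₂ πA πB, fun X Y hX hY => ?_⟩
  have hu : G.rightField X g ∈ G.vertTgt g := neg_mem (tangentRightInv_mem (hX.mem _))
  have hv : G.leftField Y g ∈ G.vertSrc g := tangentLeft_mem (hY.mem _)
  have h1 : πA (G.rightField X g) = ⟨_, hu⟩ := LinearMap.congr_fun hπA ⟨_, hu⟩
  have h2 : πB (G.leftField Y g) = ⟨_, hv⟩ := LinearMap.congr_fun hπB ⟨_, hv⟩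
  rw [LinearMap.compl₁₂_apply, h1, h2]
  exact dirDeriv_leftField_congr hL hX ((S _).isAlgSectionAt _) hY (hS _)

/-- The Poincaré-Cartan 2-section at `g` is a skew bilinear form on `Vβ ⊕ Vα`, for which both
summands are isotropic; it is given by mixed second derivatives of `L`. -/
theorem exists_omega_bilinear [FiniteDimensional ℝ EΓ]
    (hL : ContMDiff 𝓘(ℝ, EΓ) 𝓘(ℝ, ℝ) ∞ L) (g : Γ) :
    ∃ Ω : (TangentSpace 𝓘(ℝ, EΓ) g × TangentSpace 𝓘(ℝ, EΓ) g) →ₗ[ℝ]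
        (TangentSpace 𝓘(ℝ, EΓ) g × TangentSpace 𝓘(ℝ, EΓ) g) →ₗ[ℝ] ℝ,
      (∀ s s', Ω s s' = -Ω s' s) ∧ (∀ s ∈ G.prol g, ∀ s' ∈ G.prol g, G.omega L g s s' = Ω s s') ∧
      (∀ u u', Ω (u, 0) (u', 0) = 0) ∧ (∀ v v', Ω (0, v) (0, v') = 0) ∧
      (∀ X Y, G.IsAlgSectionAt X (G.src g) → G.IsAlgSectionAt Y (G.tgt g) →
        Ω (G.rightField X g, 0) (0, G.leftField Y g) =
          -dirDeriv (fun k => dirDeriv L k (G.leftField Y k)) g (G.rightField X g)) := by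
  obtain ⟨c, hc⟩ := exists_pairing (G := G) hL g
  let f := LinearMap.fst ℝ (TangentSpace 𝓘(ℝ, EΓ) g) (TangentSpace 𝓘(ℝ, EΓ) g)
  let s := LinearMap.snd ℝ (TangentSpace 𝓘(ℝ, EΓ) g) (TangentSpace 𝓘(ℝ, EΓ) g)
  have hΩ : ∀ s₁ s₂, (c.flip.compl₁₂ s f - c.compl₁₂ f s) s₁ s₂ = c s₂.1 s₁.2 - c s₁.1 s₂.2 :=
    fun _ _ => rfl
  refine ⟨c.flip.compl₁₂ s f - c.compl₁₂ f s, fun s₁ s₂ => ?_, fun s₁ h₁ s₂ h₂ => ?_,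
    fun u u' => ?_, fun v v' => ?_, fun X Y hX hY => ?_⟩
  · rw [hΩ, hΩ]; ring
  · obtain ⟨U, hU⟩ := exists_rightField_eq h₁.1
    obtain ⟨V, hV⟩ := exists_leftField_eq h₁.2
    obtain ⟨U', hU'⟩ := exists_rightField_eq h₂.1
    obtain ⟨V', hV'⟩ := exists_leftField_eq h₂.2
    have h := omega_eq hL (U.isAlgSectionAt (G.src g)) (V.isAlgSectionAt (G.tgt g))
      (U'.isAlgSectionAt (G.src g)) (V'.isAlgSectionAt (G.tgt g))
    rw [← hc _ _ (U'.isAlgSectionAt _) (V.isAlgSectionAt _),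
      ← hc _ _ (U.isAlgSectionAt _) (V'.isAlgSectionAt _), hU, hU', hV, hV'] at h
    exact h
  · rw [hΩ]; simp
  · rw [hΩ]; simp
  · rw [hΩ]; simp [hc X Y hX hY]

end LieGroupoid

section LinearAlgebra

open Module LieGroupoid

variable {V : Type*} [AddCommGroup V] [Module ℝ V]
  {Ω : V →ₗ[ℝ] V →ₗ[ℝ] ℝ} {φ : V → V → ℝ} {A B D P : Submodule ℝ V}

/-- The form `φ` need only agree with the bilinear form `Ω` on `A ⊕ B`, as `Ω_L` is meaningful on
`T^ΓΓ` only. -/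
theorem inter_orthogonal_eq_zero_iff (hφ : ∀ s ∈ A ⊔ B, ∀ s' ∈ A ⊔ B, φ s s' = Ω s s')
    (hskew : ∀ s s', Ω s s' = -Ω s' s) (hnd : NondegenerateOn φ (A ⊔ B))
    (hA : ∀ s ∈ A, ∀ s' ∈ A, Ω s s' = 0) (hB : ∀ s ∈ B, ∀ s' ∈ B, Ω s s' = 0)
    (hDA : D ≤ A) (hPAB : P ≤ A ⊔ B) :
    (P : Set V) ∩ {s | s ∈ A ⊔ B ∧ ∀ s' ∈ D ⊔ B, φ s s' = 0} = {0} ↔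
      ∀ y ∈ P ⊓ B, (∀ x ∈ D, Ω x y = 0) → y = 0 := by
  have hDB : D ⊔ B ≤ A ⊔ B := sup_le_sup_right hDA B
  have hnd' : ∀ s ∈ A ⊔ B, (∀ s' ∈ A ⊔ B, Ω s s' = 0) → s = 0 := fun s hs h =>
    hnd s hs fun s' hs' => (hφ s hs s' hs').trans (h s' hs')
  have key : ∀ s ∈ P, (s ∈ A ⊔ B ∧ ∀ s' ∈ D ⊔ B, φ s s' = 0) ↔ s ∈ B ∧ ∀ x ∈ D, Ω x s = 0 := by
    intro s hs
    rw [← mem_sup_orthogonal_iff hskew hnd' hA hB (hPAB hs)]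
    exact ⟨fun h s' hs' => (hφ s h.1 s' (hDB hs')).symm.trans (h.2 s' hs'), fun h =>
      ⟨hPAB hs, fun s' hs' => (hφ s (hPAB hs) s' (hDB hs')).trans (h s' hs')⟩⟩
  constructor
  · intro h y hy hxy
    have : y ∈ (P : Set V) ∩ {s | s ∈ A ⊔ B ∧ ∀ s' ∈ D ⊔ B, φ s s' = 0} :=
      ⟨hy.1, (key y hy.1).2 ⟨hy.2, hxy⟩⟩
    rwa [h] at this
  · intro h
    refine Set.Subset.antisymm (fun y hy => ?_) ?_
    · have := (key y hy.1).1 hy.2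
      exact h y ⟨hy.1, this.1⟩ this.2
    · rintro _ rfl
      exact ⟨zero_mem P, (key 0 (zero_mem P)).2 ⟨zero_mem B, fun x _ => map_zero _⟩⟩

/-- `finrank_and_nondegenerate_iff` for a form `φ` that is only known to be bilinear on `A ⊕ B`. -/
theorem finrank_and_nondegenerateOn_iff [FiniteDimensional ℝ V]
    (hφ : ∀ s ∈ A ⊔ B, ∀ s' ∈ A ⊔ B, φ s s' = Ω s s')
    (hskew : ∀ s s', Ω s s' = -Ω s' s) (hB : ∀ s ∈ B, ∀ s' ∈ B, Ω s s' = 0)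
    (hAB : Disjoint A B) (hDA : D ≤ A) (hPAB : P ≤ A ⊔ B)
    (hdim : finrank ℝ A + finrank ℝ D ≤ finrank ℝ P) :
    (finrank ℝ (P ⊓ (D ⊔ B) : Submodule ℝ V) = 2 * finrank ℝ D ∧
      NondegenerateOn φ (P ⊓ (D ⊔ B))) ↔
      ∀ y ∈ P ⊓ B, (∀ x ∈ D, Ω x y = 0) → y = 0 := by
  rw [← finrank_and_nondegenerate_iff hskew hB hAB hDA hPAB hdim]
  refine and_congr_right fun _ => forall₂_congr fun s hs => ?_
  have : ∀ s' ∈ P ⊓ (D ⊔ B), φ s s' = Ω s s' := fun s' hs' =>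
    hφ s (hPAB hs.1) s' (hPAB hs'.1)
  exact ⟨fun h h' => h fun s' hs' => (this s' hs').trans (h' s' hs'),
    fun h h' => h fun s' hs' => (this s' hs').symm.trans (h' s' hs')⟩

end LinearAlgebra

/-! ### The subspaces of `T^ΓΓ` and their dimensions -/

namespace LieGroupoid

open Module

variable {EΓ EM Γ M : Type*}
  [NormedAddCommGroup EΓ] [NormedSpace ℝ EΓ] [NormedAddCommGroup EM] [NormedSpace ℝ EM]
  [TopologicalSpace Γ] [ChartedSpace EΓ Γ] [TopologicalSpace M] [ChartedSpace EM M]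
  {G : LieGroupoid EΓ EM Γ M}

instance [FiniteDimensional ℝ EΓ] (g : Γ) : FiniteDimensional ℝ (TangentSpace 𝓘(ℝ, EΓ) g) :=
  inferInstanceAs (FiniteDimensional ℝ EΓ)

theorem finrank_vertSrc [FiniteDimensional ℝ EΓ] (g : Γ) :
    finrank ℝ (G.vertSrc g) + finrank ℝ EM = finrank ℝ EΓ := by
  have h := LinearMap.finrank_range_add_finrank_ker
    (mfderiv 𝓘(ℝ, EΓ) 𝓘(ℝ, EM) G.src g).toLinearMap
  have hs : Function.Surjective (mfderiv 𝓘(ℝ, EΓ) 𝓘(ℝ, EM) G.src g).toLinearMap :=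
    G.isSubmersion_src.mfderiv_surjective g
  rw [LinearMap.range_eq_top.2 hs, finrank_top, add_comm] at h
  exact h

theorem finrank_vertTgt [FiniteDimensional ℝ EΓ] (g : Γ) :
    finrank ℝ (G.vertTgt g) + finrank ℝ EM = finrank ℝ EΓ := by
  have h := LinearMap.finrank_range_add_finrank_ker
    (mfderiv 𝓘(ℝ, EΓ) 𝓘(ℝ, EM) G.tgt g).toLinearMap
  have hs : Function.Surjective (mfderiv 𝓘(ℝ, EΓ) 𝓘(ℝ, EM) G.tgt g).toLinearMap :=
    G.isSubmersion_tgt.mfderiv_surjective g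
  rw [LinearMap.range_eq_top.2 hs, finrank_top, add_comm] at h
  exact h

/-- `V_gβ`, as a subspace of `T_g^ΓΓ = V_gβ ⊕ V_gα`. -/
noncomputable abbrev prolTgt (G : LieGroupoid EΓ EM Γ M) (g : Γ) :
    Submodule ℝ (TangentSpace 𝓘(ℝ, EΓ) g × TangentSpace 𝓘(ℝ, EΓ) g) :=
  (G.vertTgt g).map (LinearMap.inl ℝ _ _)

/-- `V_gα`, as a subspace of `T_g^ΓΓ = V_gβ ⊕ V_gα`. -/
noncomputable abbrev prolSrc (G : LieGroupoid EΓ EM Γ M) (g : Γ) :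
    Submodule ℝ (TangentSpace 𝓘(ℝ, EΓ) g × TangentSpace 𝓘(ℝ, EΓ) g) :=
  (G.vertSrc g).map (LinearMap.inr ℝ _ _)

theorem anchor_inl {g : Γ} (u : TangentSpace 𝓘(ℝ, EΓ) g) : anchor g (u, 0) = u :=
  add_zero u

theorem anchor_inr {g : Γ} (v : TangentSpace 𝓘(ℝ, EΓ) g) : anchor g (0, v) = v :=
  zero_add v

theorem prolTgt_sup_prolSrc (g : Γ) : G.prolTgt g ⊔ G.prolSrc g = G.prol g :=
  (LinearMap.prod_eq_sup_map _ _).symm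

theorem disjoint_prolTgt_prolSrc (g : Γ) : Disjoint (G.prolTgt g) (G.prolSrc g) := by
  rw [Submodule.disjoint_def]
  rintro _ ⟨u, -, rfl⟩ ⟨v, -, h⟩
  have : u = 0 := (congrArg Prod.fst h).symm
  rw [this, map_zero]

theorem finrank_prolTgt (g : Γ) : finrank ℝ (G.prolTgt g) = finrank ℝ (G.vertTgt g) :=
  (Submodule.equivMapOfInjective _ LinearMap.inl_injective _).finrank_eq.symm

theorem finrank_prolSrc (g : Γ) : finrank ℝ (G.prolSrc g) = finrank ℝ (G.vertSrc g) :=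
  (Submodule.equivMapOfInjective _ LinearMap.inr_injective _).finrank_eq.symm

theorem finrank_prol [FiniteDimensional ℝ EΓ] (g : Γ) :
    finrank ℝ (G.prol g) = finrank ℝ (G.vertTgt g) + finrank ℝ (G.vertSrc g) := by
  have h := Submodule.finrank_sup_add_finrank_inf_eq (G.prolTgt g) (G.prolSrc g)
  rwa [(disjoint_prolTgt_prolSrc g).eq_bot, finrank_bot, prolTgt_sup_prolSrc, finrank_prolTgt,
    finrank_prolSrc] at h

end LieGroupoid

namespace DiscreteNonholonomicSystem

open Module LieGroupoid

variable {EΓ EM Γ M : Type*}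
  [NormedAddCommGroup EΓ] [NormedSpace ℝ EΓ] [NormedAddCommGroup EM] [NormedSpace ℝ EM]
  [TopologicalSpace Γ] [ChartedSpace EΓ Γ] [IsManifold 𝓘(ℝ, EΓ) ∞ Γ]
  [TopologicalSpace M] [ChartedSpace EM M]
  {G : LieGroupoid EΓ EM Γ M}
  {EC C : Type*} [NormedAddCommGroup EC] [NormedSpace ℝ EC]
  [TopologicalSpace C] [ChartedSpace EC C]
  {FD : Type*} [NormedAddCommGroup FD] [NormedSpace ℝ FD]
  {D : M → Type*} [∀ x, AddCommGroup (D x)] [∀ x, Module ℝ (D x)]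
  [∀ x, TopologicalSpace (D x)] [TopologicalSpace (Bundle.TotalSpace FD D)]
  [FiberBundle FD D]
  (S : DiscreteNonholonomicSystem G EC C FD D)

theorem mfderiv_emb_injective (c : C) :
    Function.Injective (mfderiv 𝓘(ℝ, EC) 𝓘(ℝ, EΓ) S.emb c) :=
  S.isSmoothEmbedding_emb.isImmersion.mfderiv_injective c

theorem finrank_tangentC [FiniteDimensional ℝ EΓ] (c : C) :
    finrank ℝ (S.tangentC c) = finrank ℝ EC :=
  LinearMap.finrank_range_of_inj (S.mfderiv_emb_injective c)

theorem constraint_le (x : M) : S.constraint x ≤ G.algFiber x := by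
  rintro _ ⟨v, rfl⟩
  exact S.incl_mem x v

theorem finrank_constraint [VectorBundle ℝ FD D] (x : M) :
    finrank ℝ (S.constraint x) = finrank ℝ FD :=
  (LinearMap.finrank_range_of_inj (S.injective_incl x)).trans
    ((trivializationAt FD D x).continuousLinearEquivAt ℝ x
      (FiberBundle.mem_baseSet_trivializationAt FD D x)).toLinearEquiv.finrank_eq

/-- The anchor maps into `T_hΓ`, so that `ρ⁻¹(T_hM_c)` has at most the codimension of `M_c`. -/
theorem finrank_le_anchorPre [FiniteDimensional ℝ EΓ] (c : C) :
    finrank ℝ (G.prol (S.emb c)) + finrank ℝ EC ≤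
      finrank ℝ (S.anchorPre c) + finrank ℝ EΓ := by
  have h := finrank_comap_ge (anchor (S.emb c)) (G.prol (S.emb c)) (S.tangentC c)
  rwa [S.finrank_tangentC] at h

/-- The part of `F_h` in `V_hβ`, the image of `D_c(α(h))`. -/
noncomputable abbrev constraintTgt (h : Γ) :
    Submodule ℝ (TangentSpace 𝓘(ℝ, EΓ) h × TangentSpace 𝓘(ℝ, EΓ) h) :=
  (S.constraint (G.src h)).map
    (LinearMap.inl ℝ _ (TangentSpace 𝓘(ℝ, EΓ) h) ∘ₗ (G.tangentRightInv h).toLinearMap)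

/-- The part of `F̄_g` in `V_gα`, the image of `D_c(β(g))`. -/
noncomputable abbrev constraintSrc (g : Γ) :
    Submodule ℝ (TangentSpace 𝓘(ℝ, EΓ) g × TangentSpace 𝓘(ℝ, EΓ) g) :=
  (S.constraint (G.tgt g)).map
    (LinearMap.inr ℝ (TangentSpace 𝓘(ℝ, EΓ) g) _ ∘ₗ (G.tangentLeft g).toLinearMap)

theorem constraintTgt_le (h : Γ) : S.constraintTgt h ≤ G.prolTgt h := by
  rintro _ ⟨a, ha, rfl⟩
  exact ⟨_, tangentRightInv_mem (S.constraint_le _ ha), rfl⟩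

theorem constraintSrc_le (g : Γ) : S.constraintSrc g ≤ G.prolSrc g := by
  rintro _ ⟨b, hb, rfl⟩
  exact ⟨_, tangentLeft_mem (S.constraint_le _ hb), rfl⟩

theorem finrank_constraintTgt [VectorBundle ℝ FD D] (h : Γ) :
    finrank ℝ (S.constraintTgt h) = finrank ℝ FD := by
  rw [constraintTgt, ← LinearMap.range_domRestrict]
  refine (LinearMap.finrank_range_of_inj fun a b hab => Subtype.ext ?_).trans
    (S.finrank_constraint _)
  rw [← tangentInvRightBack_tangentRightInv (S.constraint_le _ a.2),
    ← tangentInvRightBack_tangentRightInv (S.constraint_le _ b.2)]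
  exact congrArg (fun s => G.tangentInvRightBack h s.1) hab

theorem finrank_constraintSrc [VectorBundle ℝ FD D] (g : Γ) :
    finrank ℝ (S.constraintSrc g) = finrank ℝ FD := by
  rw [constraintSrc, ← LinearMap.range_domRestrict]
  refine (LinearMap.finrank_range_of_inj fun a b hab => Subtype.ext ?_).trans
    (S.finrank_constraint _)
  rw [← tangentLeftBack_tangentLeft (S.constraint_le _ a.2),
    ← tangentLeftBack_tangentLeft (S.constraint_le _ b.2)]
  exact congrArg (fun s => G.tangentLeftBack g s.2) hab

theorem subF_eq (h : Γ) : S.subF h = S.constraintTgt h ⊔ G.prolSrc h := by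
  have key : ∀ s, s ∈ ((S.constraint (G.src h)).dualAnnihilator.map
      (G.lift10 h)).dualCoannihilator ↔ G.tangentInvRightBack h s.1 ∈ S.constraint (G.src h) := by
    intro s
    rw [← Subspace.dualAnnihilator_dualCoannihilator_eq (W := S.constraint (G.src h)),
      Submodule.mem_dualCoannihilator, Submodule.mem_dualCoannihilator,
      Subspace.dualAnnihilator_dualCoannihilator_eq]
    simp only [Submodule.mem_map, forall_exists_index, and_imp, forall_apply_eq_imp_iff₂]
    rfl
  ext s
  constructor
  · rintro ⟨hs, hs'⟩
    refine Submodule.mem_sup.2 ⟨(s.1, 0), ⟨_, (key s).1 hs', ?_⟩, (0, s.2), ⟨_, hs.2, rfl⟩, ?_⟩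
    · exact Prod.ext (tangentRightInv_tangentInvRightBack hs.1) rfl
    · simp
  · intro hs
    obtain ⟨_, ⟨a, ha, rfl⟩, _, ⟨v, hv, rfl⟩, rfl⟩ := Submodule.mem_sup.1 hs
    have ha' := S.constraint_le _ ha
    refine ⟨?_, (key _).2 ?_⟩
    · rw [← prolTgt_sup_prolSrc]
      exact add_mem (Submodule.mem_sup_left (S.constraintTgt_le h ⟨a, ha, rfl⟩))
        (Submodule.mem_sup_right ⟨v, hv, rfl⟩)
    · have : G.tangentInvRightBack h (G.tangentRightInv h a + 0) = a := by
        rw [add_zero]; exact tangentInvRightBack_tangentRightInv ha'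
      exact (congrArg (· ∈ S.constraint (G.src h)) this).mpr ha

theorem subFbar_eq (g : Γ) : S.subFbar g = S.constraintSrc g ⊔ G.prolTgt g := by
  have key : ∀ s, s ∈ ((S.constraint (G.tgt g)).dualAnnihilator.map
      (G.lift01 g)).dualCoannihilator ↔ G.tangentLeftBack g s.2 ∈ S.constraint (G.tgt g) := by
    intro s
    rw [← Subspace.dualAnnihilator_dualCoannihilator_eq (W := S.constraint (G.tgt g)),
      Submodule.mem_dualCoannihilator, Submodule.mem_dualCoannihilator,
      Subspace.dualAnnihilator_dualCoannihilator_eq]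
    simp only [Submodule.mem_map, forall_exists_index, and_imp, forall_apply_eq_imp_iff₂]
    rfl
  ext s
  constructor
  · rintro ⟨hs, hs'⟩
    refine Submodule.mem_sup.2 ⟨(0, s.2), ⟨_, (key s).1 hs', ?_⟩, (s.1, 0), ⟨_, hs.1, rfl⟩, ?_⟩
    · exact Prod.ext rfl (tangentLeft_tangentLeftBack hs.2)
    · simp
  · intro hs
    obtain ⟨_, ⟨b, hb, rfl⟩, _, ⟨v, hv, rfl⟩, rfl⟩ := Submodule.mem_sup.1 hs
    have hb' := S.constraint_le _ hb
    refine ⟨?_, (key _).2 ?_⟩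
    · rw [← prolTgt_sup_prolSrc]
      exact add_mem (Submodule.mem_sup_right (S.constraintSrc_le g ⟨b, hb, rfl⟩))
        (Submodule.mem_sup_left ⟨v, hv, rfl⟩)
    · have : G.tangentLeftBack g (G.tangentLeft g b + 0) = b := by
        rw [add_zero]; exact tangentLeftBack_tangentLeft hb'
      exact (congrArg (· ∈ S.constraint (G.tgt g)) this).mpr hb

theorem anchorPre_le (c : C) : S.anchorPre c ≤ G.prol (S.emb c) := inf_le_left

variable {S} {c : C} {Ω : (TangentSpace 𝓘(ℝ, EΓ) (S.emb c) × TangentSpace 𝓘(ℝ, EΓ) (S.emb c)) →ₗ[ℝ]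
  (TangentSpace 𝓘(ℝ, EΓ) (S.emb c) × TangentSpace 𝓘(ℝ, EΓ) (S.emb c)) →ₗ[ℝ] ℝ}

theorem gForm_eq_zero_iff
    (hΩ : ∀ s ∈ G.prol (S.emb c), ∀ s' ∈ G.prol (S.emb c), G.omega S.L (S.emb c) s s' = Ω s s')
    {a : TangentSpace 𝓘(ℝ, EΓ) (G.one (G.src (S.emb c)))} (ha : a ∈ G.algFiber _)
    {b : TangentSpace 𝓘(ℝ, EΓ) (G.one (G.tgt (S.emb c)))} (hb : b ∈ G.algFiber _) :
    G.gForm S.L (S.emb c) a b = 0 ↔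
      Ω (G.tangentRightInv (S.emb c) a, 0) (0, G.tangentLeft (S.emb c) b) = 0 := by
  have h := hΩ (-G.tangentRightInv (S.emb c) a, 0) ⟨neg_mem (tangentRightInv_mem ha), zero_mem _⟩
    (0, G.tangentLeft (S.emb c) b) ⟨zero_mem _, tangentLeft_mem hb⟩
  have h' : ((-G.tangentRightInv (S.emb c) a, 0) :
      TangentSpace 𝓘(ℝ, EΓ) (S.emb c) × TangentSpace 𝓘(ℝ, EΓ) (S.emb c)) =
      -(G.tangentRightInv (S.emb c) a, 0) := Prod.ext rfl neg_zero.symm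
  rw [gForm, h, h', map_neg, LinearMap.neg_apply, neg_eq_zero]

/-- The left translation identifies the set in the fourth condition for `F⁻` with the orthogonal of
`D_c(α(h))` in `ρ⁻¹(T_hM_c) ∩ V_hα`. -/
theorem leftE_gForm_eq_zero_iff
    (hΩ : ∀ s ∈ G.prol (S.emb c), ∀ s' ∈ G.prol (S.emb c), G.omega S.L (S.emb c) s s' = Ω s s') :
    {b | b ∈ S.leftE c ∧
      ∀ a ∈ S.constraint (G.src (S.emb c)), G.gForm S.L (S.emb c) a b = 0} = {0} ↔
    ∀ y ∈ S.anchorPre c ⊓ G.prolSrc (S.emb c),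
      (∀ x ∈ S.constraintTgt (S.emb c), Ω x y = 0) → y = 0 := by
  constructor
  · rintro h _ ⟨hy, v, hv, rfl⟩ hxy
    have hT := tangentLeft_tangentLeftBack hv
    have hm := tangentLeftBack_mem hv
    have hvC : v ∈ S.tangentC c :=
      (congrArg (· ∈ S.tangentC c) (anchor_inr v)).mp hy.2
    have hb : G.tangentLeftBack (S.emb c) v ∈ {b | b ∈ S.leftE c ∧
        ∀ a ∈ S.constraint (G.src (S.emb c)), G.gForm S.L (S.emb c) a b = 0} := by
      refine ⟨⟨hm, (congrArg (· ∈ S.tangentC c) hT).mpr hvC⟩, fun a ha => ?_⟩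
      rw [gForm_eq_zero_iff hΩ (S.constraint_le _ ha) hm, hT]
      exact hxy _ ⟨a, ha, rfl⟩
    rw [h] at hb
    rw [← hT, Set.mem_singleton_iff.1 hb, map_zero, map_zero]
  · intro h
    refine Set.Subset.antisymm ?_ ?_
    · rintro b ⟨⟨hb, hbC⟩, hab⟩
      have hy : ((0, G.tangentLeft (S.emb c) b) :
          TangentSpace 𝓘(ℝ, EΓ) (S.emb c) × TangentSpace 𝓘(ℝ, EΓ) (S.emb c)) = 0 := by
        refine h _ ⟨⟨⟨zero_mem _, tangentLeft_mem hb⟩, ?_⟩, _, tangentLeft_mem hb, rfl⟩ ?_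
        · exact (congrArg (· ∈ S.tangentC c) (anchor_inr _)).mpr hbC
        · rintro _ ⟨a, ha, rfl⟩
          exact (gForm_eq_zero_iff hΩ (S.constraint_le _ ha) hb).1 (hab a ha)
      have h0 : G.tangentLeft (S.emb c) b = 0 := congrArg Prod.snd hy
      rw [Set.mem_singleton_iff, ← tangentLeftBack_tangentLeft hb, h0, map_zero]
    · rintro _ rfl
      refine ⟨zero_mem _, fun a ha => ?_⟩
      rw [gForm_eq_zero_iff hΩ (S.constraint_le _ ha) (zero_mem _), map_zero]
      exact map_zero _

/-- The right translation identifies the set in the fourth condition for `F⁺` with the orthogonal of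
`D_c(β(g))` in `ρ⁻¹(T_gM_c) ∩ V_gβ`. -/
theorem rightE_gForm_eq_zero_iff (hskew : ∀ s s', Ω s s' = -Ω s' s)
    (hΩ : ∀ s ∈ G.prol (S.emb c), ∀ s' ∈ G.prol (S.emb c), G.omega S.L (S.emb c) s s' = Ω s s') :
    {a | a ∈ S.rightE c ∧
      ∀ b ∈ S.constraint (G.tgt (S.emb c)), G.gForm S.L (S.emb c) a b = 0} = {0} ↔
    ∀ y ∈ S.anchorPre c ⊓ G.prolTgt (S.emb c),
      (∀ x ∈ S.constraintSrc (S.emb c), Ω x y = 0) → y = 0 := by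
  have hflip : ∀ x y, Ω x y = 0 ↔ Ω y x = 0 := fun x y => by rw [hskew, neg_eq_zero]
  constructor
  · rintro h _ ⟨hy, v, hv, rfl⟩ hxy
    have hT := tangentRightInv_tangentInvRightBack hv
    have hm := tangentInvRightBack_mem hv
    have hvC : v ∈ S.tangentC c :=
      (congrArg (· ∈ S.tangentC c) (anchor_inl v)).mp hy.2
    have ha : G.tangentInvRightBack (S.emb c) v ∈ {a | a ∈ S.rightE c ∧
        ∀ b ∈ S.constraint (G.tgt (S.emb c)), G.gForm S.L (S.emb c) a b = 0} := by
      refine ⟨⟨hm, (congrArg (· ∈ S.tangentC c) hT).mpr hvC⟩, fun b hb => ?_⟩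
      rw [gForm_eq_zero_iff hΩ hm (S.constraint_le _ hb), hT, hflip]
      exact hxy _ ⟨b, hb, rfl⟩
    rw [h] at ha
    rw [← hT, Set.mem_singleton_iff.1 ha, map_zero, map_zero]
  · intro h
    refine Set.Subset.antisymm ?_ ?_
    · rintro a ⟨⟨ha, haC⟩, hab⟩
      have hy : ((G.tangentRightInv (S.emb c) a, 0) :
          TangentSpace 𝓘(ℝ, EΓ) (S.emb c) × TangentSpace 𝓘(ℝ, EΓ) (S.emb c)) = 0 := by
        refine h _ ⟨⟨⟨tangentRightInv_mem ha, zero_mem _⟩, ?_⟩, _, tangentRightInv_mem ha, rfl⟩ ?_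
        · exact (congrArg (· ∈ S.tangentC c) (anchor_inl _)).mpr haC
        · rintro _ ⟨b, hb, rfl⟩
          exact (hflip _ _).1 ((gForm_eq_zero_iff hΩ ha (S.constraint_le _ hb)).1 (hab b hb))
      have h0 : G.tangentRightInv (S.emb c) a = 0 := congrArg Prod.fst hy
      rw [Set.mem_singleton_iff, ← tangentInvRightBack_tangentRightInv ha, h0, map_zero]
    · rintro _ rfl
      refine ⟨zero_mem _, fun b hb => ?_⟩
      rw [gForm_eq_zero_iff hΩ (zero_mem _) (S.constraint_le _ hb), map_zero]
      exact LinearMap.congr_fun (map_zero Ω) _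

variable (S)

theorem anchorPre_inter_orth_subF_iff [FiniteDimensional ℝ EΓ] [FiniteDimensional ℝ EM]
    [T2Space M] [IsManifold 𝓘(ℝ, EM) ∞ M] (c : C) :
    (S.anchorPre c : Set _) ∩ S.orth (S.emb c) (S.subF (S.emb c)) = {0} ↔
    {b | b ∈ S.leftE c ∧
      ∀ a ∈ S.constraint (G.src (S.emb c)), G.gForm S.L (S.emb c) a b = 0} = {0} := by
  obtain ⟨Ω, hskew, hΩ, hR, hL, -⟩ := exists_omega_bilinear (G := G) S.smooth_L (S.emb c)
  rw [leftE_gForm_eq_zero_iff hΩ, orth, subF_eq, ← prolTgt_sup_prolSrc]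
  rw [← prolTgt_sup_prolSrc] at hΩ
  refine inter_orthogonal_eq_zero_iff hΩ hskew ?_ ?_ ?_ (S.constraintTgt_le _) ?_
  · rw [prolTgt_sup_prolSrc]; exact S.regular _
  · rintro _ ⟨u, -, rfl⟩ _ ⟨u', -, rfl⟩; exact hR u u'
  · rintro _ ⟨v, -, rfl⟩ _ ⟨v', -, rfl⟩; exact hL v v'
  · rw [prolTgt_sup_prolSrc]; exact S.anchorPre_le c

theorem anchorPre_inter_orth_subFbar_iff [FiniteDimensional ℝ EΓ] [FiniteDimensional ℝ EM]
    [T2Space M] [IsManifold 𝓘(ℝ, EM) ∞ M] (c : C) :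
    (S.anchorPre c : Set _) ∩ S.orth (S.emb c) (S.subFbar (S.emb c)) = {0} ↔
    {a | a ∈ S.rightE c ∧
      ∀ b ∈ S.constraint (G.tgt (S.emb c)), G.gForm S.L (S.emb c) a b = 0} = {0} := by
  obtain ⟨Ω, hskew, hΩ, hR, hL, -⟩ := exists_omega_bilinear (G := G) S.smooth_L (S.emb c)
  have hsup : G.prolSrc (S.emb c) ⊔ G.prolTgt (S.emb c) = G.prol (S.emb c) := by
    rw [sup_comm, prolTgt_sup_prolSrc]
  rw [rightE_gForm_eq_zero_iff hskew hΩ, orth, subFbar_eq, ← hsup]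
  rw [← hsup] at hΩ
  refine inter_orthogonal_eq_zero_iff hΩ hskew ?_ ?_ ?_ (S.constraintSrc_le _) ?_
  · rw [hsup]; exact S.regular _
  · rintro _ ⟨v, -, rfl⟩ _ ⟨v', -, rfl⟩; exact hL v v'
  · rintro _ ⟨u, -, rfl⟩ _ ⟨u', -, rfl⟩; exact hR u u'
  · rw [hsup]; exact S.anchorPre_le c

theorem finrank_subH_and_nondegenerateOn_iff [FiniteDimensional ℝ EΓ] [FiniteDimensional ℝ EM]
    [T2Space M] [IsManifold 𝓘(ℝ, EM) ∞ M] [VectorBundle ℝ FD D] (c : C) :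
    (finrank ℝ (S.subH c) = 2 * finrank ℝ FD ∧
      NondegenerateOn (G.omega S.L (S.emb c)) (S.subH c)) ↔
    {b | b ∈ S.leftE c ∧
      ∀ a ∈ S.constraint (G.src (S.emb c)), G.gForm S.L (S.emb c) a b = 0} = {0} := by
  obtain ⟨Ω, hskew, hΩ, hR, hL, -⟩ := exists_omega_bilinear (G := G) S.smooth_L (S.emb c)
  rw [leftE_gForm_eq_zero_iff hΩ, subH, subF_eq, ← S.finrank_constraintTgt (S.emb c)]
  rw [← prolTgt_sup_prolSrc] at hΩ
  refine finrank_and_nondegenerateOn_iff hΩ hskew ?_ (disjoint_prolTgt_prolSrc _)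
    (S.constraintTgt_le _) ?_ ?_
  · rintro _ ⟨v, -, rfl⟩ _ ⟨v', -, rfl⟩; exact hL v v'
  · rw [prolTgt_sup_prolSrc]; exact S.anchorPre_le c
  · rw [finrank_prolTgt, finrank_constraintTgt]
    have h1 := S.finrank_le_anchorPre c
    have h2 := G.finrank_vertSrc (S.emb c)
    rw [finrank_prol, S.finrank_eq] at h1
    omega

theorem finrank_subHbar_and_nondegenerateOn_iff [FiniteDimensional ℝ EΓ] [FiniteDimensional ℝ EM]
    [T2Space M] [IsManifold 𝓘(ℝ, EM) ∞ M] [VectorBundle ℝ FD D] (c : C) :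
    (finrank ℝ (S.subHbar c) = 2 * finrank ℝ FD ∧
      NondegenerateOn (G.omega S.L (S.emb c)) (S.subHbar c)) ↔
    {a | a ∈ S.rightE c ∧
      ∀ b ∈ S.constraint (G.tgt (S.emb c)), G.gForm S.L (S.emb c) a b = 0} = {0} := by
  obtain ⟨Ω, hskew, hΩ, hR, hL, -⟩ := exists_omega_bilinear (G := G) S.smooth_L (S.emb c)
  have hsup : G.prolSrc (S.emb c) ⊔ G.prolTgt (S.emb c) = G.prol (S.emb c) := by
    rw [sup_comm, prolTgt_sup_prolSrc]
  rw [rightE_gForm_eq_zero_iff hskew hΩ, subHbar, subFbar_eq, ← S.finrank_constraintSrc (S.emb c)]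
  rw [← hsup] at hΩ
  refine finrank_and_nondegenerateOn_iff hΩ hskew ?_ (disjoint_prolTgt_prolSrc _).symm
    (S.constraintSrc_le _) ?_ ?_
  · rintro _ ⟨u, -, rfl⟩ _ ⟨u', -, rfl⟩; exact hR u u'
  · rw [hsup]; exact S.anchorPre_le c
  · rw [finrank_prolSrc, finrank_constraintSrc]
    have h1 := S.finrank_le_anchorPre c
    have h2 := G.finrank_vertTgt (S.emb c)
    rw [finrank_prol, S.finrank_eq] at h1
    omega

end DiscreteNonholonomicSystem

/-! ### Local diffeomorphisms and maps to a dual bundle -/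

section LocalDiffeomorph

variable {E E' H' N P : Type*} [NormedAddCommGroup E] [NormedSpace ℝ E] [FiniteDimensional ℝ E]
  [NormedAddCommGroup E'] [NormedSpace ℝ E'] [FiniteDimensional ℝ E'] [TopologicalSpace H']
  {J : ModelWithCorners ℝ E' H'} [J.Boundaryless]
  [TopologicalSpace N] [ChartedSpace E N] [IsManifold 𝓘(ℝ, E) ∞ N]
  [TopologicalSpace P] [ChartedSpace H' P] [IsManifold J ∞ P]

/-- Between manifolds of the same dimension, the local diffeomorphisms are the immersions. -/
theorem isLocalDiffeomorph_iff_mfderiv {f : N → P} (hf : ContMDiff 𝓘(ℝ, E) J ∞ f)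
    (hdim : Module.finrank ℝ E = Module.finrank ℝ E') :
    IsLocalDiffeomorph 𝓘(ℝ, E) J ∞ f ↔
      ∀ x, ∀ v : TangentSpace 𝓘(ℝ, E) x, mfderiv 𝓘(ℝ, E) J f x v = 0 → v = 0 := by
  constructor
  · intro h x v hv
    exact ((h x).mfderivToContinuousLinearEquiv (by simp)).map_eq_zero_iff.1 hv
  · intro h x
    let A : E →L[ℝ] E' := mfderiv 𝓘(ℝ, E) J f x
    have hA : Function.Injective A.toLinearMap := (injective_iff_map_eq_zero _).2 (h x)
    exact isLocalDiffeomorphAt_of_bijective_mfderiv hf x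
      ⟨hA, (LinearMap.injective_iff_surjective_of_finrank_eq_finrank hdim).1 hA⟩

end LocalDiffeomorph

section DualBundle

variable {EN HN N F : Type*} [NormedAddCommGroup EN] [NormedSpace ℝ EN] [TopologicalSpace HN]
  {I : ModelWithCorners ℝ EN HN} [TopologicalSpace N] [ChartedSpace HN N]
  [NormedAddCommGroup F] [NormedSpace ℝ F]

/-- Functionals on a finite dimensional space depend smoothly on a parameter if their values do. -/
theorem contMDiffAt_clm_of_apply [FiniteDimensional ℝ F] {A : N → F →L[ℝ] ℝ} {x : N}
    (h : ∀ v, ContMDiffAt I 𝓘(ℝ, ℝ) ∞ (fun y => A y v) x) :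
    ContMDiffAt I 𝓘(ℝ, F →L[ℝ] ℝ) ∞ A x := by
  let b := Module.finBasis ℝ F
  have hA : A = fun y => ∑ i, A y (b i) • (b.coord i).toContinuousLinearMap := by
    funext y
    refine ContinuousLinearMap.coe_injective (b.ext fun j => ?_)
    simp [Finsupp.single_apply]
  rw [hA]
  refine ContMDiffAt.sum fun i _ => ?_
  exact (h (b i)).smul contMDiffAt_const

variable {EB HB B : Type*} [NormedAddCommGroup EB] [NormedSpace ℝ EB] [TopologicalSpace HB]
  {IB : ModelWithCorners ℝ EB HB} [TopologicalSpace B] [ChartedSpace HB B]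
  {Z : B → Type*} [∀ x, AddCommGroup (Z x)] [∀ x, Module ℝ (Z x)] [∀ x, TopologicalSpace (Z x)]
  [TopologicalSpace (Bundle.TotalSpace F Z)] [FiberBundle F Z] [VectorBundle ℝ F Z]

/-- The section of a vector bundle with the constant coordinates `v` in the trivialization at
`x₀`. -/
noncomputable def constSection (Z : B → Type*) [∀ x, AddCommGroup (Z x)] [∀ x, Module ℝ (Z x)]
    [∀ x, TopologicalSpace (Z x)] [TopologicalSpace (Bundle.TotalSpace F Z)] [FiberBundle F Z]
    [VectorBundle ℝ F Z] (x₀ : B) (v : F) (x : B) : Z x :=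
  (trivializationAt F Z x₀).symmL ℝ x v

/-- The coordinates of an element of the dual bundle are its values on the sections with constant
coordinates. -/
theorem trivializationAt_dual_apply (x₀ : B)
    (p : Bundle.TotalSpace (F →L[ℝ] ℝ) (fun x : B => Z x →L[ℝ] Bundle.Trivial B ℝ x)) (v : F) :
    (trivializationAt (F →L[ℝ] ℝ) (fun x : B => Z x →L[ℝ] Bundle.Trivial B ℝ x) x₀ p).2 v =
      p.2 (constSection Z x₀ v p.1) := by
  rw [hom_trivializationAt_apply]
  simp only [ContinuousLinearMap.inCoordinates]
  erw [Bundle.Trivial.continuousLinearMapAt_trivialization]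
  rfl

theorem surjective_constSection (x₀ : B) (w : Z x₀) : ∃ v : F, constSection Z x₀ v x₀ = w :=
  ⟨_, (trivializationAt F Z x₀).symmL_continuousLinearMapAt
    (FiberBundle.mem_baseSet_trivializationAt F Z x₀) w⟩

theorem contMDiffAt_constSection [ContMDiffVectorBundle ∞ F Z IB] (x₀ : B) (v : F) :
    ContMDiffAt IB (IB.prod 𝓘(ℝ, F)) ∞
      (fun x => (⟨x, constSection Z x₀ v x⟩ : Bundle.TotalSpace F Z)) x₀ := by
  refine Bundle.contMDiffAt_totalSpace.2 ⟨contMDiffAt_id, ?_⟩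
  refine (contMDiffAt_const (c := v)).congr_of_eventuallyEq ?_
  filter_upwards [(trivializationAt F Z x₀).open_baseSet.mem_nhds
    (FiberBundle.mem_baseSet_trivializationAt F Z x₀)] with x hx
  have h := (trivializationAt F Z x₀).continuousLinearMapAt_symmL (R := ℝ) hx v
  rwa [Bundle.Trivialization.continuousLinearMapAt_apply_of_mem _ _ hx] at h

variable {f : N → Bundle.TotalSpace (F →L[ℝ] ℝ) (fun x : B => Z x →L[ℝ] Bundle.Trivial B ℝ x)}
  {x : N}

/-- A map to the dual of a vector bundle is smooth if its values on the sections with constant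
coordinates are. -/
theorem contMDiffAt_dual [FiniteDimensional ℝ F] (h₁ : ContMDiffAt I IB ∞ (fun y => (f y).proj) x)
    (h₂ : ∀ v : F, ContMDiffAt I 𝓘(ℝ, ℝ) ∞
      (fun y => (f y).2 (constSection Z (f x).proj v (f y).proj)) x) :
    ContMDiffAt I (IB.prod 𝓘(ℝ, F →L[ℝ] ℝ)) ∞ f x := by
  refine Bundle.contMDiffAt_totalSpace.2 ⟨h₁, contMDiffAt_clm_of_apply fun v => ?_⟩
  simp only [trivializationAt_dual_apply]
  exact h₂ v

/-- The kernel of the derivative of a map to the dual of a vector bundle, by the values of the map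
on the sections with constant coordinates. -/
theorem mfderiv_dual_eq_zero_iff [FiniteDimensional ℝ F]
    (h₁ : ContMDiffAt I IB ∞ (fun y => (f y).proj) x)
    (h₂ : ∀ v : F, ContMDiffAt I 𝓘(ℝ, ℝ) ∞
      (fun y => (f y).2 (constSection Z (f x).proj v (f y).proj)) x) (w : TangentSpace I x) :
    mfderiv I (IB.prod 𝓘(ℝ, F →L[ℝ] ℝ)) f x w = 0 ↔
      mfderiv I IB (fun y => (f y).proj) x w = 0 ∧
      ∀ v : F, @Eq ℝ (mfderiv I 𝓘(ℝ, ℝ)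
        (fun y => (f y).2 (constSection Z (f x).proj v (f y).proj)) x w) 0 := by
  have hf := (contMDiffAt_dual h₁ h₂).mdifferentiableAt (by simp)
  have hA := ((Bundle.contMDiffAt_totalSpace.1 (contMDiffAt_dual h₁ h₂)).2).mdifferentiableAt
    (by simp)
  let A : EN →L[ℝ] (F →L[ℝ] ℝ) := mfderiv I 𝓘(ℝ, F →L[ℝ] ℝ) (fun y => (trivializationAt (F →L[ℝ] ℝ)
    (fun x : B => Z x →L[ℝ] Bundle.Trivial B ℝ x) (f x).proj (f y)).2) x
  have key : ∀ v : F, @Eq ℝ (mfderiv I 𝓘(ℝ, ℝ)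
      (fun y => (f y).2 (constSection Z (f x).proj v (f y).proj)) x w) (A w v) := by
    intro v
    have h := HasMFDerivAt.comp x
      (ContinuousLinearMap.hasMFDerivAt (ContinuousLinearMap.apply ℝ ℝ v)) hA.hasMFDerivAt
    have h' : (fun y => (f y).2 (constSection Z (f x).proj v (f y).proj)) =
        (ContinuousLinearMap.apply ℝ ℝ v) ∘ (fun y => (trivializationAt (F →L[ℝ] ℝ)
          (fun x : B => Z x →L[ℝ] Bundle.Trivial B ℝ x) (f x).proj (f y)).2) := by
      funext y
      exact (trivializationAt_dual_apply (f x).proj (f y) v).symm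
    rw [h']
    exact congrArg (fun A : EN →L[ℝ] ℝ => A w) h.mfderiv
  have h := mfderiv_totalSpace hf w
  simp only [key]
  have h' : ∀ p : EB × (F →L[ℝ] ℝ), p = 0 ↔ p.1 = 0 ∧ ∀ v, p.2 v = 0 := fun p =>
    Prod.mk_eq_zero.trans (and_congr_right fun _ => ContinuousLinearMap.ext_iff)
  exact (Eq.congr_left h).trans (h' _)

end DualBundle

/-! ### The Legendre transformations -/

namespace DiscreteNonholonomicSystem

open Module LieGroupoid

variable {EΓ EM Γ M : Type*}
  [NormedAddCommGroup EΓ] [NormedSpace ℝ EΓ] [NormedAddCommGroup EM] [NormedSpace ℝ EM]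
  [TopologicalSpace Γ] [ChartedSpace EΓ Γ] [IsManifold 𝓘(ℝ, EΓ) ∞ Γ]
  [TopologicalSpace M] [ChartedSpace EM M]
  {G : LieGroupoid EΓ EM Γ M}
  {EC C : Type*} [NormedAddCommGroup EC] [NormedSpace ℝ EC]
  [TopologicalSpace C] [ChartedSpace EC C]
  {FD : Type*} [NormedAddCommGroup FD] [NormedSpace ℝ FD]
  {D : M → Type*} [∀ x, AddCommGroup (D x)] [∀ x, Module ℝ (D x)]
  [∀ x, TopologicalSpace (D x)] [TopologicalSpace (Bundle.TotalSpace FD D)]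
  [FiberBundle FD D]
  (S : DiscreteNonholonomicSystem G EC C FD D)

theorem contMDiff_emb : ContMDiff 𝓘(ℝ, EC) 𝓘(ℝ, EΓ) ∞ S.emb :=
  S.isSmoothEmbedding_emb.isImmersion.contMDiff

variable [VectorBundle ℝ FD D]

/-- The section of `D_c ⊆ E_Γ` with the constant coordinates `v` in the trivialization at `x₀`. -/
noncomputable def constraintSection (x₀ : M) (v : FD) (x : M) : TangentSpace 𝓘(ℝ, EΓ) (G.one x) :=
  S.incl x (constSection D x₀ v x)

theorem isAlgSectionAt_constraintSection [ContMDiffVectorBundle ∞ FD D 𝓘(ℝ, EM)] (x₀ : M) (v : FD) :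
    G.IsAlgSectionAt (S.constraintSection x₀ v) x₀ :=
  ⟨fun x => S.incl_mem x _, ContMDiffAt.comp x₀ (g := fun p : Bundle.TotalSpace FD D =>
      (⟨G.one p.proj, S.incl p.proj p.snd⟩ : TangentBundle 𝓘(ℝ, EΓ) Γ))
    (S.smooth_incl _) (contMDiffAt_constSection x₀ v)⟩

theorem mem_constraint_iff {x₀ : M} {a : TangentSpace 𝓘(ℝ, EΓ) (G.one x₀)} :
    a ∈ S.constraint x₀ ↔ ∃ v : FD, S.constraintSection x₀ v x₀ = a := by
  constructor
  · rintro ⟨w, rfl⟩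
    obtain ⟨v, rfl⟩ := surjective_constSection (F := FD) x₀ w
    exact ⟨v, rfl⟩
  · rintro ⟨v, rfl⟩
    exact ⟨_, rfl⟩

/-- `F⁻(h)` is the derivative of `L` along the right-invariant fields of the sections of `D_c`. -/
theorem legendreMinus_apply (c : C) (x₀ : M) (v : FD) :
    (S.legendreMinus c).2 (constSection D x₀ v (S.legendreMinus c).proj) =
      dirDeriv S.L (S.emb c) (G.rightField (S.constraintSection x₀ v) (S.emb c)) := by
  have hm := S.incl_mem (G.src (S.emb c)) (constSection D x₀ v (G.src (S.emb c)))
  obtain ⟨a, hac, ha, has⟩ := exists_curve_of_mem_algFiber hm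
  have hLd := (S.smooth_L (S.emb c)).mdifferentiableAt (n := ∞) (by simp)
  have h1 := (hasVelocityAt_inv_mul ha has).hasDerivAt_comp hLd
  have hmem : G.one (G.src (S.emb c)) ∈ G.src ⁻¹' {G.src (S.emb c)} := G.src_one _
  have hf : MDifferentiableWithinAt 𝓘(ℝ, EΓ) 𝓘(ℝ, ℝ)
      (fun k => S.L (G.mul (G.inv k) (S.emb c))) (G.src ⁻¹' {G.src (S.emb c)})
      (G.one (G.src (S.emb c))) :=
    ((S.smooth_L _).comp_contMDiffWithinAt _ (G.contMDiffWithinAt_mul hmem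
      (G.contMDiff_inv _).contMDiffWithinAt contMDiffWithinAt_const
      (fun y hy => (G.tgt_inv y).trans hy))).mdifferentiableWithinAt (by simp)
  have h2 := (ha.comp_mfderivWithin hf has).hasDerivAt
  rw [rightField, dirDeriv_neg]
  exact congrArg Neg.neg (h2.unique h1)

/-- `F⁺(g)` is the derivative of `L` along the left-invariant fields of the sections of `D_c`. -/
theorem legendrePlus_apply (c : C) (x₀ : M) (v : FD) :
    (S.legendrePlus c).2 (constSection D x₀ v (S.legendrePlus c).proj) =
      dirDeriv S.L (S.emb c) (G.leftField (S.constraintSection x₀ v) (S.emb c)) := by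
  have hm := S.incl_mem (G.tgt (S.emb c)) (constSection D x₀ v (G.tgt (S.emb c)))
  obtain ⟨b, hbc, hb, hbs⟩ := exists_curve_of_mem_algFiber hm
  have hLd := (S.smooth_L (S.emb c)).mdifferentiableAt (n := ∞) (by simp)
  have h1 := (hasVelocityAt_mul_left hb hbs).hasDerivAt_comp hLd
  have hmem : G.one (G.tgt (S.emb c)) ∈ G.src ⁻¹' {G.tgt (S.emb c)} := G.src_one _
  have hf : MDifferentiableWithinAt 𝓘(ℝ, EΓ) 𝓘(ℝ, ℝ)
      (fun k => S.L (G.mul (S.emb c) k)) (G.src ⁻¹' {G.tgt (S.emb c)})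
      (G.one (G.tgt (S.emb c))) :=
    ((S.smooth_L _).comp_contMDiffWithinAt _ (G.contMDiffWithinAt_mul hmem
      contMDiffWithinAt_const contMDiffWithinAt_id
      (fun y hy => Eq.symm hy))).mdifferentiableWithinAt (by simp)
  have h2 := (hb.comp_mfderivWithin hf hbs).hasDerivAt
  exact h2.unique h1

variable [ContMDiffVectorBundle ∞ FD D 𝓘(ℝ, EM)]

theorem contMDiffAt_legendreMinus_apply (c : C) (v : FD) :
    ContMDiffAt 𝓘(ℝ, EC) 𝓘(ℝ, ℝ) ∞
      (fun y => (S.legendreMinus y).2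
        (constSection D (S.legendreMinus c).proj v (S.legendreMinus y).proj)) c := by
  simp only [legendreMinus_apply]
  exact ((S.isAlgSectionAt_constraintSection _ v).contMDiffAt_dirDeriv_rightField S.smooth_L).comp c
    S.contMDiff_emb.contMDiffAt

theorem contMDiffAt_legendrePlus_apply (c : C) (v : FD) :
    ContMDiffAt 𝓘(ℝ, EC) 𝓘(ℝ, ℝ) ∞
      (fun y => (S.legendrePlus y).2
        (constSection D (S.legendrePlus c).proj v (S.legendrePlus y).proj)) c := by
  simp only [legendrePlus_apply]
  exact ((S.isAlgSectionAt_constraintSection _ v).contMDiffAt_dirDeriv_leftField S.smooth_L).comp c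
    S.contMDiff_emb.contMDiffAt

variable [FiniteDimensional ℝ FD]

theorem contMDiff_legendreMinus :
    ContMDiff 𝓘(ℝ, EC) (𝓘(ℝ, EM).prod 𝓘(ℝ, FD →L[ℝ] ℝ)) ∞ S.legendreMinus := fun c =>
  contMDiffAt_dual ((G.isSubmersion_src.contMDiff.comp S.contMDiff_emb) c)
    (S.contMDiffAt_legendreMinus_apply c)

theorem contMDiff_legendrePlus :
    ContMDiff 𝓘(ℝ, EC) (𝓘(ℝ, EM).prod 𝓘(ℝ, FD →L[ℝ] ℝ)) ∞ S.legendrePlus := fun c =>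
  contMDiffAt_dual ((G.isSubmersion_tgt.contMDiff.comp S.contMDiff_emb) c)
    (S.contMDiffAt_legendrePlus_apply c)

theorem mfderiv_legendreMinus_eq_zero_iff (c : C) (w : TangentSpace 𝓘(ℝ, EC) c) :
    mfderiv 𝓘(ℝ, EC) (𝓘(ℝ, EM).prod 𝓘(ℝ, FD →L[ℝ] ℝ)) S.legendreMinus c w = 0 ↔
      mfderiv 𝓘(ℝ, EC) 𝓘(ℝ, EΓ) S.emb c w ∈ G.vertSrc (S.emb c) ∧
      ∀ v : FD, dirDeriv (fun k => dirDeriv S.L k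
          (G.rightField (S.constraintSection (G.src (S.emb c)) v) k)) (S.emb c)
        (mfderiv 𝓘(ℝ, EC) 𝓘(ℝ, EΓ) S.emb c w) = 0 := by
  have he := (S.contMDiff_emb c).mdifferentiableAt (by simp)
  have h1 := G.isSubmersion_src.contMDiff.comp S.contMDiff_emb
  rw [mfderiv_dual_eq_zero_iff (h1 c) (S.contMDiffAt_legendreMinus_apply c)]
  have hs := HasMFDerivAt.comp c
    ((G.isSubmersion_src.contMDiff (S.emb c)).mdifferentiableAt (by simp)).hasMFDerivAt
    he.hasMFDerivAt
  refine and_congr ?_ (forall_congr' fun v => ?_)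
  · rw [mem_vertSrc]
    exact Eq.congr_left (congrArg (fun A : EC →L[ℝ] EM => A w) hs.mfderiv)
  · have hd := HasMFDerivAt.comp c (((S.isAlgSectionAt_constraintSection (G.src (S.emb c))
      v).contMDiffAt_dirDeriv_rightField S.smooth_L).mdifferentiableAt (by simp)).hasMFDerivAt
      he.hasMFDerivAt
    have hd' := hd.congr_of_eventuallyEq (Eventually.of_forall fun y =>
      S.legendreMinus_apply y (S.legendreMinus c).proj v)
    exact Eq.congr_left (congrArg (fun A : EC →L[ℝ] ℝ => A w) hd'.mfderiv)

theorem mfderiv_legendrePlus_eq_zero_iff (c : C) (w : TangentSpace 𝓘(ℝ, EC) c) :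
    mfderiv 𝓘(ℝ, EC) (𝓘(ℝ, EM).prod 𝓘(ℝ, FD →L[ℝ] ℝ)) S.legendrePlus c w = 0 ↔
      mfderiv 𝓘(ℝ, EC) 𝓘(ℝ, EΓ) S.emb c w ∈ G.vertTgt (S.emb c) ∧
      ∀ v : FD, dirDeriv (fun k => dirDeriv S.L k
          (G.leftField (S.constraintSection (G.tgt (S.emb c)) v) k)) (S.emb c)
        (mfderiv 𝓘(ℝ, EC) 𝓘(ℝ, EΓ) S.emb c w) = 0 := by
  have he := (S.contMDiff_emb c).mdifferentiableAt (by simp)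
  have h1 := G.isSubmersion_tgt.contMDiff.comp S.contMDiff_emb
  rw [mfderiv_dual_eq_zero_iff (h1 c) (S.contMDiffAt_legendrePlus_apply c)]
  have hs := HasMFDerivAt.comp c
    ((G.isSubmersion_tgt.contMDiff (S.emb c)).mdifferentiableAt (by simp)).hasMFDerivAt
    he.hasMFDerivAt
  refine and_congr ?_ (forall_congr' fun v => ?_)
  · rw [mem_vertTgt]
    exact Eq.congr_left (congrArg (fun A : EC →L[ℝ] EM => A w) hs.mfderiv)
  · have hd := HasMFDerivAt.comp c (((S.isAlgSectionAt_constraintSection (G.tgt (S.emb c))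
      v).contMDiffAt_dirDeriv_leftField S.smooth_L).mdifferentiableAt (by simp)).hasMFDerivAt
      he.hasMFDerivAt
    have hd' := hd.congr_of_eventuallyEq (Eventually.of_forall fun y =>
      S.legendrePlus_apply y (S.legendrePlus c).proj v)
    exact Eq.congr_left (congrArg (fun A : EC →L[ℝ] ℝ => A w) hd'.mfderiv)

variable [FiniteDimensional ℝ EΓ] [FiniteDimensional ℝ EM] [T2Space M] [IsManifold 𝓘(ℝ, EM) ∞ M]

/-- The kernel of `T_hF⁻` consists of the vectors of `T_hM_c ∩ V_hα` that are `Ω_L`-orthogonal to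
`D_c(α(h))`: the derivative of `→XL` along `←Y` is a value of `Ω_L`. -/
theorem mfderiv_legendreMinus_injective_iff (c : C) :
    (∀ w, mfderiv 𝓘(ℝ, EC) (𝓘(ℝ, EM).prod 𝓘(ℝ, FD →L[ℝ] ℝ)) S.legendreMinus c w = 0 → w = 0) ↔
    {b | b ∈ S.leftE c ∧
      ∀ a ∈ S.constraint (G.src (S.emb c)), G.gForm S.L (S.emb c) a b = 0} = {0} := by
  obtain ⟨Ω, hskew, hΩ, -, -, hd⟩ := exists_omega_bilinear (G := G) S.smooth_L (S.emb c)
  rw [leftE_gForm_eq_zero_iff hΩ]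
  have key : ∀ Y ∈ G.vertSrc (S.emb c), ∀ v : FD, dirDeriv (fun k => dirDeriv S.L k
      (G.rightField (S.constraintSection (G.src (S.emb c)) v) k)) (S.emb c) Y =
      Ω (G.tangentRightInv (S.emb c)
        (S.constraintSection (G.src (S.emb c)) v (G.src (S.emb c))), 0) (0, Y) := by
    intro Y hY v
    obtain ⟨Z, rfl⟩ := exists_leftField_eq hY
    have hX := S.isAlgSectionAt_constraintSection (G.src (S.emb c)) v
    have hZ := Z.isAlgSectionAt (G.tgt (S.emb c))
    have h := hd _ _ hX hZ
    rw [dirDeriv_leftField_rightField_comm S.smooth_L hX hZ] at h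
    have hneg : ((G.rightField (S.constraintSection (G.src (S.emb c)) v) (S.emb c), 0) :
        TangentSpace 𝓘(ℝ, EΓ) (S.emb c) × TangentSpace 𝓘(ℝ, EΓ) (S.emb c)) =
        -(G.tangentRightInv (S.emb c)
          (S.constraintSection (G.src (S.emb c)) v (G.src (S.emb c))), 0) :=
      Prod.ext rfl neg_zero.symm
    rw [hneg, map_neg, LinearMap.neg_apply, neg_inj] at h
    exact h.symm
  constructor
  · rintro h _ ⟨hy, Y, hY, rfl⟩ hxy
    obtain ⟨w, rfl⟩ : Y ∈ S.tangentC c := (congrArg (· ∈ S.tangentC c) (anchor_inr Y)).mp hy.2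
    have hw : w = 0 := by
      refine h w ((S.mfderiv_legendreMinus_eq_zero_iff c w).2 ⟨hY, fun v => ?_⟩)
      refine (key _ hY v).trans (hxy _ ⟨_, ?_, rfl⟩)
      exact S.mem_constraint_iff.2 ⟨v, rfl⟩
    rw [hw, map_zero, map_zero]
  · intro h w hw
    obtain ⟨hY, hv⟩ := (S.mfderiv_legendreMinus_eq_zero_iff c w).1 hw
    have h0 := h (0, mfderiv 𝓘(ℝ, EC) 𝓘(ℝ, EΓ) S.emb c w) ⟨⟨⟨zero_mem _, hY⟩,
      (congrArg (· ∈ S.tangentC c) (anchor_inr _)).mpr ⟨w, rfl⟩⟩, _, hY, rfl⟩ (by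
        rintro _ ⟨a, ha, rfl⟩
        obtain ⟨v, rfl⟩ := S.mem_constraint_iff.1 ha
        exact (key _ hY v).symm.trans (hv v))
    exact S.mfderiv_emb_injective c ((congrArg Prod.snd h0).trans (map_zero _).symm)

/-- The kernel of `T_gF⁺` consists of the vectors of `T_gM_c ∩ V_gβ` that are `Ω_L`-orthogonal to
`D_c(β(g))`: the derivative of `←YL` along `→X` is a value of `Ω_L`. -/
theorem mfderiv_legendrePlus_injective_iff (c : C) :
    (∀ w, mfderiv 𝓘(ℝ, EC) (𝓘(ℝ, EM).prod 𝓘(ℝ, FD →L[ℝ] ℝ)) S.legendrePlus c w = 0 → w = 0) ↔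
    {a | a ∈ S.rightE c ∧
      ∀ b ∈ S.constraint (G.tgt (S.emb c)), G.gForm S.L (S.emb c) a b = 0} = {0} := by
  obtain ⟨Ω, hskew, hΩ, -, -, hd⟩ := exists_omega_bilinear (G := G) S.smooth_L (S.emb c)
  rw [rightE_gForm_eq_zero_iff hskew hΩ]
  have key : ∀ X ∈ G.vertTgt (S.emb c), ∀ v : FD, dirDeriv (fun k => dirDeriv S.L k
      (G.leftField (S.constraintSection (G.tgt (S.emb c)) v) k)) (S.emb c) X =
      Ω (0, G.tangentLeft (S.emb c)
        (S.constraintSection (G.tgt (S.emb c)) v (G.tgt (S.emb c)))) (X, 0) := by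
    intro X hX v
    obtain ⟨Z, rfl⟩ := exists_rightField_eq hX
    have h := hd _ _ (Z.isAlgSectionAt (G.src (S.emb c)))
      (S.isAlgSectionAt_constraintSection (G.tgt (S.emb c)) v)
    rw [hskew, neg_inj] at h
    exact h.symm
  constructor
  · rintro h _ ⟨hy, X, hX, rfl⟩ hxy
    obtain ⟨w, rfl⟩ : X ∈ S.tangentC c := (congrArg (· ∈ S.tangentC c) (anchor_inl X)).mp hy.2
    have hw : w = 0 := by
      refine h w ((S.mfderiv_legendrePlus_eq_zero_iff c w).2 ⟨hX, fun v => ?_⟩)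
      refine (key _ hX v).trans (hxy _ ⟨_, ?_, rfl⟩)
      exact S.mem_constraint_iff.2 ⟨v, rfl⟩
    rw [hw, map_zero, map_zero]
  · intro h w hw
    obtain ⟨hX, hv⟩ := (S.mfderiv_legendrePlus_eq_zero_iff c w).1 hw
    have h0 := h (mfderiv 𝓘(ℝ, EC) 𝓘(ℝ, EΓ) S.emb c w, 0) ⟨⟨⟨hX, zero_mem _⟩,
      (congrArg (· ∈ S.tangentC c) (anchor_inl _)).mpr ⟨w, rfl⟩⟩, _, hX, rfl⟩ (by
        rintro _ ⟨b, hb, rfl⟩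
        obtain ⟨v, rfl⟩ := S.mem_constraint_iff.1 hb
        exact (key _ hX v).symm.trans (hv v))
    exact S.mfderiv_emb_injective c ((congrArg Prod.fst h0).trans (map_zero _).symm)

end DiscreteNonholonomicSystem

namespace DiscreteNonholonomicSystem

open Module

variable {EΓ EM Γ M : Type*}
  [NormedAddCommGroup EΓ] [NormedSpace ℝ EΓ] [NormedAddCommGroup EM] [NormedSpace ℝ EM]
  [FiniteDimensional ℝ EM]
  [TopologicalSpace Γ] [ChartedSpace EΓ Γ] [IsManifold 𝓘(ℝ, EΓ) ∞ Γ]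
  [TopologicalSpace M] [ChartedSpace EM M]
  {G : LieGroupoid EΓ EM Γ M}
  {EC C : Type*} [NormedAddCommGroup EC] [NormedSpace ℝ EC]
  [TopologicalSpace C] [ChartedSpace EC C]
  {FD : Type*} [NormedAddCommGroup FD] [NormedSpace ℝ FD] [FiniteDimensional ℝ FD]
  {D : M → Type*} [∀ x, AddCommGroup (D x)] [∀ x, Module ℝ (D x)]
  [∀ x, TopologicalSpace (D x)] [TopologicalSpace (Bundle.TotalSpace FD D)]
  [FiberBundle FD D]

/-- `dim M_c = dim D_c^*`. -/
theorem finrank_eq_finrank_dual (S : DiscreteNonholonomicSystem G EC C FD D) :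
    finrank ℝ EC = finrank ℝ (EM × (FD →L[ℝ] ℝ)) := by
  rw [S.finrank_eq, finrank_prod,
    ← (LinearMap.toContinuousLinearMap : (FD →ₗ[ℝ] ℝ) ≃ₗ[ℝ] FD →L[ℝ] ℝ).finrank_eq]
  exact congrArg _ Subspace.dual_finrank_eq.symm

end DiscreteNonholonomicSystem

end

theorem theorem3p8
    {EΓ EM EC FD Γ M C : Type*}
    [NormedAddCommGroup EΓ] [NormedSpace ℝ EΓ] [FiniteDimensional ℝ EΓ]
    [NormedAddCommGroup EM] [NormedSpace ℝ EM] [FiniteDimensional ℝ EM]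
    [NormedAddCommGroup EC] [NormedSpace ℝ EC] [FiniteDimensional ℝ EC]
    [NormedAddCommGroup FD] [NormedSpace ℝ FD] [FiniteDimensional ℝ FD]
    [TopologicalSpace Γ] [T2Space Γ] [ChartedSpace EΓ Γ] [IsManifold 𝓘(ℝ, EΓ) ∞ Γ]
    [TopologicalSpace M] [T2Space M] [ChartedSpace EM M] [IsManifold 𝓘(ℝ, EM) ∞ M]
    [TopologicalSpace C] [ChartedSpace EC C] [IsManifold 𝓘(ℝ, EC) ∞ C]
    {D : M → Type*} [∀ x, AddCommGroup (D x)] [∀ x, Module ℝ (D x)]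
    [∀ x, TopologicalSpace (D x)]
    [TopologicalSpace (Bundle.TotalSpace FD D)] [FiberBundle FD D] [VectorBundle ℝ FD D]
    [ContMDiffVectorBundle ∞ FD D 𝓘(ℝ, EM)]
    (G : LieGroupoid EΓ EM Γ M) (S : DiscreteNonholonomicSystem G EC C FD D) :
    List.TFAE [
      IsLocalDiffeomorph 𝓘(ℝ, EC) (𝓘(ℝ, EM).prod 𝓘(ℝ, FD →L[ℝ] ℝ)) ∞ S.legendreMinus,
      ∀ c : C, (S.anchorPre c : Set _) ∩ S.orth (S.emb c) (S.subF (S.emb c)) = {0},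
      ∀ c : C, Module.finrank ℝ (S.subH c) = 2 * Module.finrank ℝ FD ∧
        LieGroupoid.NondegenerateOn (G.omega S.L (S.emb c)) (S.subH c),
      ∀ c : C, {b | b ∈ S.leftE c ∧
        ∀ a ∈ S.constraint (G.src (S.emb c)), G.gForm S.L (S.emb c) a b = 0} = {0}] ∧
    List.TFAE [
      IsLocalDiffeomorph 𝓘(ℝ, EC) (𝓘(ℝ, EM).prod 𝓘(ℝ, FD →L[ℝ] ℝ)) ∞ S.legendrePlus,
      ∀ c : C, (S.anchorPre c : Set _) ∩ S.orth (S.emb c) (S.subFbar (S.emb c)) = {0},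
      ∀ c : C, Module.finrank ℝ (S.subHbar c) = 2 * Module.finrank ℝ FD ∧
        LieGroupoid.NondegenerateOn (G.omega S.L (S.emb c)) (S.subHbar c),
      ∀ c : C, {a | a ∈ S.rightE c ∧
        ∀ b ∈ S.constraint (G.tgt (S.emb c)), G.gForm S.L (S.emb c) a b = 0} = {0}] := by
  constructor
  · tfae_have 1 ↔ 4 :=
      (isLocalDiffeomorph_iff_mfderiv S.contMDiff_legendreMinus S.finrank_eq_finrank_dual).trans
        (forall_congr' S.mfderiv_legendreMinus_injective_iff)
    tfae_have 2 ↔ 4 := forall_congr' S.anchorPre_inter_orth_subF_iff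
    tfae_have 3 ↔ 4 := forall_congr' S.finrank_subH_and_nondegenerateOn_iff
    tfae_finish
  · tfae_have 1 ↔ 4 :=
      (isLocalDiffeomorph_iff_mfderiv S.contMDiff_legendrePlus S.finrank_eq_finrank_dual).trans
        (forall_congr' S.mfderiv_legendrePlus_injective_iff)
    tfae_have 2 ↔ 4 := forall_congr' S.anchorPre_inter_orth_subFbar_iff
    tfae_have 3 ↔ 4 := forall_congr' S.finrank_subHbar_and_nondegenerateOn_iff
    tfae_finish
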